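/- **Setting.** Let $0<d_{\min}<d_{\max}$, and let $\lambda_\ell,\lambda_r\ge 0$ be bounded measurable functions on $[d_{\min},\infty]$ such that $\lambda:=\lambda_\ell+\lambda_r$ satisfies: $\lambda(d)>0$ if and only if $d\in[d_{\min},d_{\max})$; and $d+d'\ge d_{\max}$ whenever $d,d'\ge d_{\min}$. For probability measures $\nu$ on $\mathbb R$ and $\mu$ on $[d_{\min},\infty)$, $\mathrm{Ren}(\nu,\mu)$ denotes the law of the random locally finite set $\{x_0<x_1<x_2<\cdots\}$ for which $x_0,\,x_1-x_0,\,x_2-x_1,\dots$ are independent, $x_0$ has law $\nu$ and all the differences have law $\mu$. The one-epoch coalescence process $(\xi(t))_{t\ge0}$ with initial law $\mathcal Q$ is the following process. Given the initial configuration $\xi(0)$, which has law $\mathcal Q$, each bounded interval $[x,x']$ between consecutive points of $\xi(0)$, of length $d=x'-x$, independently of the others rings at an exponential time of parameter $\lambda(d)$ (never, if $\lambda(d)=0$). If both $x$ and $x'$ are still present just before that time, then one of them is removed: $x$ with probability $\lambda_r(d)/\lambda(d)$ and $x'$ with probability $\lambda_\ell(d)/\lambda(d)$, independently of everything else. No other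 point is removed. Let $\xi(\infty)=\bigcap_{t\ge0}\xi(t)$, and let $\mathcal Q_t$ be the law of $\xi(t)$, $t\in[0,\infty]$. **Theorem (Recursive identities).** Let $\nu$ and $\mu$ be probability measures on $\mathbb R$ and $[d_{\min},\infty)$, and let $\mathcal Q=\mathrm{Ren}(\nu,\mu)$. Then there are probability measures $\nu_t$ on $\mathbb R$ and $\mu_t$ on $[d_{\min},\infty)$, $t\in[0,\infty]$, with $\nu_0=\nu$, $\mu_0=\mu$ and $\mathcal Q_t=\mathrm{Ren}(\nu_t,\mu_t)$ for all $t\in[0,\infty]$, and they satisfy the following. (i) Let $G_t(s)=\int_{[d_{\min},\infty)}e^{-sx}\,\mu_t(dx)$ and $H_t(s)=\int_{[d_{\min},d_{\max})}e^{-sx}\,\mu_t(dx)$. For every $s\in\mathbb R_+\cup i\mathbb R$, $$1-G_\infty(s)=\bigl(1-G_0(s)\bigr)\,e^{H_0(s)}.$$ (ii) Let $L_t(s)=\int_{\mathbb R}e^{-sx}\,\nu_t(dx)$, which is a complex number for $s\in i\mathbb R$ and an element of $[0,\infty]$ for $s\in\mathbb R_+$. (a) If $\lambda_r\equiv0$,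 then $\nu_t=\nu_0$, and hence $L_t=L_0$ on $\mathbb R_+\cup i\mathbb R$, for all $t\in[0,\infty]$. (b) If $\lambda_\ell=\gamma\lambda_r$ for some $\gamma\in[0,\infty)$, then for every $s\in\mathbb R_+\cup i\mathbb R$ (as an identity in $[0,\infty]$ when $s\in\mathbb R_+$) $$L_\infty(s)=L_0(s)\exp\Bigl\{\frac{H_0(s)-H_0(0)}{1+\gamma}\Bigr\}.$$ Moreover the first point $x_0(0)$ of $\xi(0)$ satisfies $$\mathbb P_{\mathcal Q}\bigl(x_0(0)\in\xi(\infty)\bigr)=e^{-H_0(0)/(1+\gamma)}.$$ -/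

import Mathlib

open MeasureTheory ProbabilityTheory
open scoped NNReal ENNReal

noncomputable section

namespace Coalescence

/-! ### Configurations -/

/-- The set of locally finite subsets of the line. -/
def Config : Type := {ξ : Set ℝ // ∀ a b : ℝ, (ξ ∩ Set.Icc a b).Finite}

/-- The σ-algebra on configurations generated by the numbers of points in bounded Borel sets. -/
instance : MeasurableSpace Config :=
  MeasurableSpace.generateFrom
    {S | ∃ (A : Set ℝ) (n : ℕ), MeasurableSet A ∧ Bornology.IsBounded A ∧
      S = {ξ : Config | (ξ.1 ∩ A).ncard = n}}

/-- The points `x₀, x₀ + d₁, x₀ + d₁ + d₂, …`; here `p.2 i` is the gap `d_{i+1}`. -/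
def renewalPoint (p : ℝ × (ℕ → ℝ)) (k : ℕ) : ℝ := p.1 + ∑ i ∈ Finset.range k, p.2 i

open Classical in
/-- The configuration `{x₀, x₀ + d₁, …}`. (It is replaced by the empty one when the points
accumulate, which happens with probability zero for i.i.d. positive gaps.) -/
def renewalConfig (p : ℝ × (ℕ → ℝ)) : Config :=
  if h : ∀ a b : ℝ, (Set.range (renewalPoint p) ∩ Set.Icc a b).Finite then
    ⟨Set.range (renewalPoint p), h⟩
  else ⟨∅, fun a b => by simp⟩

/-- `Ren(ν, μ)`: the law of the right renewal point process, whose first point has law `ν` and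
whose successive gaps have law `μ`, all these variables being independent. -/
def Ren (ν μ : ProbabilityMeasure ℝ) : Measure Config :=
  ((ν : Measure ℝ).prod (Measure.infinitePi fun _ : ℕ => (μ : Measure ℝ))).map renewalConfig

/-! ### The one-epoch coalescence process

It is constructed from the domain dynamics. `rateL d` and `rateR d` are the rates at which a point
is erased by the domain of length `d` on its left, respectively on its right. So a domain
`[x, x']` of length `d` erases its left extreme `x` at rate `rateR d` and its right extreme `x'`
at rate `rateL d`. The rates are positive exactly on `[dmin, dmax)` and all initial domains have
length at least `dmin ≥ dmax / 2`. Hence unbounded domains, and domains formed by a coalescence (of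
length at least `dmax`), have rate zero: only the domains of the initial configuration ever act. -/

/-- `[x, x']` is a (bounded) domain of `ξ`: its extremes are consecutive points of `ξ`. -/
def IsDomain (ξ : Config) (x x' : ℝ) : Prop :=
  x ∈ ξ.1 ∧ x' ∈ ξ.1 ∧ x < x' ∧ ∀ y ∈ ξ.1, ¬ (x < y ∧ y < x')

/-- The label of a point of `ξ`: points are numbered increasingly, the smallest positive one
being number `1` and the largest nonpositive one number `0`. A bounded domain carries the label
of its left extreme. -/
def label (ξ : Config) (x : ℝ) : ℤ :=
  if 0 < x then ((ξ.1 ∩ Set.Ioc 0 x).ncard : ℤ) else -((ξ.1 ∩ Set.Ioc x 0).ncard : ℤ)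

/-- The marks: for each label, a clock variable and a coin variable. -/
abbrev Marks : Type := ℤ → ℝ × unitInterval

/-- The marks are independent; the clock variables are exponential of parameter `1` and the coin
variables are uniform on `[0, 1]`. -/
def marksLaw : Measure Marks :=
  haveI : IsProbabilityMeasure (expMeasure 1) := isProbabilityMeasure_expMeasure one_pos
  Measure.infinitePi fun _ : ℤ => (expMeasure 1).prod (volume : Measure unitInterval)

/-- The domain `[x, x']` of the initial configuration `ζ` rings at time `s`. Its ring time, the
clock variable divided by the total rate, is exponential with parameter the total rate; a domain
of total rate zero never rings. -/
def RingsAt (rateL rateR : ℝ → ℝ) (ζ : Config) (ω : Marks) (x x' : ℝ) (s : ℝ≥0) : Prop :=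
  0 < rateL (x' - x) + rateR (x' - x) ∧
    (s : ℝ) = (ω (label ζ x)).1 / (rateL (x' - x) + rateR (x' - x))

/-- The coin of the domain `[x, x']` tells it to erase its left extreme `x`; this has probability
`rateR d / (rateL d + rateR d)`, where `d = x' - x`. Otherwise it has to erase `x'`. -/
def CoinLeft (rateL rateR : ℝ → ℝ) (ζ : Config) (ω : Marks) (x x' : ℝ) : Prop :=
  ((ω (label ζ x)).2 : ℝ) ≤ rateR (x' - x) / (rateL (x' - x) + rateR (x' - x))

/-- The point `x` is erased at time `s` along the path `ξ` started from `ζ`: a domain of `ζ` having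
`x` as an extreme rings at time `s`, it still exists just before time `s` (both its extremes are
present at all earlier times), and its coin designates `x`. -/
def ErasedAt (rateL rateR : ℝ → ℝ) (ζ : Config) (ω : Marks) (ξ : ℝ≥0 → Config)
    (x : ℝ) (s : ℝ≥0) : Prop :=
  (∃ x', IsDomain ζ x x' ∧ RingsAt rateL rateR ζ ω x x' s ∧ CoinLeft rateL rateR ζ ω x x' ∧
      ∀ r < s, x ∈ (ξ r).1 ∧ x' ∈ (ξ r).1) ∨
  (∃ y, IsDomain ζ y x ∧ RingsAt rateL rateR ζ ω y x s ∧ ¬ CoinLeft rateL rateR ζ ω y x ∧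
      ∀ r < s, y ∈ (ξ r).1 ∧ x ∈ (ξ r).1)

/-- The path `ξ` follows the domain dynamics started from `ζ` and driven by the marks `ω`. -/
def FollowsDynamics (rateL rateR : ℝ → ℝ) (ζ : Config) (ω : Marks) (ξ : ℝ≥0 → Config) : Prop :=
  ∀ (t : ℝ≥0) (x : ℝ),
    x ∈ (ξ t).1 ↔ x ∈ ζ.1 ∧ ¬ ∃ s ≤ t, ErasedAt rateL rateR ζ ω ξ x s

open Classical in
/-- The path of the process: the unique path that follows the dynamics. (Outside the almost sure
event on which there is exactly one such path, the path is taken to be constant.) -/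
def path (rateL rateR : ℝ → ℝ) (ζ : Config) (ω : Marks) : ℝ≥0 → Config :=
  if h : ∃! ξ : ℝ≥0 → Config, FollowsDynamics rateL rateR ζ ω ξ then h.choose else fun _ => ζ

/-- The state of the process at a time `t ∈ [0, ∞]`. Since points are only removed, the limit as
`t → ∞` is the set of the points that are never removed. -/
def state (rateL rateR : ℝ → ℝ) (ζ : Config) (ω : Marks) (t : ℝ≥0∞) : Config :=
  if t = ⊤ then
    ⟨⋂ r : ℝ≥0, (path rateL rateR ζ ω r).1, fun a b =>
      ((path rateL rateR ζ ω 0).2 a b).subset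
        (Set.inter_subset_inter_left _ (Set.iInter_subset _ 0))⟩
  else path rateL rateR ζ ω t.toNNReal

/-- The law `𝒬_t` of the process at time `t ∈ [0, ∞]`, for the initial law `𝒬 = Q`: the marks are
independent of the initial configuration. -/
def lawAt (rateL rateR : ℝ → ℝ) (Q : Measure Config) (t : ℝ≥0∞) : Measure Config :=
  (Q.prod marksLaw).map fun p => state rateL rateR p.1 p.2 t

/-- For the process with initial law `Q`, the probability that the first point of the initial
configuration is never removed. -/
def firstPointSurvival (rateL rateR : ℝ → ℝ) (Q : Measure Config) : ℝ≥0∞ :=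
  (Q.prod marksLaw) {p | ∃ x, IsLeast p.1.1 x ∧ x ∈ (state rateL rateR p.1 p.2 ⊤).1}

/-! ### Laplace transforms -/

/-- `∫_A e^{-sx} m(dx)` for complex `s`. -/
def laplace (m : ProbabilityMeasure ℝ) (A : Set ℝ) (s : ℂ) : ℂ :=
  ∫ x in A, Complex.exp (-s * (x : ℂ)) ∂(m : Measure ℝ)

/-- `∫_A e^{-sx} m(dx)` for real `s`, as a real number. -/
def laplaceReal (m : ProbabilityMeasure ℝ) (A : Set ℝ) (s : ℝ) : ℝ :=
  ∫ x in A, Real.exp (-s * x) ∂(m : Measure ℝ)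

/-- `∫ e^{-sx} m(dx)` for real `s`, as an element of `[0, ∞]`. -/
def laplaceExt (m : ProbabilityMeasure ℝ) (s : ℝ) : ℝ≥0∞ :=
  ∫⁻ x, ENNReal.ofReal (Real.exp (-s * x)) ∂(m : Measure ℝ)

end Coalescence

end

noncomputable section

namespace Coalescence

/-! ### Erasures along a sequence of domains -/

/-! Number the initial points 0, 1, 2, … and let domain `i` lie between points `i` and `i + 1`. Its
length, clock and coin form one letter, and the letters are i.i.d. Ring times are almost surely
distinct and not eventually monotone (`ae_good`), so every chain of influences between neighbouring
domains is finite and the dynamics has exactly one solution.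

Decoupling. Domain `i` can fail to erase point `i`, when its coin says so, only because point `i +
1` was lost earlier to domain `i + 1`, or because point `i` itself was lost earlier, which does not
matter for the fate of point `i`. So point `i` disappears if and only if it would be erased by the
domains on its right alone (`RightErasedLim`) or by those on its left alone (`LeftErased`), and each
of these obeys a one-step recursion. Silencing the domains that ring after time `t` only changes the
rules, so all times are treated together.

Renewal structure. Let A (`survSet`) be the event that the initial point is not erased from the
right. The first survivor is point `k` exactly when the first `k` letters satisfy `FirstEvent` and
the letters after them lie in A. Hence the position of the first survivor is independent of what
follows, and what follows is i.i.d. conditioned on A (`map_stopped`). The same holds at the next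
survivor, so iteration (`measurePreserving_iterate`) gives i.i.d. gaps, and the state at time `t` is
again a renewal process.

Identities. Put g = E[e^{-sd}], and let l and r be the same expectation restricted to the domains
that are to erase their left, respectively right, extreme. For finitely many domains, let F_n, E_n,
K_n be the integrals of e^{-s(d_1+…+d_n)} over `FirstEvent`, `NextEvent` and non-erasure of the
initial point from the right. `FirstEvent` at n means n left-erasing domains with increasing ring
times; by exchangeability F_n = l^n/n!. Splitting at the first survivor gives g^n = Σ F_k K_{n-k}.
Splitting at the next one gives K_n = Σ E_k K_{n-k} + r^n/n!, where the last term is the case of no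
other survivor: n right-erasing domains with decreasing ring times. As power series, e^{lX} K =
1/(1-gX) and (1-E) K = e^{rX}, so 1 - E = (1-gX) e^{(l+r)X}. At X = 1 and t = ∞, where l + r =
H_0(s), this is the identity for the gaps (`hasSum_nextEvent`).

The displacement to the first survivor has transform P(A) e^{l(s)}, and s = 0 forces P(A) =
e^{-l(0)}; this is also the survival probability of the first point. When the rates are proportional
the coin does not depend on the length, so l = H_0/(1+γ). Only Re s ≥ 0 is needed throughout. -/

/-- How a domain acts: the time at which it rings, and whether it is to erase its left extreme or
its right extreme (or neither of them). -/
structure Rules (α : Type*) where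
  /-- the ring time -/
  time : α → ℝ
  /-- the domains that are to erase their left extreme -/
  left : Set α
  /-- the domains that are to erase their right extreme -/
  right : Set α
  /-- no domain erases both its extremes -/
  disj : ∀ a, a ∈ left → a ∉ right

/-- Drop the first `k` terms. -/
def shift {α : Type*} (k : ℕ) (y : ℕ → α) : ℕ → α := fun i => y (k + i)

/-- The first `k` terms of `y`, followed by those of `z`. -/
def splice {α : Type*} (k : ℕ) (y z : ℕ → α) : ℕ → α := fun i => if i < k then y i else z (i - k)

section Sequences

variable {α : Type*}

theorem shift_shift (j k : ℕ) (y : ℕ → α) : shift j (shift k y) = shift (k + j) y := by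
  funext i; simp [shift, add_assoc]

@[simp] theorem shift_zero (y : ℕ → α) : shift 0 y = y := by
  funext i; simp [shift]

theorem shift_splice (k : ℕ) (y z : ℕ → α) : shift k (splice k y z) = z := by
  funext i; simp [shift, splice]

theorem splice_of_lt {k i : ℕ} (h : i < k) (y z : ℕ → α) : splice k y z i = y i := by
  simp [splice, h]

end Sequences

namespace Rules

variable {α : Type*} (𝓡 : Rules α)

/-- Point number `i` is erased by the domains on its right, when only the `n` domains that follow
it are present. -/
def RightErased (y : ℕ → α) : ℕ → ℕ → Prop
  | 0, _ => False
  | n + 1, i => y i ∈ 𝓡.left ∧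
      ¬ (RightErased y n (i + 1) ∧ 𝓡.time (y (i + 1)) < 𝓡.time (y i))

/-- Point number `i` is erased by the domains on its left. -/
def LeftErased (y : ℕ → α) : ℕ → Prop
  | 0 => False
  | i + 1 => y i ∈ 𝓡.right ∧ ¬ (LeftErased y i ∧ 𝓡.time (y (i - 1)) < 𝓡.time (y i))

/-- Point number `i` is erased by the domains on its right. -/
def RightErasedLim (y : ℕ → α) (i : ℕ) : Prop := ∃ N, ∀ n ≥ N, 𝓡.RightErased y n i

/-- Point number `i` is never erased. -/
def Surv (y : ℕ → α) (i : ℕ) : Prop := ¬ 𝓡.LeftErased y i ∧ ¬ 𝓡.RightErasedLim y i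

/-- Given that point number `k` survives on its right, it is the first survivor. -/
def FirstEvent (y : ℕ → α) (k : ℕ) : Prop :=
  ¬ 𝓡.LeftErased y k ∧ ∀ i < k, 𝓡.LeftErased y i ∨ 𝓡.RightErased y (k - i) i

/-- Given that point number `k` survives on its right, it is the next survivor after the initial
point, which survives as well. -/
def NextEvent (y : ℕ → α) (k : ℕ) : Prop :=
  0 < k ∧ ¬ 𝓡.RightErased y k 0 ∧ ¬ 𝓡.LeftErased y k ∧
    ∀ i, 0 < i → i < k → 𝓡.LeftErased y i ∨ 𝓡.RightErased y (k - i) i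

/-- The initial point is the only survivor among those of the first `n` domains. -/
def LastEvent (y : ℕ → α) (n : ℕ) : Prop :=
  ¬ 𝓡.RightErased y n 0 ∧ ∀ i, 0 < i → i ≤ n → 𝓡.LeftErased y i ∨ 𝓡.RightErased y (n - i) i

/-- The ring times are distinct, and not monotone from some index on. -/
structure Good (y : ℕ → α) : Prop where
  inj : ∀ i j, i ≠ j → 𝓡.time (y i) ≠ 𝓡.time (y j)
  descent : ∀ m, ∃ i ≥ m, 𝓡.time (y (i + 1)) < 𝓡.time (y i)
  ascent : ∀ m, ∃ i ≥ m, 𝓡.time (y i) < 𝓡.time (y (i + 1))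

variable {𝓡}

theorem Good.shift {y : ℕ → α} (h : 𝓡.Good y) (k : ℕ) : 𝓡.Good (shift k y) where
  inj i j hij := h.inj _ _ (by omega)
  descent m := by
    obtain ⟨i, hi, h'⟩ := h.descent (k + m)
    obtain ⟨j, rfl⟩ := Nat.exists_eq_add_of_le (show k ≤ i by omega)
    exact ⟨j, by omega, h'⟩
  ascent m := by
    obtain ⟨i, hi, h'⟩ := h.ascent (k + m)
    obtain ⟨j, rfl⟩ := Nat.exists_eq_add_of_le (show k ≤ i by omega)
    exact ⟨j, by omega, h'⟩

/-! #### Locality -/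

theorem rightErased_congr {y z : ℕ → α} {k : ℕ} (h : ∀ i < k, y i = z i) (n i : ℕ)
    (hi : i + n ≤ k) : 𝓡.RightErased y n i ↔ 𝓡.RightErased z n i := by
  induction n generalizing i with
  | zero => simp [RightErased]
  | succ n ih =>
    rw [RightErased, RightErased, h i (by omega), ih (i + 1) (by omega)]
    rcases Nat.eq_zero_or_pos n with rfl | hn
    · simp [RightErased]
    · rw [h (i + 1) (by omega)]

theorem leftErased_congr {y z : ℕ → α} {k : ℕ} (h : ∀ i < k, y i = z i) (i : ℕ) (hi : i ≤ k) :
    𝓡.LeftErased y i ↔ 𝓡.LeftErased z i := by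
  induction i with
  | zero => simp [LeftErased]
  | succ i ih => rw [LeftErased, LeftErased, h i (by omega), ih (by omega), h (i - 1) (by omega)]

/-- Locality: the event is decided by the first `k` letters, hence is independent of the tail. -/
theorem firstEvent_congr {y z : ℕ → α} {k : ℕ} (h : ∀ i < k, y i = z i) :
    𝓡.FirstEvent y k ↔ 𝓡.FirstEvent z k := by
  unfold FirstEvent
  rw [leftErased_congr h k le_rfl]
  refine and_congr_right fun _ => forall₂_congr fun i hi => ?_
  rw [leftErased_congr h i hi.le, rightErased_congr h _ _ (by omega)]

theorem nextEvent_congr {y z : ℕ → α} {k : ℕ} (h : ∀ i < k, y i = z i) :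
    𝓡.NextEvent y k ↔ 𝓡.NextEvent z k := by
  unfold NextEvent
  rw [leftErased_congr h k le_rfl, rightErased_congr h k 0 (by omega)]
  refine and_congr_right fun _ => and_congr_right fun _ => and_congr_right fun _ =>
    forall₃_congr fun i _ hi => ?_
  rw [leftErased_congr h i hi.le, rightErased_congr h _ _ (by omega)]

theorem rightErased_shift (y : ℕ → α) (k n i : ℕ) :
    𝓡.RightErased (Coalescence.shift k y) n i ↔ 𝓡.RightErased y n (k + i) := by
  induction n generalizing i with
  | zero => simp [RightErased]
  | succ n ih => rw [RightErased, RightErased, ih]; rfl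

theorem rightErasedLim_shift (y : ℕ → α) (k i : ℕ) :
    𝓡.RightErasedLim (Coalescence.shift k y) i ↔ 𝓡.RightErasedLim y (k + i) := by
  simp only [RightErasedLim, rightErased_shift]

/-- The recursion from the left starts from "not erased", so it restarts unchanged at any point that
is not left-erased. -/
theorem leftErased_shift {y : ℕ → α} {k : ℕ} (hk : ¬ 𝓡.LeftErased y k) (i : ℕ) :
    𝓡.LeftErased (Coalescence.shift k y) i ↔ 𝓡.LeftErased y (k + i) := by
  induction i with
  | zero => simpa [LeftErased] using hk
  | succ i ih =>
    rw [LeftErased, ← add_assoc, LeftErased, ih]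
    -- For `i = 0` the truncated index `i - 1` does not match `k + i - 1`, but the clause containing
    -- it is false by `hk`.
    rcases Nat.eq_zero_or_pos i with rfl | hi
    · simp [hk, Coalescence.shift]
    · rw [show k + i - 1 = k + (i - 1) by omega]; rfl

theorem surv_shift {y : ℕ → α} {k : ℕ} (hk : 𝓡.Surv y k) (i : ℕ) :
    𝓡.Surv (Coalescence.shift k y) i ↔ 𝓡.Surv y (k + i) := by
  rw [Surv, Surv, leftErased_shift hk.1, rightErasedLim_shift]

/-! #### The recursion for the erasures from the right -/

/-- `c i` tells whether point number `i` is erased from the right, for the first `n` points. -/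
def Recursion (𝓡 : Rules α) (y : ℕ → α) (n : ℕ) (c : ℕ → Prop) : Prop :=
  ∀ i < n, c i ↔ y i ∈ 𝓡.left ∧ ¬ (c (i + 1) ∧ 𝓡.time (y (i + 1)) < 𝓡.time (y i))

theorem recursion_rightErased (y : ℕ → α) (n : ℕ) :
    𝓡.Recursion y n fun i => 𝓡.RightErased y (n - i) i := by
  intro i hi
  dsimp only
  rw [show n - i = n - (i + 1) + 1 by omega, RightErased]

/-- A domain that does not ring after its right neighbour's left neighbour's turn, that is, an index
where the times do not descend, blocks all influence from further right; so adding domains beyond it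
changes nothing. -/
theorem rightErased_stable {y : ℕ → α} (m i : ℕ)
    (h : ¬ 𝓡.time (y (i + m + 1)) < 𝓡.time (y (i + m))) (n : ℕ) (hn : m + 1 ≤ n) :
    𝓡.RightErased y n i ↔ 𝓡.RightErased y (m + 1) i := by
  induction m generalizing i n with
  | zero =>
    obtain ⟨n, rfl⟩ := Nat.exists_eq_succ_of_ne_zero (show n ≠ 0 by omega)
    simp only [RightErased]
    simp_all
  | succ m ih =>
    obtain ⟨n, rfl⟩ := Nat.exists_eq_succ_of_ne_zero (show n ≠ 0 by omega)
    rw [Nat.succ_eq_add_one, RightErased, RightErased,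
      ih (i + 1) (by rwa [show i + 1 + m = i + (m + 1) by omega]) n (by omega)]

theorem Good.rightErasedLim_iff {y : ℕ → α} (h : 𝓡.Good y) (i : ℕ) :
    ∃ N, ∀ n ≥ N, 𝓡.RightErased y n i ↔ 𝓡.RightErasedLim y i := by
  obtain ⟨j, hj, h'⟩ := h.ascent i
  obtain ⟨m, rfl⟩ := Nat.exists_eq_add_of_le hj
  have hs := rightErased_stable m i (not_lt.2 h'.le)
  have : 𝓡.RightErasedLim y i ↔ 𝓡.RightErased y (m + 1) i := by
    constructor
    · rintro ⟨N, hN⟩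
      exact (hs _ (le_max_right N (m + 1))).1 (hN _ (le_max_left _ _))
    · exact fun h0 => ⟨m + 1, fun n hn => (hs n hn).2 h0⟩
  exact ⟨m + 1, fun n hn => (hs n hn).trans this.symm⟩

theorem Good.recursion {y : ℕ → α} (h : 𝓡.Good y) (n : ℕ) :
    𝓡.Recursion y n (𝓡.RightErasedLim y) := by
  intro i _
  obtain ⟨N, hN⟩ := h.rightErasedLim_iff i
  obtain ⟨M, hM⟩ := h.rightErasedLim_iff (i + 1)
  rw [← hN (max N M + 1) (by omega), ← hM (max N M) (by omega), RightErased]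

/-- A point `k` that is not erased from the right acts as an empty boundary: to its left the
recursion runs as if domain `k - 1` were the last one. This makes the events before a survivor
depend on finitely many letters. -/
theorem Recursion.iff_rightErased {y : ℕ → α} {k : ℕ} {c : ℕ → Prop} (hc : 𝓡.Recursion y k c)
    (hk : ¬ c k) (i : ℕ) (hi : i ≤ k) : c i ↔ 𝓡.RightErased y (k - i) i := by
  obtain ⟨j, rfl⟩ := Nat.exists_eq_add_of_le hi
  rw [Nat.add_sub_cancel_left]
  induction j generalizing i with
  | zero => simpa [RightErased] using hk
  | succ j ih =>
    rw [hc i (by omega), RightErased, ih (i + 1) (by rwa [show i + 1 + j = i + (j + 1) by omega])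
      (by rwa [show i + 1 + j = i + (j + 1) by omega]) (by omega)]

theorem Recursion.mono {y : ℕ → α} {k n : ℕ} {c : ℕ → Prop} (hc : 𝓡.Recursion y n c)
    (hk : k ≤ n) : 𝓡.Recursion y k c := fun i hi => hc i (by omega)

theorem Recursion.first_iff {y : ℕ → α} {k : ℕ} {c : ℕ → Prop} (hc : 𝓡.Recursion y k c) :
    ((¬ 𝓡.LeftErased y k ∧ ¬ c k) ∧ ∀ i < k, 𝓡.LeftErased y i ∨ c i) ↔
      𝓡.FirstEvent y k ∧ ¬ c k := by
  by_cases hk : c k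
  · simp [hk]
  · have : (∀ i < k, 𝓡.LeftErased y i ∨ c i) ↔
        ∀ i < k, 𝓡.LeftErased y i ∨ 𝓡.RightErased y (k - i) i :=
      forall₂_congr fun i hi => by rw [hc.iff_rightErased hk i hi.le]
    rw [this, FirstEvent]
    tauto

theorem Recursion.next_iff {y : ℕ → α} {k : ℕ} {c : ℕ → Prop} (hc : 𝓡.Recursion y k c) :
    (¬ c 0 ∧ (0 < k ∧ ¬ 𝓡.LeftErased y k ∧ ¬ c k) ∧
        ∀ i, 0 < i → i < k → 𝓡.LeftErased y i ∨ c i) ↔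
      𝓡.NextEvent y k ∧ ¬ c k := by
  by_cases hk : c k
  · simp [hk]
  · have : (∀ i, 0 < i → i < k → 𝓡.LeftErased y i ∨ c i) ↔
        ∀ i, 0 < i → i < k → 𝓡.LeftErased y i ∨ 𝓡.RightErased y (k - i) i :=
      forall₃_congr fun i _ hi => by rw [hc.iff_rightErased hk i hi.le]
    rw [this, NextEvent, hc.iff_rightErased hk 0 (by omega), Nat.sub_zero]
    tauto

/-- Point 0 has nothing on its left, so it goes to domain 0. That domain then does not erase its
right extreme, so point 1 is not left-erased either, and so on. -/
theorem Recursion.all_right {y : ℕ → α} {k : ℕ} {c : ℕ → Prop} (hc : 𝓡.Recursion y k c)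
    (h : ∀ i < k, 𝓡.LeftErased y i ∨ c i) :
    (∀ i ≤ k, ¬ 𝓡.LeftErased y i) ∧ ∀ i < k, c i := by
  have h1 : ∀ i ≤ k, ¬ 𝓡.LeftErased y i := by
    intro i
    induction i with
    | zero => simp [LeftErased]
    | succ i ih =>
      intro hi
      have hci := (h i (by omega)).resolve_left (ih (by omega))
      rw [LeftErased]
      exact fun h' => 𝓡.disj _ ((hc i (by omega)).1 hci).1 h'.1
  exact ⟨h1, fun i hi => (h i hi).resolve_left (h1 i hi.le)⟩

/-- If every point were erased, all would be erased from the right, which forces increasing ring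
times and contradicts a descent. -/
theorem Good.exists_surv {y : ℕ → α} (h : 𝓡.Good y) : ∃ i, 𝓡.Surv y i := by
  by_contra! hcon
  have hall : ∀ i, 𝓡.RightErasedLim y i := fun i =>
    ((h.recursion (i + 1)).all_right fun j _ => by
      have := hcon j
      rw [Surv] at this
      tauto).2 i (by omega)
  obtain ⟨i, -, hi⟩ := h.descent 0
  exact ((h.recursion (i + 1) i (by omega)).1 (hall i)).2 ⟨hall _, hi⟩

/-- Suppose all later points are erased. Once one is erased from the right, so are all that follow,
against a descent; otherwise all are erased from the left, against an ascent. -/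
theorem Good.exists_next_surv {y : ℕ → α} (h : 𝓡.Good y) : ∃ i, 0 < i ∧ 𝓡.Surv y i := by
  by_contra! hcon
  replace hcon : ∀ i, 0 < i → 𝓡.LeftErased y i ∨ 𝓡.RightErasedLim y i := by
    intro i hi
    have := hcon i hi
    rw [Surv] at this
    tauto
  by_cases hex : ∃ i, 0 < i ∧ 𝓡.RightErasedLim y i
  · obtain ⟨i, hi, hci⟩ := hex
    have hall : ∀ j, 𝓡.RightErasedLim y (i + j) := by
      intro j
      induction j with
      | zero => exact hci
      | succ j ih =>
        refine (hcon (i + j + 1) (by omega)).resolve_left fun h' => ?_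
        rw [LeftErased] at h'
        exact 𝓡.disj _ ((h.recursion _ (i + j) (Nat.lt_succ_self _)).1 ih).1 h'.1
    obtain ⟨m, hm, hd⟩ := h.descent i
    obtain ⟨j, rfl⟩ := Nat.exists_eq_add_of_le hm
    exact ((h.recursion _ (i + j) (Nat.lt_succ_self _)).1 (hall j)).2 ⟨hall (j + 1), hd⟩
  · push Not at hex
    obtain ⟨m, -, hm⟩ := h.ascent 0
    have h1 := (hcon (m + 1) (by omega)).resolve_right (hex _ (by omega))
    have h2 := (hcon (m + 2) (by omega)).resolve_right (hex _ (by omega))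
    rw [LeftErased] at h2
    exact h2.2 ⟨h1, hm⟩

/-! #### The enumeration of the survivors -/

variable (𝓡)

/-- The index of the first survivor. -/
def firstIdx (y : ℕ → α) : ℕ := sInf {i | 𝓡.Surv y i}

/-- The index of the first survivor after the initial point. -/
def nextIdx (y : ℕ → α) : ℕ := sInf {i | 0 < i ∧ 𝓡.Surv y i}

/-- The index of survivor number `n`. -/
def survIdx (y : ℕ → α) : ℕ → ℕ
  | 0 => 𝓡.firstIdx y
  | n + 1 => survIdx y n + 𝓡.nextIdx (Coalescence.shift (survIdx y n) y)

variable {𝓡}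

/-- The factorisation behind the renewal property: one condition on the first `k` letters, one on
the letters after them. -/
theorem Good.firstIdx_eq_iff {y : ℕ → α} (h : 𝓡.Good y) (k : ℕ) :
    𝓡.firstIdx y = k ↔ 𝓡.FirstEvent y k ∧ ¬ 𝓡.RightErasedLim (Coalescence.shift k y) 0 := by
  rw [rightErasedLim_shift, add_zero, ← (h.recursion k).first_iff]
  constructor
  · rintro rfl
    refine ⟨Nat.sInf_mem h.exists_surv, fun i hi => ?_⟩
    have : ¬ 𝓡.Surv y i := Nat.notMem_of_lt_sInf hi
    rw [Surv] at this
    tauto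
  · rintro ⟨h1, h2⟩
    refine le_antisymm (Nat.sInf_le h1) (le_csInf h.exists_surv fun i hi => ?_)
    by_contra! hlt
    have := h2 i hlt
    have h3 : 𝓡.Surv y i := hi
    rw [Surv] at h3
    tauto

theorem Good.nextIdx_eq_iff {y : ℕ → α} (h : 𝓡.Good y) (k : ℕ) :
    (¬ 𝓡.RightErasedLim y 0 ∧ 𝓡.nextIdx y = k) ↔
      𝓡.NextEvent y k ∧ ¬ 𝓡.RightErasedLim (Coalescence.shift k y) 0 := by
  rw [rightErasedLim_shift, add_zero, ← (h.recursion k).next_iff]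
  refine and_congr_right fun _ => ?_
  constructor
  · rintro rfl
    refine ⟨Nat.sInf_mem h.exists_next_surv, fun i hi0 hi => ?_⟩
    have : ¬ (0 < i ∧ 𝓡.Surv y i) := Nat.notMem_of_lt_sInf hi
    rw [Surv] at this
    tauto
  · rintro ⟨h1, h2⟩
    refine le_antisymm (Nat.sInf_le h1) (le_csInf h.exists_next_surv fun i hi => ?_)
    by_contra! hlt
    have := h2 i hi.1 hlt
    have h3 : 𝓡.Surv y i := hi.2
    rw [Surv] at h3
    tauto

theorem Good.surv_survIdx {y : ℕ → α} (h : 𝓡.Good y) (n : ℕ) : 𝓡.Surv y (𝓡.survIdx y n) := by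
  induction n with
  | zero => exact Nat.sInf_mem h.exists_surv
  | succ n ih =>
    have := Nat.sInf_mem (h.shift (𝓡.survIdx y n)).exists_next_surv
    exact (surv_shift ih _).1 this.2

theorem Good.survIdx_lt {y : ℕ → α} (h : 𝓡.Good y) (n : ℕ) :
    𝓡.survIdx y n < 𝓡.survIdx y (n + 1) := by
  have := (Nat.sInf_mem (h.shift (𝓡.survIdx y n)).exists_next_surv).1
  exact Nat.lt_add_of_pos_right this

theorem Good.exists_survIdx {y : ℕ → α} (h : 𝓡.Good y) {i : ℕ} (hi : 𝓡.Surv y i) :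
    ∃ n, 𝓡.survIdx y n = i := by
  by_contra! hne
  have hlt : ∀ n, 𝓡.survIdx y n < i := by
    intro n
    induction n with
    | zero => exact lt_of_le_of_ne (Nat.sInf_le hi) (hne 0)
    | succ n ih =>
      refine lt_of_le_of_ne ?_ (hne _)
      obtain ⟨j, rfl⟩ := Nat.exists_eq_add_of_lt ih
      have : 𝓡.nextIdx (Coalescence.shift (𝓡.survIdx y n) y) ≤ j + 1 :=
        Nat.sInf_le ⟨by omega, (surv_shift (h.surv_survIdx n) _).2 hi⟩
      rw [survIdx]
      omega
  -- A survivor missed by the enumeration would bound a strictly increasing sequence of indices.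
  have hge : ∀ n, n ≤ 𝓡.survIdx y n := by
    intro n
    induction n with
    | zero => omega
    | succ n ih => have := h.survIdx_lt n; omega
  have := hlt i
  have := hge i
  omega

/-! #### Monotone chains -/

/-- By `all_right` every point before `k` is erased by the domain on its right, and domain `i`
succeeds only if domain `i + 1` did not erase point `i + 1` earlier. -/
theorem firstEvent_iff {y : ℕ → α} {k : ℕ}
    (hy : ∀ i j, i ≠ j → 𝓡.time (y i) ≠ 𝓡.time (y j)) :
    𝓡.FirstEvent y k ↔
      (∀ i < k, y i ∈ 𝓡.left) ∧ ∀ i, i + 1 < k → 𝓡.time (y i) < 𝓡.time (y (i + 1)) := by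
  have hc := 𝓡.recursion_rightErased y k
  constructor
  · rintro ⟨-, h2⟩
    have h3 := (hc.all_right h2).2
    refine ⟨fun i hi => ((hc i hi).1 (h3 i hi)).1, fun i hi => ?_⟩
    have := ((hc i (by omega)).1 (h3 i (by omega))).2
    by_contra h4
    exact this ⟨h3 _ hi, lt_of_le_of_ne (not_lt.1 h4) (hy _ _ (by omega))⟩
  · rintro ⟨h1, h2⟩
    have h3 : ∀ i < k, 𝓡.RightErased y (k - i) i := by
      intro i hi
      refine (hc i hi).2 ⟨h1 i hi, fun h => ?_⟩
      by_cases hik : i + 1 < k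
      · exact lt_asymm h.2 (h2 i hik)
      · have := h.1
        dsimp only at this
        rw [show k - (i + 1) = 0 by omega] at this
        exact this
    have h4 : ∀ i < k, 𝓡.LeftErased y i ∨ 𝓡.RightErased y (k - i) i := fun i hi => .inr (h3 i hi)
    exact ⟨(hc.all_right h4).1 k le_rfl, h4⟩

/-- Mirror image of `firstEvent_iff`: point `n` has no domain on its right, so it is erased from the
left, and this propagates down to point 1. -/
theorem lastEvent_iff {y : ℕ → α} {n : ℕ}
    (hy : ∀ i j, i ≠ j → 𝓡.time (y i) ≠ 𝓡.time (y j)) :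
    𝓡.LastEvent y n ↔
      (∀ i < n, y i ∈ 𝓡.right) ∧ ∀ i, i + 1 < n → 𝓡.time (y (i + 1)) < 𝓡.time (y i) := by
  have hc := 𝓡.recursion_rightErased y n
  constructor
  · rintro ⟨h1, h2⟩
    have h3 : ∀ j, j < n → 𝓡.LeftErased y (n - j) := by
      intro j
      induction j with
      | zero =>
        intro hj
        have := h2 n hj le_rfl
        rw [Nat.sub_self] at this
        exact this.resolve_right id
      | succ j ih =>
        intro hj
        refine (h2 (n - (j + 1)) (by omega) (by omega)).resolve_right fun h => ?_
        have h4 := ((hc _ (by omega)).1 h).1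
        have h5 := ih (by omega)
        rw [show n - j = n - (j + 1) + 1 by omega, LeftErased] at h5
        exact 𝓡.disj _ h4 h5.1
    have h4 : ∀ i < n, 𝓡.LeftErased y (i + 1) := fun i hi => by
      have := h3 (n - (i + 1)) (by omega)
      rwa [show n - (n - (i + 1)) = i + 1 by omega] at this
    refine ⟨fun i hi => ?_, fun i hi => ?_⟩
    · have := h4 i hi
      rw [LeftErased] at this
      exact this.1
    · have := h4 (i + 1) hi
      rw [LeftErased] at this
      by_contra h5
      exact this.2 ⟨h4 i (by omega), lt_of_le_of_ne (not_lt.1 h5) (hy _ _ (by omega))⟩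
  · rintro ⟨h1, h2⟩
    refine ⟨fun h => ?_, fun i hi0 hi => .inl ?_⟩
    · rcases Nat.eq_zero_or_pos n with rfl | hn
      · exact h
      · exact 𝓡.disj _ ((hc 0 hn).1 h).1 (h1 0 hn)
    · induction i with
      | zero => omega
      | succ i ih =>
        rw [LeftErased]
        refine ⟨h1 i (by omega), fun h => ?_⟩
        rcases Nat.eq_zero_or_pos i with rfl | hi'
        · exact h.1
        · have := h2 (i - 1) (by omega)
          rw [show i - 1 + 1 = i by omega] at this
          exact lt_asymm this h.2

/-- Among the points of finitely many domains, there is a survivor. -/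
theorem exists_firstEvent (y : ℕ → α) (n : ℕ) :
    ∃ k ≤ n, 𝓡.FirstEvent y k ∧ ¬ 𝓡.RightErased y (n - k) k := by
  have hc := 𝓡.recursion_rightErased y n
  -- If points 0, …, n - 1 are all erased, `all_right` spares point `n` on the left, and no domain
  -- remains on its right.
  have hex : ∃ k, k ≤ n ∧ ¬ 𝓡.LeftErased y k ∧ ¬ 𝓡.RightErased y (n - k) k := by
    by_contra! hcon
    have hall : ∀ i < n, 𝓡.LeftErased y i ∨ 𝓡.RightErased y (n - i) i := fun i hi => by
      have := hcon i hi.le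
      tauto
    have := hcon n le_rfl ((hc.all_right hall).1 n le_rfl)
    rw [Nat.sub_self] at this
    exact this
  classical
  refine ⟨Nat.find hex, (Nat.find_spec hex).1, ?_⟩
  rw [← (hc.mono (Nat.find_spec hex).1).first_iff]
  refine ⟨(Nat.find_spec hex).2, fun i hi => ?_⟩
  have := Nat.find_min hex hi
  have h2 := (Nat.find_spec hex).1
  have : ¬ (¬ 𝓡.LeftErased y i ∧ ¬ 𝓡.RightErased y (n - i) i) := fun h => this ⟨by omega, h⟩
  tauto

theorem firstEvent_unique (y : ℕ → α) (n : ℕ) {k l : ℕ} (hk : k ≤ n) (hl : l ≤ n)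
    (h : 𝓡.FirstEvent y k ∧ ¬ 𝓡.RightErased y (n - k) k)
    (h' : 𝓡.FirstEvent y l ∧ ¬ 𝓡.RightErased y (n - l) l) : k = l := by
  have hc := 𝓡.recursion_rightErased y n
  rw [← (hc.mono hk).first_iff] at h
  rw [← (hc.mono hl).first_iff] at h'
  by_contra hne
  rcases lt_or_gt_of_ne hne with hlt | hlt
  · have := h'.2 k hlt; tauto
  · have := h.2 l hlt; tauto

/-- If the initial point survives the first `n` domains, then either there is a next survivor or
it is the only one. -/
theorem exists_nextEvent {y : ℕ → α} {n : ℕ} (h0 : ¬ 𝓡.RightErased y n 0)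
    (hlast : ¬ 𝓡.LastEvent y n) :
    ∃ k ≤ n, 𝓡.NextEvent y k ∧ ¬ 𝓡.RightErased y (n - k) k := by
  have hc := 𝓡.recursion_rightErased y n
  have hex : ∃ k, k ≤ n ∧ 0 < k ∧ ¬ 𝓡.LeftErased y k ∧ ¬ 𝓡.RightErased y (n - k) k := by
    by_contra! hcon
    refine hlast ⟨h0, fun i hi0 hi => ?_⟩
    have := hcon i hi hi0
    tauto
  classical
  refine ⟨Nat.find hex, (Nat.find_spec hex).1, ?_⟩
  rw [← (hc.mono (Nat.find_spec hex).1).next_iff]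
  refine ⟨h0, (Nat.find_spec hex).2, fun i hi0 hi => ?_⟩
  have := Nat.find_min hex hi
  have h2 := (Nat.find_spec hex).1
  have : ¬ (¬ 𝓡.LeftErased y i ∧ ¬ 𝓡.RightErased y (n - i) i) := fun h => this ⟨by omega, hi0, h⟩
  tauto

theorem nextEvent_unique (y : ℕ → α) (n : ℕ) {k l : ℕ} (hk : k ≤ n) (hl : l ≤ n)
    (h : 𝓡.NextEvent y k ∧ ¬ 𝓡.RightErased y (n - k) k)
    (h' : 𝓡.NextEvent y l ∧ ¬ 𝓡.RightErased y (n - l) l) : k = l := by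
  have hc := 𝓡.recursion_rightErased y n
  rw [← (hc.mono hk).next_iff] at h
  rw [← (hc.mono hl).next_iff] at h'
  by_contra hne
  rcases lt_or_gt_of_ne hne with hlt | hlt
  · have := h'.2.2 k h.2.1.1 hlt; tauto
  · have := h.2.2 l h'.2.1.1 hlt; tauto

theorem not_rightErased_of_nextEvent {y : ℕ → α} {n k : ℕ} (hk : k ≤ n)
    (h : 𝓡.NextEvent y k ∧ ¬ 𝓡.RightErased y (n - k) k) :
    ¬ 𝓡.RightErased y n 0 ∧ ¬ 𝓡.LastEvent y n := by
  have hc := 𝓡.recursion_rightErased y n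
  rw [← (hc.mono hk).next_iff] at h
  refine ⟨h.1, fun hl => ?_⟩
  have := hl.2 k h.2.1.1 hk
  tauto

end Rules

/-! ### Sequences of independent variables -/

section IID

variable {α β ι ι' : Type*} [MeasurableSpace α] [MeasurableSpace β]

@[fun_prop]
theorem measurable_shift (k : ℕ) : Measurable (shift k : (ℕ → α) → ℕ → α) := by
  unfold shift; fun_prop

@[fun_prop]
theorem measurable_splice (k : ℕ) :
    Measurable fun p : (ℕ → α) × (ℕ → α) => splice k p.1 p.2 := by
  refine measurable_pi_lambda _ fun i => ?_
  by_cases hi : i < k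
  · simp only [splice, hi, if_true]; fun_prop
  · simp only [splice, hi, if_false]; fun_prop

/-- The law of a sequence of independent variables of law `κ`. -/
abbrev iid (κ : Measure α) [IsProbabilityMeasure κ] : Measure (ℕ → α) :=
  Measure.infinitePi fun _ : ℕ => κ

variable (κ : Measure α) [IsProbabilityMeasure κ] (m : Measure β) [IsProbabilityMeasure m]

/-- Replacing the tail after a fixed index by an independent copy does not change an i.i.d. law.
Past and future are separated by this map. -/
theorem measurePreserving_splice (k : ℕ) :
    MeasurePreserving (fun p : (ℕ → α) × (ℕ → α) => splice k p.1 p.2)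
      ((iid κ).prod (iid κ)) (iid κ) := by
  refine ⟨measurable_splice k, Measure.eq_infinitePi _ fun s t ht => ?_⟩
  rw [Measure.map_apply (measurable_splice k) (.pi s.countable_toSet fun _ _ => ht _)]
  have hpre : (fun p : (ℕ → α) × (ℕ → α) => splice k p.1 p.2) ⁻¹' ((s : Set ℕ).pi t) =
      ((s.filter (· < k) : Finset ℕ) : Set ℕ).pi t ×ˢ
        (((s.filter (¬ · < k)).image (· - k) : Finset ℕ) : Set ℕ).pi fun i => t (k + i) := by
    ext ⟨y, z⟩
    simp only [Set.mem_preimage, Set.mem_pi, Finset.mem_coe, Set.mem_prod, Finset.mem_filter,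
      Finset.mem_image, splice]
    constructor
    · refine fun h => ⟨fun i hi => by simpa [hi.2] using h i hi.1, ?_⟩
      rintro _ ⟨i, hi, rfl⟩
      have := h i hi.1
      rwa [if_neg hi.2, ← show k + (i - k) = i by omega, Nat.add_sub_cancel_left] at this
    · rintro ⟨h1, h2⟩ i hi
      by_cases hik : i < k
      · simpa [hik] using h1 i ⟨hi, hik⟩
      · have := h2 (i - k) ⟨i, ⟨hi, hik⟩, rfl⟩
        rwa [if_neg hik, ← show k + (i - k) = i by omega, Nat.add_sub_cancel_left]
  rw [hpre, Measure.prod_prod, Measure.infinitePi_pi _ fun i _ => ht i,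
    Measure.infinitePi_pi _ fun i _ => ht _, Finset.prod_image,
    ← Finset.prod_filter_mul_prod_filter_not s (· < k)]
  · congr 1
    refine Finset.prod_congr rfl fun i hi => ?_
    have := (Finset.mem_filter.1 hi).2
    rw [show k + (i - k) = i by omega]
  · intro i hi j hj hij
    simp only [Finset.coe_filter, Set.mem_ofPred_eq, not_lt] at hi hj
    simp only at hij
    omega

theorem measurePreserving_reindex {e : ι' → ι} (he : Function.Injective e) :
    MeasurePreserving (fun (y : ι → α) (i : ι') => y (e i))
      (Measure.infinitePi fun _ : ι => κ) (Measure.infinitePi fun _ : ι' => κ) := by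
  classical
  have hm : Measurable fun (y : ι → α) (i : ι') => y (e i) := by fun_prop
  refine ⟨hm, Measure.eq_infinitePi _ fun s t ht => ?_⟩
  rw [Measure.map_apply hm (.pi s.countable_toSet fun _ _ => ht _)]
  rcases isEmpty_or_nonempty ι' with hι | hι
  · have : s = ∅ := Finset.eq_empty_of_isEmpty s
    subst this
    simp
  have hpre : (fun (y : ι → α) (i : ι') => y (e i)) ⁻¹' ((s : Set ι').pi t) =
      ((s.image e : Finset ι) : Set ι).pi fun i => t (Function.invFun e i) := by
    ext y
    simp [Set.mem_pi, Function.leftInverse_invFun he _]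
  rw [hpre, Measure.infinitePi_pi _ fun i _ => ht _, Finset.prod_image he.injOn]
  simp [Function.leftInverse_invFun he _]

theorem measurePreserving_shift (k : ℕ) : MeasurePreserving (shift k) (iid κ) (iid κ) :=
  measurePreserving_reindex κ (add_right_injective k)

theorem measurePreserving_zip :
    MeasurePreserving (fun (p : (ℕ → α) × (ℕ → β)) (i : ℕ) => (p.1 i, p.2 i))
      ((iid κ).prod (iid m)) (iid (κ.prod m)) := by
  have hm : Measurable fun (p : (ℕ → α) × (ℕ → β)) (i : ℕ) => (p.1 i, p.2 i) := by fun_prop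
  refine ⟨hm, Measure.eq_infinitePi _ fun s t ht => ?_⟩
  rw [Measure.map_apply hm (.pi s.countable_toSet fun _ _ => ht _)]
  let e := MeasurableEquiv.arrowProdEquivProdArrow α β s
  have hpre : (fun (p : (ℕ → α) × (ℕ → β)) (i : ℕ) => (p.1 i, p.2 i)) ⁻¹' ((s : Set ℕ).pi t) =
      Prod.map s.restrict s.restrict ⁻¹' (e.symm ⁻¹' (Set.univ.pi fun i : s => t i)) := by
    ext p
    simp only [Set.mem_preimage, Set.mem_pi, Finset.mem_coe, Set.mem_univ, true_imp_iff,
      Subtype.forall]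
    rfl
  have hM : MeasurableSet (Set.univ.pi fun i : s => t i) := .univ_pi fun i => ht _
  rw [hpre, ← Measure.map_apply (by fun_prop) (e.symm.measurable hM),
    ← Measure.map_prod_map _ _ (by fun_prop) (by fun_prop), Measure.infinitePi_map_restrict,
    Measure.infinitePi_map_restrict,
    (measurePreserving_arrowProdEquivProdArrow α β s (fun _ => κ) fun _ => m).symm.measure_preimage
      hM.nullMeasurableSet, Measure.pi_pi, Finset.prod_coe_sort s fun i => (κ.prod m) (t i)]

/-- If `Z` sends `P` to `η ⊗ P`, then the first coordinates obtained by iterating `Z` are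
independent of law `η`. -/
theorem measurePreserving_iterate {P : Measure β} [IsProbabilityMeasure P] {Z : β → α × β}
    (hZ : MeasurePreserving Z P (κ.prod P)) :
    MeasurePreserving (fun y (n : ℕ) => (Z ((fun z => (Z z).2)^[n] y)).1) P (iid κ) := by
  have hm2 : Measurable fun z => (Z z).2 := hZ.measurable.snd
  have hm : Measurable (fun y (n : ℕ) => (Z ((fun z => (Z z).2)^[n] y)).1) :=
    measurable_pi_lambda _ fun n => (hZ.measurable.comp (hm2.iterate n)).fst
  refine ⟨hm, ?_⟩
  have key : ∀ (n : ℕ) (t : ℕ → Set α), (∀ i, MeasurableSet (t i)) →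
      P {y | ∀ i < n, (Z ((fun z => (Z z).2)^[i] y)).1 ∈ t i} = ∏ i ∈ Finset.range n, κ (t i) := by
    intro n
    induction n with
    | zero => intro t ht; simp
    | succ n ih =>
      intro t ht
      have hset : {y | ∀ i < n + 1, (Z ((fun z => (Z z).2)^[i] y)).1 ∈ t i} =
          Z ⁻¹' (t 0 ×ˢ {y | ∀ i < n, (Z ((fun z => (Z z).2)^[i] y)).1 ∈ t (i + 1)}) := by
        ext y
        simp only [Set.mem_ofPred_eq, Set.mem_preimage, Set.mem_prod]
        constructor
        · exact fun h => ⟨h 0 (by omega), fun i hi => h (i + 1) (by omega)⟩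
        · rintro ⟨h0, h1⟩ i hi
          rcases i with _ | i
          · exact h0
          · exact h1 i (by omega)
      have hms : MeasurableSet {y | ∀ i < n, (Z ((fun z => (Z z).2)^[i] y)).1 ∈ t (i + 1)} := by
        simp only [Set.ofPred_forall]
        exact .iInter fun i => .iInter fun _ =>
          (hZ.measurable.comp (hm2.iterate i)).fst (ht (i + 1))
      rw [hset, hZ.measure_preimage ((ht 0).prod hms).nullMeasurableSet, Measure.prod_prod,
        ih (fun i => t (i + 1)) fun i => ht _, Finset.prod_range_succ', mul_comm]
  refine Measure.eq_infinitePi _ fun s t ht => ?_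
  rw [Measure.map_apply hm (.pi s.countable_toSet fun _ _ => ht _)]
  obtain ⟨n, hn⟩ := s.exists_nat_subset_range
  classical
  -- A box over a finite set of indices is padded with `Set.univ` to a box over an initial segment,
  -- where the induction `key` applies.
  have := key n (fun i => if i ∈ s then t i else Set.univ) fun i => by
    split_ifs; exacts [ht i, .univ]
  rw [← Finset.prod_subset hn fun i _ hi => by simp [hi],
    Finset.prod_congr rfl fun i hi => by rw [if_pos hi]] at this
  rw [← this]
  congr 1
  ext y
  simp only [Set.mem_preimage, Set.mem_pi, Finset.mem_coe, Set.mem_ofPred_eq]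
  constructor
  · intro h i _
    split_ifs with hi
    exacts [h i hi, trivial]
  · intro h i hi
    simpa [hi] using h i (Finset.mem_range.1 (hn hi))

/-- The law of the value and the future at a random index. The index is `k` if and only if the
first `k` terms satisfy `E k` and the terms after them satisfy `A`. -/
theorem map_stopped {γ : Type*} [MeasurableSpace γ] {B A : Set (ℕ → α)} {E : ℕ → Set (ℕ → α)}
    {idx : (ℕ → α) → ℕ} {S : ℕ → (ℕ → α) → γ} (hB : MeasurableSet B) (hA : MeasurableSet A)
    (hE : ∀ k, MeasurableSet (E k)) (hidx : Measurable idx) (hS : ∀ k, Measurable (S k))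
    (hloc : ∀ k y z, splice k y z ∈ E k ↔ y ∈ E k) (hSloc : ∀ k y z, S k (splice k y z) = S k y)
    (hiff : ∀ᵐ y ∂iid κ, ∀ k, (y ∈ B ∧ idx y = k) ↔ (y ∈ E k ∧ shift k y ∈ A)) :
    ((iid κ).restrict B).map (fun y => (S (idx y) y, shift (idx y) y)) =
      (Measure.sum fun k => ((iid κ).restrict (E k)).map (S k)).prod ((iid κ).restrict A) := by
  have hZ : Measurable fun y : ℕ → α => (S (idx y) y, shift (idx y) y) := by
    have h1 : Measurable fun p : (ℕ → α) × ℕ => (S p.2 p.1, shift p.2 p.1) :=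
      measurable_from_prod_countable_left fun k =>
        show Measurable fun y => (S k y, shift k y) from (hS k).prodMk (measurable_shift k)
    exact h1.comp (measurable_id.prodMk hidx)
  -- Decomposition according to the value of the random index, each piece being a prefix event
  -- intersected with a tail event.
  have hdec : (iid κ).restrict B =
      Measure.sum fun k => (iid κ).restrict (E k ∩ shift k ⁻¹' A) := by
    have h1 : (iid κ).restrict B = Measure.sum fun k => (iid κ).restrict (B ∩ idx ⁻¹' {k}) := by
      rw [← Measure.restrict_iUnion]
      · congr 1
        ext y; simp
      · intro k l hkl
        refine Set.disjoint_left.2 fun y hy hy' => hkl ?_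
        exact hy.2.symm.trans hy'.2
      · exact fun k => hB.inter (hidx (measurableSet_singleton k))
    rw [h1]
    congr 1
    funext k
    refine Measure.restrict_congr_set ?_
    filter_upwards [hiff] with y hy
    exact propext (hy k)
  rw [hdec, Measure.map_sum hZ.aemeasurable, Measure.prod_sum_left]
  congr 1
  funext k
  have hEA : MeasurableSet (E k ∩ shift k ⁻¹' A) := (hE k).inter (measurable_shift k hA)
  have h2 : ((iid κ).restrict (E k ∩ shift k ⁻¹' A)).map
        (fun y => (S (idx y) y, shift (idx y) y)) =
      ((iid κ).restrict (E k ∩ shift k ⁻¹' A)).map (fun y => (S k y, shift k y)) := by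
    refine Measure.map_congr ?_
    filter_upwards [ae_restrict_of_ae hiff, ae_restrict_mem hEA] with y hy hy'
    rw [((hy k).2 hy').2]
  have h3 : (fun p : (ℕ → α) × (ℕ → α) => splice k p.1 p.2) ⁻¹' (E k ∩ shift k ⁻¹' A) =
      E k ×ˢ A := by
    ext ⟨y, z⟩
    simp [hloc, shift_splice]
  rw [h2, ← ((measurePreserving_splice κ k).restrict_preimage hEA).map_eq, h3,
    Measure.map_map ((hS k).prodMk (measurable_shift k)) (measurable_splice k),
    ← Measure.prod_restrict]
  have h4 : (fun y => (S k y, shift k y)) ∘ (fun p : (ℕ → α) × (ℕ → α) => splice k p.1 p.2) =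
      Prod.map (S k) id := by
    funext p
    simp [hSloc, shift_splice, Prod.map]
  rw [h4, ← Measure.map_prod_map _ _ (hS k) measurable_id, Measure.map_id]

theorem integral_splice (k : ℕ) {E A : Set (ℕ → α)} (hE : MeasurableSet E) (hA : MeasurableSet A)
    {f g h : (ℕ → α) → ℂ} (hloc : ∀ y z, splice k y z ∈ E ↔ y ∈ E)
    (hf : Measurable f) (hfgh : ∀ y z, f (splice k y z) = g y * h z) :
    ∫ y in E ∩ shift k ⁻¹' A, f y ∂iid κ = (∫ y in E, g y ∂iid κ) * ∫ y in A, h y ∂iid κ := by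
  have hEA : MeasurableSet (E ∩ shift k ⁻¹' A) := hE.inter (measurable_shift k hA)
  have h3 : (fun p : (ℕ → α) × (ℕ → α) => splice k p.1 p.2) ⁻¹' (E ∩ shift k ⁻¹' A) =
      E ×ˢ A := by
    ext ⟨y, z⟩
    simp [hloc, shift_splice]
  rw [← ((measurePreserving_splice κ k).restrict_preimage hEA).map_eq, h3,
    integral_map (measurable_splice k).aemeasurable hf.aestronglyMeasurable,
    ← Measure.prod_restrict]
  simp only [hfgh]
  exact integral_prod_mul g h

/-! ### Ordered chains -/

theorem ae_injective_of_null {T : α → ℝ} (hT : Measurable T) (h0 : ∀ c, κ {a | T a = c} = 0) :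
    ∀ᵐ y ∂iid κ, ∀ i j, i ≠ j → T (y i) ≠ T (y j) := by
  rw [ae_all_iff]
  intro i
  rw [ae_all_iff]
  intro j
  by_cases hij : i = j
  · simp [hij]
  -- Two coordinates are extracted by reindexing, which reduces the claim to the diagonal having
  -- measure zero under `κ.prod κ`.
  have he : Function.Injective ![i, j] := by
    intro a b hab
    fin_cases a <;> fin_cases b <;> simp_all [eq_comm]
  have h1 := measurePreserving_reindex κ he
  rw [Measure.infinitePi_eq_pi fun _ : Fin 2 => κ] at h1
  have h2 := (measurePreserving_finTwoArrow κ).comp h1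
  have h3 : ∀ᵐ p ∂κ.prod κ, T p.1 ≠ T p.2 := by
    have hms : MeasurableSet {p : α × α | T p.1 = T p.2} :=
      measurableSet_eq_fun (hT.comp measurable_fst) (hT.comp measurable_snd)
    rw [ae_iff]
    simp only [not_not]
    rw [Measure.measure_prod_null hms]
    refine ae_of_all _ fun a => ?_
    have : Prod.mk a ⁻¹' {p : α × α | T p.1 = T p.2} = {b | T b = T a} := by
      ext b; simp [eq_comm]
    change κ (Prod.mk a ⁻¹' {p : α × α | T p.1 = T p.2}) = 0
    rw [this, h0]
  filter_upwards [h2.quasiMeasurePreserving.ae h3] with y hy _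
  simpa using hy

theorem existsUnique_strictMono_comp {n : ℕ} {v : Fin n → ℝ} (hv : Function.Injective v) :
    ∃! σ : Equiv.Perm (Fin n), StrictMono (v ∘ σ) := by
  refine ⟨Tuple.sort v,
    (Tuple.monotone_sort v).strictMono_of_injective (hv.comp (Equiv.injective _)), fun τ hτ => ?_⟩
  have hs : StrictMono (v ∘ Tuple.sort v) :=
    (Tuple.monotone_sort v).strictMono_of_injective (hv.comp (Equiv.injective _))
  have := (StrictMono.range_inj hτ hs).1 (by simp [Set.range_comp])
  ext1 i
  exact hv (congr_fun this i)

theorem measurePreserving_perm {n : ℕ} (σ : Equiv.Perm (Fin n)) :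
    MeasurePreserving (fun (y : Fin n → α) i => y (σ i)) (Measure.pi fun _ => κ)
      (Measure.pi fun _ => κ) := by
  have := measurePreserving_reindex κ σ.injective
  rwa [Measure.infinitePi_eq_pi] at this

theorem integrable_prod_of_bounded {n : ℕ} {f : α → ℂ} (hf : Measurable f) (hb : ∀ a, ‖f a‖ ≤ 1)
    {δ : Type*} [MeasurableSpace δ] (η : Measure δ) [IsFiniteMeasure η] {e : δ → Fin n → α}
    (he : Measurable e) : Integrable (fun y => ∏ i, f (e y i)) η := by
  refine Integrable.of_bound (C := 1) ?_ (ae_of_all _ fun y => ?_)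
  · exact (Finset.measurable_fun_prod _ fun i _ =>
      hf.comp ((measurable_pi_apply i).comp he)).aestronglyMeasurable
  · rw [norm_prod]
    exact Finset.prod_le_one (fun _ _ => norm_nonneg _) fun _ _ => hb _

theorem measurableSet_strictMono {T : α → ℝ} (hT : Measurable T) (n : ℕ) :
    MeasurableSet {y : Fin n → α | StrictMono (T ∘ y)} := by
  simp only [StrictMono, Set.ofPred_forall]
  exact .iInter fun i => .iInter fun j => .iInter fun _ =>
    measurableSet_lt (hT.comp (measurable_pi_apply i)) (hT.comp (measurable_pi_apply j))

/-- The `n!` orderings of the values of `T` partition the space up to a null set, and the symmetric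
integrand has the same integral over each of them. -/
theorem integral_pi_strictMono {T : α → ℝ} (hT : Measurable T)
    (h0 : ∀ c, κ {a | T a = c} = 0) {f : α → ℂ} (hf : Measurable f) (hb : ∀ a, ‖f a‖ ≤ 1)
    (n : ℕ) :
    ∫ y in {y : Fin n → α | StrictMono (T ∘ y)}, ∏ i, f (y i) ∂(Measure.pi fun _ => κ) =
      (∫ a, f a ∂κ) ^ n / n.factorial := by
  set π : Measure (Fin n → α) := Measure.pi fun _ => κ with hπ
  have hint : Integrable (fun y : Fin n → α => ∏ i, f (y i)) π :=
    integrable_prod_of_bounded hf hb π measurable_id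
  have hms := measurableSet_strictMono hT n
  have hσm : ∀ σ : Equiv.Perm (Fin n), MeasurableSet {y : Fin n → α | StrictMono (T ∘ y ∘ σ)} :=
    fun σ => (measurePreserving_perm κ σ).measurable hms
  have hσ : ∀ σ : Equiv.Perm (Fin n),
      ∫ y in {y : Fin n → α | StrictMono (T ∘ y ∘ σ)}, ∏ i, f (y i) ∂π =
        ∫ y in {y : Fin n → α | StrictMono (T ∘ y)}, ∏ i, f (y i) ∂π := by
    intro σ
    have hp := (measurePreserving_perm κ σ).restrict_preimage hms
    rw [← hπ] at hp
    rw [← hp.map_eq, integral_map hp.measurable.aemeasurable]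
    · refine integral_congr_ae (ae_of_all _ fun y => ?_)
      exact (Equiv.prod_comp σ fun i => f (y i)).symm
    · exact (Finset.measurable_fun_prod _ fun i _ =>
        hf.comp (measurable_pi_apply i)).aestronglyMeasurable
  have hinj : ∀ᵐ y ∂π, Function.Injective (T ∘ y) := by
    have h1 := measurePreserving_reindex κ (Fin.val_injective (n := n))
    rw [Measure.infinitePi_eq_pi fun _ : Fin n => κ] at h1
    rw [hπ, ← h1.map_eq]
    refine (ae_map_iff h1.measurable.aemeasurable ?_).2 ?_
    · simp only [Function.Injective, Set.ofPred_forall]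
      refine .iInter fun i => .iInter fun j => ?_
      by_cases hij : i = j
      · simp [hij]
      · simp only [hij, imp_false]
        exact (measurableSet_eq_fun (hT.comp (measurable_pi_apply i))
          (hT.comp (measurable_pi_apply j))).compl
    · filter_upwards [ae_injective_of_null κ hT h0] with y hy i j hij
      by_contra hne
      exact hy _ _ (fun h => hne (Fin.val_injective h)) hij
  have hsum : ∑ σ : Equiv.Perm (Fin n),
      ∫ y in {y : Fin n → α | StrictMono (T ∘ y ∘ σ)}, ∏ i, f (y i) ∂π =
        ∫ y, ∏ i, f (y i) ∂π := by
    simp only [← integral_indicator (hσm _)]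
    rw [← integral_finsetSum _ fun σ _ => hint.indicator (hσm σ)]
    refine integral_congr_ae ?_
    filter_upwards [hinj] with y hy
    obtain ⟨σ, h1, h2⟩ := existsUnique_strictMono_comp hy
    rw [Finset.sum_eq_single σ]
    · exact Set.indicator_of_mem (s := {y : Fin n → α | StrictMono (T ∘ y ∘ σ)}) h1 _
    · intro τ _ hτ
      exact Set.indicator_of_notMem (s := {y : Fin n → α | StrictMono (T ∘ y ∘ τ)})
        (fun h => hτ (h2 τ h)) _
    · simp
  rw [Finset.sum_congr rfl fun σ _ => hσ σ, Finset.sum_const, Finset.card_univ,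
    Fintype.card_perm, Fintype.card_fin, nsmul_eq_mul, hπ, integral_fintype_prod_eq_pow,
    Fintype.card_fin] at hsum
  rw [eq_div_iff (by exact_mod_cast n.factorial_ne_zero), mul_comm, hsum]

theorem integral_chain {T : α → ℝ} (hT : Measurable T)
    (h0 : ∀ c, κ {a | T a = c} = 0) {f : α → ℂ} (hf : Measurable f) (hb : ∀ a, ‖f a‖ ≤ 1)
    {L : Set α} (hL : MeasurableSet L) (n : ℕ) :
    ∫ y in {y : ℕ → α | (∀ i < n, y i ∈ L) ∧ ∀ i, i + 1 < n → T (y i) < T (y (i + 1))},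
        ∏ i ∈ Finset.range n, f (y i) ∂iid κ =
      (∫ a in L, f a ∂κ) ^ n / n.factorial := by
  have h1 := measurePreserving_reindex κ (Fin.val_injective (n := n))
  rw [Measure.infinitePi_eq_pi fun _ : Fin n => κ] at h1
  have hms := measurableSet_strictMono hT n
  -- Membership of all letters in `L` is absorbed into the weight, as a product of indicators.
  have key := integral_pi_strictMono κ hT h0 (hf.indicator hL) (fun a => by
    by_cases ha : a ∈ L <;> simp [ha, hb a]) n
  rw [integral_indicator hL] at key
  have hmp : Measurable fun y : Fin n → α => ∏ i, L.indicator f (y i) :=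
    Finset.measurable_fun_prod _ fun i _ => (hf.indicator hL).comp (measurable_pi_apply i)
  rw [← key, ← (h1.restrict_preimage hms).map_eq,
    integral_map h1.measurable.aemeasurable hmp.aestronglyMeasurable,
    ← integral_indicator (h1.measurable hms), ← integral_indicator]
  · refine integral_congr_ae (ae_of_all _ fun y => ?_)
    have hmono : StrictMono (T ∘ fun i : Fin n => y i) ↔
        ∀ i, i + 1 < n → T (y i) < T (y (i + 1)) := by
      rcases n with _ | n
      · simp [StrictMono]
      · rw [Fin.strictMono_iff_lt_succ]
        exact ⟨fun h i hi => h ⟨i, by omega⟩, fun h i => h i (by simp)⟩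
    have hprod : (∀ i < n, y i ∈ L) → ∏ i : Fin n, L.indicator f (y i) =
        ∏ i ∈ Finset.range n, f (y i) := by
      intro h
      rw [Finset.prod_range]
      exact Finset.prod_congr rfl fun i _ => Set.indicator_of_mem (h i i.2) f
    have hprod0 : (¬ ∀ i < n, y i ∈ L) → ∏ i : Fin n, L.indicator f (y i) = 0 := by
      intro h
      push Not at h
      obtain ⟨i, hi, hiL⟩ := h
      exact Finset.prod_eq_zero (Finset.mem_univ (⟨i, hi⟩ : Fin n)) (by simp [hiL])
    simp only [Set.indicator, Set.mem_ofPred_eq, Set.mem_preimage] at hprod hprod0 ⊢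
    by_cases hL' : ∀ i < n, y i ∈ L
    · rw [hprod hL']
      by_cases hm : StrictMono (T ∘ fun i : Fin n => y i)
      · rw [if_pos hm, if_pos ⟨hL', hmono.1 hm⟩]
      · rw [if_neg hm, if_neg fun h => hm (hmono.2 h.2)]
    · rw [hprod0 hL', ite_self, if_neg fun h => hL' h.1]
  · simp only [Set.ofPred_and, Set.ofPred_forall]
    refine .inter (.iInter fun i => .iInter fun _ => measurable_pi_apply i hL)
      (.iInter fun i => .iInter fun _ => measurableSet_lt (hT.comp (measurable_pi_apply i))
        (hT.comp (measurable_pi_apply (i + 1))))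

/-- An increasing run of length `n` has probability `1 / n!`, so an infinite one has probability
zero; this is then applied to every shift. -/
theorem ae_exists_descent {T : α → ℝ} (hT : Measurable T) (h0 : ∀ c, κ {a | T a = c} = 0) :
    ∀ᵐ y ∂iid κ, ∀ m, ∃ i ≥ m, T (y (i + 1)) < T (y i) := by
  have hn : ∀ n : ℕ, (iid κ).real {y : ℕ → α | ∀ i, i + 1 < n → T (y i) < T (y (i + 1))} =
      1 / n.factorial := by
    intro n
    have := integral_chain κ hT h0 (f := fun _ => 1) measurable_const (by simp)
      MeasurableSet.univ n
    simp only [Set.mem_univ, implies_true, true_and, Finset.prod_const_one, integral_const,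
      measureReal_restrict_apply_univ, probReal_univ, one_smul, one_pow, Complex.real_smul,
      mul_one] at this
    apply Complex.ofReal_injective
    rw [this]
    push_cast
    rfl
  have hinc : iid κ {y : ℕ → α | ∀ i, T (y i) < T (y (i + 1))} = 0 := by
    rw [← measureReal_eq_zero_iff]
    have hlim : Filter.Tendsto (fun n : ℕ => (1 : ℝ) / n.factorial) Filter.atTop (nhds 0) := by
      simpa using FloorSemiring.tendsto_pow_div_factorial_atTop (1 : ℝ)
    refine le_antisymm (ge_of_tendsto' hlim fun n => ?_) measureReal_nonneg
    · rw [← hn n]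
      exact measureReal_mono fun y hy i _ => hy i
  rw [ae_all_iff]
  intro m
  have h1 : ∀ᵐ y ∂iid κ, ¬ ∀ i, T (y i) < T (y (i + 1)) := by
    rw [ae_iff]; simpa using hinc
  filter_upwards [(measurePreserving_shift κ m).quasiMeasurePreserving.ae h1,
    ae_injective_of_null κ hT h0] with y hy hinj
  push Not at hy
  obtain ⟨i, hi⟩ := hy
  refine ⟨m + i, by omega, lt_of_le_of_ne hi ?_⟩
  exact hinj _ _ (by simp)

/-- Ascents of the ring times are descents of their negatives. -/
theorem ae_good {𝓡 : Rules α} (hT : Measurable 𝓡.time) (h0 : ∀ c, κ {a | 𝓡.time a = c} = 0) :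
    ∀ᵐ y ∂iid κ, 𝓡.Good y := by
  have h0' : ∀ c, κ {a | -𝓡.time a = c} = 0 := fun c => by
    simpa [neg_eq_iff_eq_neg] using h0 (-c)
  filter_upwards [ae_injective_of_null κ hT h0, ae_exists_descent κ hT h0,
    ae_exists_descent κ hT.neg h0'] with y h1 h2 h3
  exact ⟨h1, h2, fun m => by simpa using h3 m⟩

end IID

/-! ### Measurability and generating functions of the survivors -/

namespace Rules

variable {α : Type*} [MeasurableSpace α]

/-- The rules are measurable, and the ring time has no atoms under `κ`. -/
structure Regular (𝓡 : Rules α) (κ : Measure α) : Prop where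
  measurable_time : Measurable 𝓡.time
  measurableSet_left : MeasurableSet 𝓡.left
  measurableSet_right : MeasurableSet 𝓡.right
  null_time : ∀ c, κ {a | 𝓡.time a = c} = 0

variable {𝓡 : Rules α} {κ : Measure α}

/-! #### Measurability -/

theorem Regular.measurableSet_time_lt (h : 𝓡.Regular κ) (i j : ℕ) :
    MeasurableSet {y : ℕ → α | 𝓡.time (y i) < 𝓡.time (y j)} :=
  measurableSet_lt (h.measurable_time.comp (measurable_pi_apply i))
    (h.measurable_time.comp (measurable_pi_apply j))

theorem Regular.measurableSet_rightErased (h : 𝓡.Regular κ) (n i : ℕ) :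
    MeasurableSet {y : ℕ → α | 𝓡.RightErased y n i} := by
  induction n generalizing i with
  | zero => simp [RightErased]
  | succ n ih =>
    simp only [RightErased]
    exact (measurable_pi_apply i h.measurableSet_left).inter
      ((ih (i + 1)).inter (h.measurableSet_time_lt _ _)).compl

theorem Regular.measurableSet_leftErased (h : 𝓡.Regular κ) (i : ℕ) :
    MeasurableSet {y : ℕ → α | 𝓡.LeftErased y i} := by
  induction i with
  | zero => simp [LeftErased]
  | succ i ih =>
    simp only [LeftErased]
    exact (measurable_pi_apply i h.measurableSet_right).inter
      (ih.inter (h.measurableSet_time_lt _ _)).compl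

theorem Regular.measurableSet_rightErasedLim (h : 𝓡.Regular κ) (i : ℕ) :
    MeasurableSet {y : ℕ → α | 𝓡.RightErasedLim y i} := by
  simp only [RightErasedLim, Set.ofPred_exists, Set.ofPred_forall]
  exact .iUnion fun N => .iInter fun n => .iInter fun _ => h.measurableSet_rightErased n i

theorem Regular.measurableSet_surv (h : 𝓡.Regular κ) (i : ℕ) :
    MeasurableSet {y : ℕ → α | 𝓡.Surv y i} :=
  (h.measurableSet_leftErased i).compl.inter (h.measurableSet_rightErasedLim i).compl

theorem Regular.measurableSet_firstEvent (h : 𝓡.Regular κ) (k : ℕ) :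
    MeasurableSet {y : ℕ → α | 𝓡.FirstEvent y k} := by
  simp only [FirstEvent, Set.ofPred_and, Set.ofPred_forall]
  exact (h.measurableSet_leftErased k).compl.inter <| .iInter fun i => .iInter fun _ =>
    (h.measurableSet_leftErased i).union (h.measurableSet_rightErased _ i)

theorem Regular.measurableSet_nextEvent (h : 𝓡.Regular κ) (k : ℕ) :
    MeasurableSet {y : ℕ → α | 𝓡.NextEvent y k} := by
  simp only [NextEvent, Set.ofPred_and, Set.ofPred_forall]
  exact (MeasurableSet.const _).inter <| (h.measurableSet_rightErased k 0).compl.inter <|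
    (h.measurableSet_leftErased k).compl.inter <| .iInter fun i => .iInter fun _ =>
      .iInter fun _ => (h.measurableSet_leftErased i).union (h.measurableSet_rightErased _ i)

theorem Regular.measurableSet_lastEvent (h : 𝓡.Regular κ) (k : ℕ) :
    MeasurableSet {y : ℕ → α | 𝓡.LastEvent y k} := by
  simp only [LastEvent, Set.ofPred_and, Set.ofPred_forall]
  exact (h.measurableSet_rightErased k 0).compl.inter <| .iInter fun i => .iInter fun _ =>
      .iInter fun _ => (h.measurableSet_leftErased i).union (h.measurableSet_rightErased _ i)

theorem _root_.Coalescence.measurable_sInf_nat {β : Type*} [MeasurableSpace β] {p : β → ℕ → Prop}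
    (hp : ∀ i, MeasurableSet {b | p b i}) : Measurable fun b => sInf {i | p b i} := by
  refine measurable_to_countable' fun k => ?_
  -- The second piece accounts for the convention `sInf ∅ = 0`.
  have : (fun b => sInf {i | p b i}) ⁻¹' {k} =
      ({b | p b k} ∩ ⋂ i, ⋂ _ : i < k, {b | p b i}ᶜ) ∪ ({_b | k = 0} ∩ ⋂ i, {b | p b i}ᶜ) := by
    ext b
    simp only [Set.mem_preimage, Set.mem_singleton_iff, Set.mem_union, Set.mem_inter_iff,
      Set.mem_ofPred_eq, Set.mem_iInter, Set.mem_compl_iff]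
    constructor
    · rintro rfl
      rcases Set.eq_empty_or_nonempty {i | p b i} with he | hne
      · right
        refine ⟨by rw [he, Nat.sInf_empty], fun i hi => ?_⟩
        have : i ∈ {i | p b i} := hi
        rw [he] at this
        exact this
      · exact .inl ⟨Nat.sInf_mem hne, fun i hi => Nat.notMem_of_lt_sInf hi⟩
    · rintro (⟨h1, h2⟩ | ⟨rfl, h2⟩)
      · refine le_antisymm (Nat.sInf_le h1) (le_csInf ⟨k, h1⟩ fun i hi => ?_)
        by_contra! hlt
        exact h2 i hlt hi
      · have : {i | p b i} = ∅ := Set.eq_empty_of_forall_notMem h2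
        rw [this, Nat.sInf_empty]
  rw [this]
  exact ((hp k).inter (.iInter fun i => .iInter fun _ => (hp i).compl)).union
    ((MeasurableSet.const _).inter (.iInter fun i => (hp i).compl))

theorem Regular.measurable_firstIdx (h : 𝓡.Regular κ) : Measurable 𝓡.firstIdx :=
  measurable_sInf_nat h.measurableSet_surv

theorem Regular.measurable_nextIdx (h : 𝓡.Regular κ) : Measurable 𝓡.nextIdx :=
  measurable_sInf_nat fun i => (MeasurableSet.const (0 < i)).inter (h.measurableSet_surv i)

/-! #### Generating functions -/

/-- The product of the first `n` values of `f`. -/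
def weight (f : α → ℂ) (n : ℕ) (y : ℕ → α) : ℂ := ∏ i ∈ Finset.range n, f (y i)

theorem measurable_weight {f : α → ℂ} (hf : Measurable f) (n : ℕ) : Measurable (weight f n) :=
  Finset.measurable_fun_prod _ fun i _ => hf.comp (measurable_pi_apply i)

omit [MeasurableSpace α] in
theorem norm_weight_le {f : α → ℂ} (hb : ∀ a, ‖f a‖ ≤ 1) (n : ℕ) (y : ℕ → α) :
    ‖weight f n y‖ ≤ 1 := by
  rw [weight, norm_prod]
  exact Finset.prod_le_one (fun _ _ => norm_nonneg _) fun _ _ => hb _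

omit [MeasurableSpace α] in
theorem weight_splice (f : α → ℂ) (k n : ℕ) (y z : ℕ → α) :
    weight f (k + n) (splice k y z) = weight f k y * weight f n z := by
  rw [weight, Finset.prod_range_add]
  congr 1
  · exact Finset.prod_congr rfl fun i hi => by rw [splice_of_lt (Finset.mem_range.1 hi)]
  · exact Finset.prod_congr rfl fun i _ => by simp [splice]

section Generating

variable [IsProbabilityMeasure κ] (h : 𝓡.Regular κ) {f : α → ℂ} (hf : Measurable f)
  (hb : ∀ a, ‖f a‖ ≤ 1)

include hf hb in
theorem integrable_weight (η : Measure (ℕ → α)) [IsFiniteMeasure η] (n : ℕ) :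
    Integrable (weight f n) η :=
  Integrable.of_bound (C := 1) (measurable_weight hf n).aestronglyMeasurable
    (ae_of_all _ (norm_weight_le hb n))

include h hf hb in
theorem integral_firstEvent (n : ℕ) :
    ∫ y in {y | 𝓡.FirstEvent y n}, weight f n y ∂iid κ =
      (∫ a in 𝓡.left, f a ∂κ) ^ n / n.factorial := by
  rw [← integral_chain κ h.measurable_time h.null_time hf hb h.measurableSet_left n]
  refine setIntegral_congr_set ?_
  filter_upwards [ae_injective_of_null κ h.measurable_time h.null_time] with y hy
  exact propext (firstEvent_iff hy)

include h hf hb in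
theorem integral_lastEvent (n : ℕ) :
    ∫ y in {y | 𝓡.LastEvent y n}, weight f n y ∂iid κ =
      (∫ a in 𝓡.right, f a ∂κ) ^ n / n.factorial := by
  rw [← integral_chain κ h.measurable_time.neg (fun c => by
    simpa [neg_eq_iff_eq_neg] using h.null_time (-c)) hf hb h.measurableSet_right n]
  refine setIntegral_congr_set ?_
  filter_upwards [ae_injective_of_null κ h.measurable_time h.null_time] with y hy
  refine propext ((lastEvent_iff hy).trans ?_)
  simp only [Pi.neg_apply, neg_lt_neg_iff]
  rfl

include hf in
theorem integral_weight (n : ℕ) : ∫ y, weight f n y ∂iid κ = (∫ a, f a ∂κ) ^ n := by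
  have h1 := measurePreserving_reindex κ (Fin.val_injective (n := n))
  rw [Measure.infinitePi_eq_pi fun _ : Fin n => κ] at h1
  have h2 := integral_fintype_prod_eq_pow (ι := Fin n) (μ := κ) f
  rw [Fintype.card_fin] at h2
  have h3 : Measurable fun y : Fin n → α => ∏ i, f (y i) :=
    Finset.measurable_fun_prod _ fun i _ => hf.comp (measurable_pi_apply i)
  rw [← h2, ← h1.map_eq, integral_map h1.measurable.aemeasurable h3.aestronglyMeasurable]
  simp only [weight, Finset.prod_range]

include h hf in
theorem integral_event_shift {E : ℕ → Set (ℕ → α)} (hE : ∀ k, MeasurableSet (E k))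
    (hloc : ∀ k y z, splice k y z ∈ E k ↔ y ∈ E k) (k m : ℕ) :
    ∫ y in {y | y ∈ E k ∧ ¬ 𝓡.RightErased y m k}, weight f (k + m) y ∂iid κ =
      (∫ y in E k, weight f k y ∂iid κ) *
        ∫ y in {y | ¬ 𝓡.RightErased y m 0}, weight f m y ∂iid κ := by
  have hA : MeasurableSet {y : ℕ → α | ¬ 𝓡.RightErased y m 0} :=
    (h.measurableSet_rightErased m 0).compl
  rw [← integral_splice κ k (hE k) hA (hloc k) (measurable_weight hf (k + m))
    (weight_splice f k m)]
  congr 2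
  ext y
  simp [rightErased_shift]

omit [MeasurableSpace α] in
theorem firstEvent_splice (k : ℕ) (y z : ℕ → α) :
    𝓡.FirstEvent (splice k y z) k ↔ 𝓡.FirstEvent y k :=
  firstEvent_congr fun _ hi => splice_of_lt hi y z

omit [MeasurableSpace α] in
theorem nextEvent_splice (k : ℕ) (y z : ℕ → α) :
    𝓡.NextEvent (splice k y z) k ↔ 𝓡.NextEvent y k :=
  nextEvent_congr fun _ hi => splice_of_lt hi y z

include h hf hb in
-- Partition of the whole space by the first survivor `k` among the points of `n` domains;
-- independence of the two sides of `k` turns each piece into a product.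
theorem pow_eq_sum_firstEvent (n : ℕ) :
    (∫ a, f a ∂κ) ^ n = ∑ p ∈ Finset.HasAntidiagonal.antidiagonal n,
      (∫ y in {y | 𝓡.FirstEvent y p.1}, weight f p.1 y ∂iid κ) *
        ∫ y in {y | ¬ 𝓡.RightErased y p.2 0}, weight f p.2 y ∂iid κ := by
  have hms : ∀ p : ℕ × ℕ,
      MeasurableSet {y : ℕ → α | 𝓡.FirstEvent y p.1 ∧ ¬ 𝓡.RightErased y p.2 p.1} := fun p =>
    (h.measurableSet_firstEvent p.1).inter (h.measurableSet_rightErased p.2 p.1).compl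
  have hcover : ⋃ p ∈ Finset.HasAntidiagonal.antidiagonal n,
      {y : ℕ → α | 𝓡.FirstEvent y p.1 ∧ ¬ 𝓡.RightErased y p.2 p.1} = Set.univ := by
    refine Set.eq_univ_of_forall fun y => ?_
    obtain ⟨k, hk, hk'⟩ := 𝓡.exists_firstEvent y n
    refine Set.mem_biUnion (x := (k, n - k)) ?_ hk'
    simp; omega
  rw [← integral_weight hf n, ← setIntegral_univ, ← hcover,
    integral_biUnion_finset _ (fun p _ => hms p) ?_
      fun p _ => (integrable_weight hf hb _ n).integrableOn]
  · refine Finset.sum_congr rfl fun p hp => ?_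
    rw [← integral_event_shift (E := fun k => {y | 𝓡.FirstEvent y k}) h hf
      h.measurableSet_firstEvent firstEvent_splice, Finset.HasAntidiagonal.mem_antidiagonal.1 hp]
    rfl
  · intro p hp q hq hpq
    refine Set.disjoint_left.2 fun y hy hy' => hpq ?_
    rw [Finset.mem_coe, Finset.HasAntidiagonal.mem_antidiagonal] at hp hq
    simp only [Set.mem_ofPred_eq] at hy hy'
    have := 𝓡.firstEvent_unique y n (k := p.1) (l := q.1) (by omega) (by omega)
      (by rwa [show n - p.1 = p.2 by omega]) (by rwa [show n - q.1 = q.2 by omega])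
    ext <;> omega

include h hf hb in
-- Partition by the next survivor, the event that there is none giving the extra term.
theorem integral_survival_eq_sum_nextEvent (n : ℕ) :
    ∫ y in {y | ¬ 𝓡.RightErased y n 0}, weight f n y ∂iid κ =
      (∑ p ∈ Finset.HasAntidiagonal.antidiagonal n,
        (∫ y in {y | 𝓡.NextEvent y p.1}, weight f p.1 y ∂iid κ) *
          ∫ y in {y | ¬ 𝓡.RightErased y p.2 0}, weight f p.2 y ∂iid κ) +
      ∫ y in {y | 𝓡.LastEvent y n}, weight f n y ∂iid κ := by
  have hms : ∀ p : ℕ × ℕ,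
      MeasurableSet {y : ℕ → α | 𝓡.NextEvent y p.1 ∧ ¬ 𝓡.RightErased y p.2 p.1} := fun p =>
    (h.measurableSet_nextEvent p.1).inter (h.measurableSet_rightErased p.2 p.1).compl
  have hcover : {y : ℕ → α | ¬ 𝓡.RightErased y n 0} = (⋃ p ∈ Finset.HasAntidiagonal.antidiagonal n,
      {y : ℕ → α | 𝓡.NextEvent y p.1 ∧ ¬ 𝓡.RightErased y p.2 p.1}) ∪
        {y | 𝓡.LastEvent y n} := by
    ext y
    simp only [Set.mem_union, Set.mem_iUnion, exists_prop, Set.mem_ofPred_eq,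
      Finset.HasAntidiagonal.mem_antidiagonal]
    constructor
    · intro hy
      by_cases hl : 𝓡.LastEvent y n
      · exact .inr hl
      · obtain ⟨k, hk, hk'⟩ := exists_nextEvent hy hl
        exact .inl ⟨(k, n - k), by simp; omega, hk'⟩
    · rintro (⟨p, hp, hp'⟩ | hl)
      · exact (not_rightErased_of_nextEvent (n := n) (k := p.1) (by omega)
          (by rwa [show n - p.1 = p.2 by omega])).1
      · exact hl.1
  rw [hcover, setIntegral_union ?_ (h.measurableSet_lastEvent n)
      (integrable_weight hf hb _ n).integrableOn (integrable_weight hf hb _ n).integrableOn,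
    integral_biUnion_finset _ (fun p _ => hms p) ?_
      fun p _ => (integrable_weight hf hb _ n).integrableOn]
  · congr 1
    refine Finset.sum_congr rfl fun p hp => ?_
    rw [← integral_event_shift (E := fun k => {y | 𝓡.NextEvent y k}) h hf
      h.measurableSet_nextEvent nextEvent_splice, Finset.HasAntidiagonal.mem_antidiagonal.1 hp]
    rfl
  · intro p hp q hq hpq
    refine Set.disjoint_left.2 fun y hy hy' => hpq ?_
    rw [Finset.mem_coe, Finset.HasAntidiagonal.mem_antidiagonal] at hp hq
    simp only [Set.mem_ofPred_eq] at hy hy'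
    have := 𝓡.nextEvent_unique y n (k := p.1) (l := q.1) (by omega) (by omega)
      (by rwa [show n - p.1 = p.2 by omega]) (by rwa [show n - q.1 = q.2 by omega])
    ext <;> omega
  · refine Set.disjoint_left.2 fun y hy hy' => ?_
    simp only [Set.mem_iUnion, exists_prop, Set.mem_ofPred_eq, Finset.HasAntidiagonal.mem_antidiagonal] at hy hy'
    obtain ⟨p, hp, hp'⟩ := hy
    exact (not_rightErased_of_nextEvent (n := n) (k := p.1) (by omega)
      (by rwa [show n - p.1 = p.2 by omega])).2 hy'

open PowerSeries in
theorem _root_.Coalescence.rescale_exp_eq_mk (c : ℂ) :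
    rescale c (exp ℂ) = PowerSeries.mk fun n => c ^ n / n.factorial := by
  ext n
  simp [coeff_rescale, coeff_exp, div_eq_mul_inv]

theorem _root_.Coalescence.hasSum_exp (c : ℂ) :
    HasSum (fun n : ℕ => c ^ n / n.factorial) (Complex.exp c) := by
  rw [Complex.exp_eq_exp_ℂ]
  exact NormedSpace.expSeries_div_hasSum_exp c

include h hf hb in
theorem hasSum_firstEvent :
    HasSum (fun n => ∫ y in {y | 𝓡.FirstEvent y n}, weight f n y ∂iid κ)
      (Complex.exp (∫ a in 𝓡.left, f a ∂κ)) := by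
  simp only [integral_firstEvent h hf hb]
  exact hasSum_exp _

open PowerSeries in
include h hf hb in
-- The two convolution identities are solved as formal power series. The unknown survival series `K`
-- is eliminated formally, so its convergence never matters.
theorem hasSum_nextEvent :
    HasSum (fun n => ∫ y in {y | 𝓡.NextEvent y n}, weight f n y ∂iid κ)
      (1 - (1 - ∫ a, f a ∂κ) *
        Complex.exp (∫ a in 𝓡.right, f a ∂κ + ∫ a in 𝓡.left, f a ∂κ)) := by
  set g := ∫ a, f a ∂κ with hg
  set l := ∫ a in 𝓡.left, f a ∂κ with hl
  set r := ∫ a in 𝓡.right, f a ∂κ with hr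
  set F : PowerSeries ℂ := PowerSeries.mk fun n => ∫ y in {y | 𝓡.FirstEvent y n}, weight f n y ∂iid κ with hF
  set K : PowerSeries ℂ :=
    PowerSeries.mk fun n => ∫ y in {y | ¬ 𝓡.RightErased y n 0}, weight f n y ∂iid κ with hK
  set E : PowerSeries ℂ := PowerSeries.mk fun n => ∫ y in {y | 𝓡.NextEvent y n}, weight f n y ∂iid κ with hE
  have hFe : F = rescale l (exp ℂ) := by
    rw [rescale_exp_eq_mk, hF]
    simp only [integral_firstEvent h hf hb, hl]
  have hFK : F * K = PowerSeries.mk fun n => g ^ n := by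
    ext n
    rw [coeff_mul, coeff_mk, hg, pow_eq_sum_firstEvent h hf hb]
    simp only [hF, hK, coeff_mk]
  have hEK : K = E * K + rescale r (exp ℂ) := by
    ext n
    rw [rescale_exp_eq_mk, map_add, coeff_mul, coeff_mk, coeff_mk, hr, ← integral_lastEvent h hf hb]
    simp only [hE, hK, coeff_mk]
    exact integral_survival_eq_sum_nextEvent h hf hb n
  have hgeom : (PowerSeries.mk fun n => g ^ n) * (1 - C g * X) = 1 := by
    ext n
    rw [mul_sub, mul_one, map_sub, mul_comm, mul_assoc, coeff_C_mul, coeff_one]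
    rcases n with _ | n
    · simp
    · simp [coeff_succ_X_mul, pow_succ']
  -- Multiply `(1 - E) * K = exp (r X)` by `F = exp (l X)` and replace `F * K` by the geometric
  -- series.
  have hexp : 1 - E = rescale (r + l) (exp ℂ) * (1 - C g * X) := by
    have h1 : (1 - E) * (F * K) = rescale (r + l) (exp ℂ) := by
      rw [← exp_mul_exp_eq_exp_add, ← hFe]
      linear_combination F * hEK
    rw [← h1, hFK, mul_assoc, hgeom, mul_one]
  -- The coefficients of `E` are thus those of an entire function, so evaluation at `X = 1` is
  -- legitimate.
  have hcoeff : ∀ n, coeff n E = (if n = 0 then 1 else 0) - (r + l) ^ n / n.factorial +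
      g * coeff n (X * rescale (r + l) (exp ℂ)) := by
    intro n
    have h1 : E = 1 - rescale (r + l) (exp ℂ) + C g * (X * rescale (r + l) (exp ℂ)) := by
      linear_combination -hexp
    rw [h1, map_add, map_sub, coeff_one, coeff_C_mul, rescale_exp_eq_mk, coeff_mk]
  have hX : HasSum (fun n => coeff n (X * rescale (r + l) (exp ℂ))) (Complex.exp (r + l)) := by
    rw [← hasSum_nat_add_iff' 1]
    simp only [coeff_succ_X_mul, rescale_exp_eq_mk, coeff_mk]
    simpa using hasSum_exp (r + l)
  have hfin := ((hasSum_ite_eq (0 : ℕ) (1 : ℂ)).sub (hasSum_exp (r + l))).add (hX.mul_left g)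
  have hval : 1 - (1 - g) * Complex.exp (r + l) =
      1 - Complex.exp (r + l) + g * Complex.exp (r + l) := by ring
  rw [hval]
  refine hfin.congr_fun fun n => ?_
  rw [← hcoeff n, hE, coeff_mk]

end Generating

end Rules

namespace Rules

/-! ### The law of the survivors -/

variable {α : Type*} [MeasurableSpace α] (𝓡 : Rules α) (g : α → ℝ)

/-- The total length of the first `n` gaps. -/
def disp (n : ℕ) (y : ℕ → α) : ℝ := ∑ i ∈ Finset.range n, g (y i)

/-- The position of the first survivor, and the sequence that starts there. -/
def stepFirst (y : ℕ → α) : ℝ × (ℕ → α) := (disp g (𝓡.firstIdx y) y, shift (𝓡.firstIdx y) y)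

/-- The position of the next survivor, and the sequence that starts there. -/
def stepNext (y : ℕ → α) : ℝ × (ℕ → α) := (disp g (𝓡.nextIdx y) y, shift (𝓡.nextIdx y) y)

/-- The first survivor and the gaps between the successive survivors. -/
def survivors (p : ℝ × (ℕ → α)) : ℝ × (ℕ → ℝ) :=
  (p.1 + (𝓡.stepFirst g p.2).1, fun n =>
    (𝓡.stepNext g ((fun z => (𝓡.stepNext g z).2)^[n] (𝓡.stepFirst g p.2).2)).1)

/-- The initial point is not erased by the domains on its right. -/
def survSet : Set (ℕ → α) := {y | ¬ 𝓡.RightErasedLim y 0}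

/-- The law of the displacement from the initial point to the first survivor. -/
def firstDispLaw (κ : Measure α) [IsProbabilityMeasure κ] : Measure ℝ :=
  (iid κ).map fun y => (𝓡.stepFirst g y).1

/-- The law of the gaps between survivors. -/
def nextGapLaw (κ : Measure α) [IsProbabilityMeasure κ] : Measure ℝ :=
  (ProbabilityTheory.cond (iid κ) 𝓡.survSet).map fun y => (𝓡.stepNext g y).1

variable {𝓡 g}

omit [MeasurableSpace α] in
theorem disp_splice (k : ℕ) (y z : ℕ → α) : disp g k (splice k y z) = disp g k y :=
  Finset.sum_congr rfl fun i hi => by rw [splice_of_lt (Finset.mem_range.1 hi)]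

omit [MeasurableSpace α] in
theorem disp_add (j k : ℕ) (y : ℕ → α) : disp g (k + j) y = disp g k y + disp g j (shift k y) :=
  Finset.sum_range_add _ _ _

theorem measurable_disp (hg : Measurable g) (n : ℕ) : Measurable (disp g n) :=
  Finset.measurable_fun_sum _ fun i _ => hg.comp (measurable_pi_apply i)

omit [MeasurableSpace α] in
theorem iterate_stepNext (y : ℕ → α) (n : ℕ) :
    (fun z => (𝓡.stepNext g z).2)^[n] (𝓡.stepFirst g y).2 = shift (𝓡.survIdx y n) y := by
  induction n with
  | zero => rfl
  | succ n ih =>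
    rw [Function.iterate_succ_apply', ih]
    exact shift_shift _ _ _

omit [MeasurableSpace α] in
theorem renewalPoint_survivors (x : ℝ) (y : ℕ → α) (n : ℕ) :
    renewalPoint (𝓡.survivors g (x, y)) n =
      renewalPoint (x, fun i => g (y i)) (𝓡.survIdx y n) := by
  have h : ∀ n, renewalPoint (𝓡.survivors g (x, y)) n = x + disp g (𝓡.survIdx y n) y := by
    intro n
    induction n with
    | zero => simp [renewalPoint, survivors, stepFirst, survIdx]
    | succ n ih =>
      have h1 : renewalPoint (𝓡.survivors g (x, y)) (n + 1) =
          renewalPoint (𝓡.survivors g (x, y)) n + (𝓡.survivors g (x, y)).2 n := by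
        simp only [renewalPoint, Finset.sum_range_succ, add_assoc]
      rw [h1, ih, survIdx, disp_add, add_assoc]
      congr 2
      simp only [survivors]
      rw [iterate_stepNext]
      rfl
  rw [h n]
  rfl

variable {κ : Measure α}

theorem Regular.measurable_stepFirst (h : 𝓡.Regular κ) (hg : Measurable g) :
    Measurable (𝓡.stepFirst g) := by
  have h1 : Measurable fun p : (ℕ → α) × ℕ => (disp g p.2 p.1, shift p.2 p.1) :=
    measurable_from_prod_countable_left fun k =>
      show Measurable fun y => (disp g k y, shift k y) from
        (measurable_disp hg k).prodMk (measurable_shift k)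
  exact h1.comp (measurable_id.prodMk h.measurable_firstIdx)

theorem Regular.measurable_stepNext (h : 𝓡.Regular κ) (hg : Measurable g) :
    Measurable (𝓡.stepNext g) := by
  have h1 : Measurable fun p : (ℕ → α) × ℕ => (disp g p.2 p.1, shift p.2 p.1) :=
    measurable_from_prod_countable_left fun k =>
      show Measurable fun y => (disp g k y, shift k y) from
        (measurable_disp hg k).prodMk (measurable_shift k)
  exact h1.comp (measurable_id.prodMk h.measurable_nextIdx)

theorem Regular.measurableSet_survSet (h : 𝓡.Regular κ) : MeasurableSet 𝓡.survSet :=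
  (h.measurableSet_rightErasedLim 0).compl

variable [IsProbabilityMeasure κ] (h : 𝓡.Regular κ) (hg : Measurable g)

include h hg

theorem Regular.map_stepFirst :
    (iid κ).map (𝓡.stepFirst g) =
      (Measure.sum fun k => ((iid κ).restrict {y | 𝓡.FirstEvent y k}).map (disp g k)).prod
        ((iid κ).restrict 𝓡.survSet) := by
  have := map_stopped κ MeasurableSet.univ h.measurableSet_survSet h.measurableSet_firstEvent
    h.measurable_firstIdx (measurable_disp hg) firstEvent_splice disp_splice (by
      filter_upwards [ae_good κ h.measurable_time h.null_time] with y hy k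
      exact (and_iff_right trivial).trans (hy.firstIdx_eq_iff k))
  rw [← this, Measure.restrict_univ]
  rfl

theorem Regular.map_stepNext :
    ((iid κ).restrict 𝓡.survSet).map (𝓡.stepNext g) =
      (Measure.sum fun k => ((iid κ).restrict {y | 𝓡.NextEvent y k}).map (disp g k)).prod
        ((iid κ).restrict 𝓡.survSet) := by
  have := map_stopped κ h.measurableSet_survSet h.measurableSet_survSet h.measurableSet_nextEvent
    h.measurable_nextIdx (measurable_disp hg) nextEvent_splice disp_splice (by
      filter_upwards [ae_good κ h.measurable_time h.null_time] with y hy k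
      exact hy.nextIdx_eq_iff k)
  exact this.symm ▸ rfl

omit hg in
-- A first survivor exists almost surely, and its tail lies in `survSet`. Were that set null, the
-- product formula would make a probability law vanish.
theorem Regular.survSet_ne_zero : iid κ 𝓡.survSet ≠ 0 := by
  intro h0
  have h1 := h.map_stepFirst (g := fun _ => 0) measurable_const
  rw [Measure.restrict_eq_zero.2 h0, Measure.prod_zero] at h1
  have h2 := (Measure.isProbabilityMeasure_map
    (h.measurable_stepFirst (g := fun _ => 0) measurable_const).aemeasurable (μ := iid κ))
  rw [h1] at h2
  exact (IsProbabilityMeasure.ne_zero (0 : Measure (ℝ × (ℕ → α)))) rfl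

omit hg in
theorem Regular.isProbabilityMeasure_cond : IsProbabilityMeasure (ProbabilityTheory.cond (iid κ) 𝓡.survSet) :=
  cond_isProbabilityMeasure h.survSet_ne_zero

omit hg in
theorem Regular.restrict_survSet :
    (iid κ).restrict 𝓡.survSet = iid κ 𝓡.survSet • ProbabilityTheory.cond (iid κ) 𝓡.survSet := by
  rw [ProbabilityTheory.cond, smul_smul, ENNReal.mul_inv_cancel h.survSet_ne_zero (measure_ne_top _ _), one_smul]

theorem Regular.firstDispLaw_eq :
    𝓡.firstDispLaw g κ = iid κ 𝓡.survSet •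
      Measure.sum fun k => ((iid κ).restrict {y | 𝓡.FirstEvent y k}).map (disp g k) := by
  have := h.isProbabilityMeasure_cond
  have h1 := h.map_stepFirst hg
  -- The mass of `survSet` is moved to the first factor, leaving a probability measure in the
  -- second, so that the first marginal can be read off.
  rw [h.restrict_survSet, Measure.prod_smul_right, ← Measure.prod_smul_left] at h1
  have h2 := congr_arg Measure.fst h1
  rw [Measure.fst_prod] at h2
  rw [← h2, Measure.fst, Measure.map_map measurable_fst (h.measurable_stepFirst hg)]
  rfl

theorem Regular.measurePreserving_stepFirst :
    MeasurePreserving (𝓡.stepFirst g) (iid κ)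
      ((𝓡.firstDispLaw g κ).prod (ProbabilityTheory.cond (iid κ) 𝓡.survSet)) := by
  refine ⟨h.measurable_stepFirst hg, ?_⟩
  rw [h.map_stepFirst hg, h.firstDispLaw_eq hg, h.restrict_survSet, Measure.prod_smul_right,
    Measure.prod_smul_left]

theorem Regular.nextGapLaw_eq :
    𝓡.nextGapLaw g κ =
      Measure.sum fun k => ((iid κ).restrict {y | 𝓡.NextEvent y k}).map (disp g k) := by
  have := h.isProbabilityMeasure_cond
  have h1 : (ProbabilityTheory.cond (iid κ) 𝓡.survSet).map (𝓡.stepNext g) =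
      (Measure.sum fun k => ((iid κ).restrict {y | 𝓡.NextEvent y k}).map (disp g k)).prod
        (ProbabilityTheory.cond (iid κ) 𝓡.survSet) := by
    rw [ProbabilityTheory.cond, Measure.map_smul, h.map_stepNext hg, Measure.prod_smul_right]
  have h2 := congr_arg Measure.fst h1
  rw [Measure.fst_prod] at h2
  rw [← h2, Measure.fst, Measure.map_map measurable_fst (h.measurable_stepNext hg)]
  rfl

/-- The conditioned law reproduces itself at the next survivor, independently of the gap just
crossed. This is the hypothesis of `measurePreserving_iterate`. -/
theorem Regular.measurePreserving_stepNext :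
    MeasurePreserving (𝓡.stepNext g) (ProbabilityTheory.cond (iid κ) 𝓡.survSet)
      ((𝓡.nextGapLaw g κ).prod (ProbabilityTheory.cond (iid κ) 𝓡.survSet)) := by
  refine ⟨h.measurable_stepNext hg, ?_⟩
  rw [h.nextGapLaw_eq hg, ProbabilityTheory.cond, Measure.map_smul, h.map_stepNext hg, Measure.prod_smul_right]

theorem Regular.isProbabilityMeasure_firstDispLaw :
    IsProbabilityMeasure (𝓡.firstDispLaw g κ) :=
  Measure.isProbabilityMeasure_map (h.measurable_stepFirst hg).fst.aemeasurable

theorem Regular.isProbabilityMeasure_nextGapLaw :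
    IsProbabilityMeasure (𝓡.nextGapLaw g κ) :=
  have := h.isProbabilityMeasure_cond
  Measure.isProbabilityMeasure_map (h.measurable_stepNext hg).fst.aemeasurable

theorem Regular.measurePreserving_survivors (ν : Measure ℝ) [IsProbabilityMeasure ν]
    [IsProbabilityMeasure (𝓡.nextGapLaw g κ)] :
    MeasurePreserving (𝓡.survivors g) (ν.prod (iid κ))
      (((ν.prod (𝓡.firstDispLaw g κ)).map fun q => q.1 + q.2).prod
        (iid (𝓡.nextGapLaw g κ))) := by
  have := h.isProbabilityMeasure_cond
  have := h.isProbabilityMeasure_firstDispLaw hg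
  have h1 := (MeasurePreserving.id ν).prod (h.measurePreserving_stepFirst hg)
  have h2 := (measurePreserving_prodAssoc ν (𝓡.firstDispLaw g κ)
    (ProbabilityTheory.cond (iid κ) 𝓡.survSet)).symm.comp h1
  have h3 : MeasurePreserving (fun q : ℝ × ℝ => q.1 + q.2) (ν.prod (𝓡.firstDispLaw g κ))
      ((ν.prod (𝓡.firstDispLaw g κ)).map fun q => q.1 + q.2) :=
    Measurable.measurePreserving (by fun_prop) _
  exact (h3.prod (measurePreserving_iterate _ (h.measurePreserving_stepNext hg))).comp h2

theorem Regular.ae_nextGapLaw {P : Set ℝ} (hP : MeasurableSet P)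
    (hk : ∀ k, 0 < k → ∀ᵐ y ∂iid κ, disp g k y ∉ P) : 𝓡.nextGapLaw g κ P = 0 := by
  rw [h.nextGapLaw_eq hg, Measure.sum_apply _ hP, ENNReal.tsum_eq_zero]
  intro k
  rw [Measure.map_apply (measurable_disp hg k) hP]
  rcases Nat.eq_zero_or_pos k with rfl | hk'
  · have : {y : ℕ → α | 𝓡.NextEvent y 0} = ∅ := by ext; simp [NextEvent]
    rw [this]; simp
  · refine le_antisymm ((Measure.restrict_apply_le _ _).trans ?_) bot_le
    have h0 := hk k hk'
    rw [ae_iff] at h0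
    simp only [not_not] at h0
    exact h0.le

/-! ### Laplace transforms of the survivors -/

variable (hpos : ∀ᵐ a ∂κ, 0 ≤ g a) (s : ℂ)

omit [MeasurableSpace α] h hg [IsProbabilityMeasure κ] in
-- The generating functions require a weight bounded by 1 everywhere. The exponential is so only for
-- nonnegative gaps, hence the cut-off, which changes it on a null set.
theorem norm_boundedExp_le (hs : 0 ≤ s.re) (a : α) :
    ‖(if 0 ≤ g a then Complex.exp (-s * (g a : ℂ)) else 0)‖ ≤ 1 := by
  split_ifs with ha
  · rw [Complex.norm_exp]
    simp only [Complex.mul_re, Complex.neg_re, Complex.ofReal_re, Complex.ofReal_im, mul_zero,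
      sub_zero, Real.exp_le_one_iff]
    nlinarith
  · simp

omit h [IsProbabilityMeasure κ] in
theorem measurable_boundedExp :
    Measurable fun a => if 0 ≤ g a then Complex.exp (-s * (g a : ℂ)) else 0 :=
  Measurable.ite (measurableSet_le measurable_const hg) (by fun_prop) measurable_const

omit h hg in
include hpos in
theorem ae_weight_eq (n : ℕ) :
    ∀ᵐ y ∂iid κ, weight (fun a => if 0 ≤ g a then Complex.exp (-s * (g a : ℂ)) else 0) n y =
      Complex.exp (-s * (disp g n y : ℂ)) := by
  have : ∀ᵐ y ∂iid κ, ∀ i : ℕ, 0 ≤ g (y i) := ae_all_iff.2 fun i =>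
    (measurePreserving_eval_infinitePi (fun _ : ℕ => κ) i).quasiMeasurePreserving.ae hpos
  filter_upwards [this] with y hy
  simp only [weight, hy, if_true, disp, Complex.ofReal_sum, Finset.mul_sum, Complex.exp_sum]

omit h in
include hg hpos in
theorem hasSum_laplace {E : ℕ → Set (ℕ → α)} (hs : 0 ≤ s.re)
    [IsFiniteMeasure (Measure.sum fun k => ((iid κ).restrict (E k)).map (disp g k))] :
    HasSum (fun k => ∫ y in E k,
        weight (fun a => if 0 ≤ g a then Complex.exp (-s * (g a : ℂ)) else 0) k y ∂iid κ)
      (∫ x, Complex.exp (-s * (x : ℂ))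
        ∂(Measure.sum fun k => ((iid κ).restrict (E k)).map (disp g k))) := by
  have hx : ∀ᵐ x ∂(Measure.sum fun k => ((iid κ).restrict (E k)).map (disp g k)), 0 ≤ x := by
    rw [Measure.ae_sum_iff]
    intro k
    rw [ae_map_iff (measurable_disp hg k).aemeasurable measurableSet_Ici]
    have : ∀ᵐ y ∂iid κ, ∀ i : ℕ, 0 ≤ g (y i) := ae_all_iff.2 fun i =>
      (measurePreserving_eval_infinitePi (fun _ : ℕ => κ) i).quasiMeasurePreserving.ae hpos
    filter_upwards [ae_restrict_of_ae this] with y hy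
    exact Finset.sum_nonneg fun i _ => hy i
  have hint : Integrable (fun x : ℝ => Complex.exp (-s * (x : ℂ)))
      (Measure.sum fun k => ((iid κ).restrict (E k)).map (disp g k)) := by
    refine Integrable.of_bound (C := 1) (by fun_prop) ?_
    filter_upwards [hx] with x hx
    have := norm_boundedExp_le (g := fun x : ℝ => x) s hs x
    rwa [if_pos hx] at this
  refine (hasSum_integral_measure hint).congr_fun fun k => ?_
  rw [integral_map (measurable_disp hg k).aemeasurable (by fun_prop)]
  exact integral_congr_ae (ae_restrict_of_ae (ae_weight_eq hpos s k))

include hpos in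
theorem Regular.laplace_nextGapLaw (hs : 0 ≤ s.re) :
    ∫ x, Complex.exp (-s * (x : ℂ)) ∂𝓡.nextGapLaw g κ =
      1 - (1 - ∫ a, Complex.exp (-s * (g a : ℂ)) ∂κ) *
        Complex.exp (∫ a in 𝓡.right, Complex.exp (-s * (g a : ℂ)) ∂κ +
          ∫ a in 𝓡.left, Complex.exp (-s * (g a : ℂ)) ∂κ) := by
  have := h.isProbabilityMeasure_nextGapLaw hg
  rw [h.nextGapLaw_eq hg] at this ⊢
  rw [(hasSum_laplace hg hpos s hs).unique (hasSum_nextEvent h (measurable_boundedExp hg s)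
    (norm_boundedExp_le s hs))]
  have hae : ∀ᵐ a ∂κ, (if 0 ≤ g a then Complex.exp (-s * (g a : ℂ)) else 0) =
      Complex.exp (-s * (g a : ℂ)) := by
    filter_upwards [hpos] with a ha
    rw [if_pos ha]
  rw [integral_congr_ae hae, integral_congr_ae (ae_restrict_of_ae hae),
    integral_congr_ae (ae_restrict_of_ae hae)]

include hpos in
theorem Regular.laplace_firstDispLaw_aux (hs : 0 ≤ s.re) :
    ∫ x, Complex.exp (-s * (x : ℂ)) ∂𝓡.firstDispLaw g κ =
      (iid κ).real 𝓡.survSet * Complex.exp (∫ a in 𝓡.left, Complex.exp (-s * (g a : ℂ)) ∂κ) := by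
  have h1 := h.isProbabilityMeasure_firstDispLaw hg
  rw [h.firstDispLaw_eq hg] at h1 ⊢
  -- The sum is a probability measure once multiplied by the nonzero mass of `survSet`, so it cannot
  -- be infinite.
  have hfin : IsFiniteMeasure
      (Measure.sum fun k => ((iid κ).restrict {y | 𝓡.FirstEvent y k}).map (disp g k)) := by
    refine ⟨lt_of_le_of_ne le_top fun htop => ?_⟩
    have := h1.measure_univ
    rw [Measure.smul_apply, htop, smul_eq_mul, ENNReal.mul_top h.survSet_ne_zero] at this
    exact ENNReal.top_ne_one this
  rw [integral_smul_measure, (hasSum_laplace hg hpos s hs).unique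
    (hasSum_firstEvent h (measurable_boundedExp hg s) (norm_boundedExp_le s hs))]
  have hae : ∀ᵐ a ∂κ, (if 0 ≤ g a then Complex.exp (-s * (g a : ℂ)) else 0) =
      Complex.exp (-s * (g a : ℂ)) := by
    filter_upwards [hpos] with a ha
    rw [if_pos ha]
  rw [integral_congr_ae (ae_restrict_of_ae hae), Complex.real_smul]
  rfl

omit hg in
/-- The probability that the initial point is not erased by the domains on its right. -/
theorem Regular.measureReal_survSet :
    (iid κ).real 𝓡.survSet = Real.exp (-κ.real 𝓡.left) := by
  -- With zero lengths the formula only expresses the total mass of the displacement law, which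
  -- determines the normalising constant.
  have h1 := h.laplace_firstDispLaw_aux (g := fun _ => 0) measurable_const (by simp) 0 le_rfl
  have h2 := h.isProbabilityMeasure_firstDispLaw (g := fun _ => 0) measurable_const
  simp only [neg_zero, zero_mul, Complex.exp_zero, integral_const, probReal_univ, one_smul,
    measureReal_restrict_apply_univ, Complex.real_smul, mul_one] at h1
  rw [Real.exp_neg, ← one_div, eq_div_iff (Real.exp_ne_zero _)]
  apply Complex.ofReal_injective
  push_cast
  exact h1.symm

include hpos in
theorem Regular.laplace_firstDispLaw (hs : 0 ≤ s.re) :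
    ∫ x, Complex.exp (-s * (x : ℂ)) ∂𝓡.firstDispLaw g κ =
      Complex.exp (∫ a in 𝓡.left, Complex.exp (-s * (g a : ℂ)) ∂κ - κ.real 𝓡.left) := by
  rw [h.laplace_firstDispLaw_aux hg hpos s hs, h.measureReal_survSet, sub_eq_neg_add,
    Complex.exp_add]
  push_cast
  rfl

end Rules

namespace Rules

/-! ### The dynamics along a sequence of domains -/

variable {α : Type*} (𝓡 : Rules α)

/-- `X t i` tells whether point number `i` is present at time `t`, for the domain dynamics. -/
def Dynamics (y : ℕ → α) (X : ℝ≥0 → ℕ → Prop) : Prop :=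
  ∀ t i, X t i ↔ ¬ ∃ s ≤ t,
    (y i ∈ 𝓡.left ∧ (s : ℝ) = 𝓡.time (y i) ∧ ∀ r < s, X r i ∧ X r (i + 1)) ∨
    ∃ j, i = j + 1 ∧ y j ∈ 𝓡.right ∧ (s : ℝ) = 𝓡.time (y j) ∧ ∀ r < s, X r j ∧ X r i

/-- The solution of the domain dynamics. -/
def AliveAt (y : ℕ → α) (t : ℝ≥0) (i : ℕ) : Prop :=
  ¬ (𝓡.LeftErased y i ∧ 𝓡.time (y (i - 1)) ≤ t) ∧
    ¬ (𝓡.RightErasedLim y i ∧ 𝓡.time (y i) ≤ t)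

variable {𝓡} {y : ℕ → α}

/-- The decoupling: the one-sided recursions, each ignoring the other side, together solve the
two-sided dynamics. If both sides would erase a point, the earlier one does so in the true dynamics.
-/
theorem Good.dynamics_aliveAt (h : 𝓡.Good y) (h0 : ∀ i, 0 ≤ 𝓡.time (y i)) :
    𝓡.Dynamics y (𝓡.AliveAt y) := by
  have hrec : ∀ i, 𝓡.RightErasedLim y i ↔ y i ∈ 𝓡.left ∧
      ¬ (𝓡.RightErasedLim y (i + 1) ∧ 𝓡.time (y (i + 1)) < 𝓡.time (y i)) :=
    fun i => h.recursion (i + 1) i (Nat.lt_succ_self i)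
  intro t i
  rw [← not_iff_not, not_not]
  constructor
  · intro hn
    rw [AliveAt, ← not_or, not_not] at hn
    -- Is the erasure from the right the effective one, that is, not preceded by one from the left?
    by_cases hr : 𝓡.RightErasedLim y i ∧ 𝓡.time (y i) ≤ t ∧
        ¬ (𝓡.LeftErased y i ∧ 𝓡.time (y (i - 1)) < 𝓡.time (y i))
    · obtain ⟨hc, ht, hl⟩ := hr
      refine ⟨⟨𝓡.time (y i), h0 i⟩, ht, .inl ⟨((hrec i).1 hc).1, rfl, fun r hr => ?_⟩⟩
      replace hr : (r : ℝ) < 𝓡.time (y i) := hr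
      refine ⟨⟨fun h' => hl ⟨h'.1, h'.2.trans_lt hr⟩, fun h' => h'.2.not_gt hr⟩,
        ⟨fun h' => ?_, fun h' => ((hrec i).1 hc).2 ⟨h'.1, h'.2.trans_lt hr⟩⟩⟩
      rw [Nat.add_sub_cancel] at h'
      exact h'.2.not_gt hr
    · have hl : 𝓡.LeftErased y i ∧ 𝓡.time (y (i - 1)) ≤ t ∧
          ¬ (𝓡.RightErasedLim y i ∧ 𝓡.time (y i) < 𝓡.time (y (i - 1))) := by
        rcases hn with hn | hn
        · refine ⟨hn.1, hn.2, fun h' => hr ⟨h'.1, h'.2.le.trans hn.2, fun h2 => ?_⟩⟩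
          exact lt_asymm h'.2 h2.2
        · have h1 : 𝓡.LeftErased y i ∧ 𝓡.time (y (i - 1)) < 𝓡.time (y i) := by
            by_contra h'
            exact hr ⟨hn.1, hn.2, h'⟩
          exact ⟨h1.1, h1.2.le.trans hn.2, fun h' => lt_asymm h'.2 h1.2⟩
      obtain ⟨hl, ht, hr'⟩ := hl
      rcases i with _ | j
      · exact hl.elim
      rw [Nat.add_sub_cancel] at ht hr'
      have hl' := hl
      rw [LeftErased] at hl'
      refine ⟨⟨𝓡.time (y j), h0 j⟩, ht, .inr ⟨j, rfl, hl'.1, rfl, fun r hr => ?_⟩⟩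
      replace hr : (r : ℝ) < 𝓡.time (y j) := hr
      refine ⟨⟨fun h' => hl'.2 ⟨h'.1, h'.2.trans_lt hr⟩, fun h' => h'.2.not_gt hr⟩,
        ⟨fun h' => ?_, fun h' => hr' ⟨h'.1, h'.2.trans_lt hr⟩⟩⟩
      rw [Nat.add_sub_cancel] at h'
      exact h'.2.not_gt hr
  · rintro ⟨s, hs, ⟨hL, hT, hX⟩ | ⟨j, rfl, hR, hT, hX⟩⟩ ⟨h1, h2⟩
    · have hs' : (s : ℝ) ≤ t := hs
      refine h2 ⟨(hrec i).2 ⟨hL, fun h' => ?_⟩, hT ▸ hs'⟩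
      -- Evaluate at the ring time of domain `i + 1`: point `i + 1` is already absent then, while
      -- domain `i` needs it at all times before `s`.
      exact (hX ⟨_, h0 (i + 1)⟩ (show 𝓡.time (y (i + 1)) < (s : ℝ) from hT ▸ h'.2)).2.2 ⟨h'.1, le_rfl⟩
    · have hs' : (s : ℝ) ≤ t := hs
      refine h1 ⟨?_, by rw [Nat.add_sub_cancel]; exact hT ▸ hs'⟩
      rw [LeftErased]
      refine ⟨hR, fun h' => ?_⟩
      exact (hX ⟨_, h0 (j - 1)⟩ (show 𝓡.time (y (j - 1)) < (s : ℝ) from hT ▸ h'.2)).1.1 ⟨h'.1, le_rfl⟩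

/-- A neighbouring domain with an earlier ring time. -/
def Earlier (𝓡 : Rules α) (y : ℕ → α) (j i : ℕ) : Prop :=
  (j = i + 1 ∨ i = j + 1) ∧ 𝓡.time (y j) < 𝓡.time (y i)

/-- A chain of neighbours with decreasing ring times cannot turn back, so its indices move in one
direction. To the right it would meet an ascent, to the left it runs out of indices. -/
theorem Good.wellFounded_earlier (h : 𝓡.Good y) : WellFounded (𝓡.Earlier y) := by
  rw [wellFounded_iff_isEmpty_descending_chain]
  refine ⟨fun ⟨f, hf⟩ => ?_⟩
  have hlt : ∀ n, 𝓡.time (y (f (n + 1))) < 𝓡.time (y (f n)) := fun n => (hf n).2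
  have hback : ∀ n, f (n + 1 + 1) ≠ f n := fun n he => by
    have := (hlt (n + 1)).trans (hlt n)
    rw [he] at this
    exact lt_irrefl _ this
  rcases (hf 0).1 with h1 | h1
  · have hup : ∀ n, f (n + 1) = f n + 1 := by
      intro n
      induction n with
      | zero => exact h1
      | succ n ih =>
        rcases (hf (n + 1)).1 with h2 | h2
        · exact h2
        · exact absurd (show f (n + 1 + 1) = f n by omega) (hback n)
    have hf' : ∀ n, f n = f 0 + n := by
      intro n
      induction n with
      | zero => rfl
      | succ n ih => rw [hup, ih]; omega
    obtain ⟨i, hi, hi'⟩ := h.ascent (f 0)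
    obtain ⟨n, rfl⟩ := Nat.exists_eq_add_of_le hi
    have := hlt n
    rw [hf' (n + 1), hf' n] at this
    exact lt_asymm this hi'
  · have hdown : ∀ n, f n = f (n + 1) + 1 := by
      intro n
      induction n with
      | zero => exact h1
      | succ n ih =>
        rcases (hf (n + 1)).1 with h2 | h2
        · exact absurd (show f (n + 1 + 1) = f n by omega) (hback n)
        · exact h2
    have hf' : ∀ n, f 0 = f n + n := by
      intro n
      induction n with
      | zero => rfl
      | succ n ih => rw [ih, hdown n]; omega
    have := hf' (f 0 + 1)
    omega

theorem Good.dynamics_unique (h : 𝓡.Good y) {X X' : ℝ≥0 → ℕ → Prop} (hX : 𝓡.Dynamics y X)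
    (hX' : 𝓡.Dynamics y X') (t : ℝ≥0) (i : ℕ) : X t i ↔ X' t i := by
  -- Before domain `i` rings, its extremes can be affected only by neighbours that ring earlier, so
  -- well-founded induction applies.
  have key : ∀ i, ∀ r : ℝ≥0, (r : ℝ) < 𝓡.time (y i) →
      (X r i ↔ X' r i) ∧ (X r (i + 1) ↔ X' r (i + 1)) := by
    intro i
    induction i using h.wellFounded_earlier.induction with
    | _ i ih =>
      intro r hr
      constructor
      · rw [hX r i, hX' r i]
        refine not_congr (exists_congr fun s => and_congr_right fun hs => or_congr ?_ ?_)
        · have hs' : (s : ℝ) ≤ r := hs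
          refine and_congr_right fun _ => and_congr_right fun hT => ?_
          linarith
        · refine exists_congr fun j => and_congr_right fun hj => and_congr_right fun _ =>
            and_congr_right fun hT => forall₂_congr fun r' hr' => ?_
          subst hj
          have hs' : (s : ℝ) ≤ r := hs
          have hr'' : (r' : ℝ) < s := hr'
          have := ih j ⟨.inr rfl, by linarith⟩ r' (by linarith)
          exact and_congr this.1 this.2
      · rw [hX r (i + 1), hX' r (i + 1)]
        refine not_congr (exists_congr fun s => and_congr_right fun hs => or_congr ?_ ?_)
        · have hs' : (s : ℝ) ≤ r := hs
          refine and_congr_right fun _ => and_congr_right fun hT =>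
            forall₂_congr fun r' hr' => ?_
          have hr'' : (r' : ℝ) < s := hr'
          have := ih (i + 1) ⟨.inl rfl, by linarith⟩ r' (by linarith)
          exact and_congr this.1 this.2
        · refine exists_congr fun j => and_congr_right fun hj => and_congr_right fun _ =>
            and_congr_right fun hT => ?_
          obtain rfl : i = j := by omega
          have hs' : (s : ℝ) ≤ r := hs
          linarith
  rw [hX t i, hX' t i]
  refine not_congr (exists_congr fun s => and_congr_right fun hs => or_congr ?_ ?_)
  · refine and_congr_right fun _ => and_congr_right fun hT => forall₂_congr fun r hr => ?_
    have hr' : (r : ℝ) < s := hr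
    have := key i r (by linarith)
    exact and_congr this.1 this.2
  · refine exists_congr fun j => and_congr_right fun hj => and_congr_right fun _ =>
      and_congr_right fun hT => forall₂_congr fun r hr => ?_
    subst hj
    have hr' : (r : ℝ) < s := hr
    have := key j r (by linarith)
    exact and_congr this.1 this.2

end Rules

/-! ### The rules of the coalescence process -/

section DomainRules

variable (rateL rateR : ℝ → ℝ)

/-- A domain: its length, its clock variable and its coin variable. -/
abbrev Letter : Type := ℝ × (ℝ × unitInterval)

/-- The ring time of a domain. (It has no meaning when the domain never rings.) -/
def ringTime (a : Letter) : ℝ :=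
  if 0 < rateL a.1 + rateR a.1 then a.2.1 / (rateL a.1 + rateR a.1) else a.2.1

/-- The rules up to time `t`: the domains that ring after time `t` are inactive. -/
def rules (t : ℝ≥0∞) : Rules Letter where
  time := ringTime rateL rateR
  left := {a | (0 < rateL a.1 + rateR a.1 ∧ (a.2.2 : ℝ) ≤ rateR a.1 / (rateL a.1 + rateR a.1)) ∧
    ENNReal.ofReal (ringTime rateL rateR a) ≤ t}
  right := {a | (0 < rateL a.1 + rateR a.1 ∧
    ¬ (a.2.2 : ℝ) ≤ rateR a.1 / (rateL a.1 + rateR a.1)) ∧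
    ENNReal.ofReal (ringTime rateL rateR a) ≤ t}
  disj _ h h' := h'.1.2 h.1.2

variable {rateL rateR}

theorem good_rules_iff {y : ℕ → Letter} (t t' : ℝ≥0∞) :
    (rules rateL rateR t).Good y ↔ (rules rateL rateR t').Good y :=
  ⟨fun h => ⟨h.inj, h.descent, h.ascent⟩, fun h => ⟨h.inj, h.descent, h.ascent⟩⟩

/-- Silencing the late domains does not alter earlier erasures, because a domain can be obstructed
only by one that rings before it. -/
theorem leftErased_rules (y : ℕ → Letter) (t : ℝ≥0∞) (i : ℕ) :
    (rules rateL rateR t).LeftErased y i ↔ (rules rateL rateR ⊤).LeftErased y i ∧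
      ENNReal.ofReal (ringTime rateL rateR (y (i - 1))) ≤ t := by
  induction i with
  | zero => simp [Rules.LeftErased]
  | succ i ih =>
    rw [Rules.LeftErased, Rules.LeftErased, ih, Nat.add_sub_cancel]
    simp only [rules, Set.mem_ofPred_eq, le_top, and_true]
    have : ringTime rateL rateR (y (i - 1)) < ringTime rateL rateR (y i) →
        ENNReal.ofReal (ringTime rateL rateR (y i)) ≤ t →
          ENNReal.ofReal (ringTime rateL rateR (y (i - 1))) ≤ t :=
      fun h1 h2 => (ENNReal.ofReal_le_ofReal h1.le).trans h2
    tauto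

theorem rightErased_rules (y : ℕ → Letter) (t : ℝ≥0∞) (n i : ℕ) :
    (rules rateL rateR t).RightErased y n i ↔ (rules rateL rateR ⊤).RightErased y n i ∧
      ENNReal.ofReal (ringTime rateL rateR (y i)) ≤ t := by
  induction n generalizing i with
  | zero => simp [Rules.RightErased]
  | succ n ih =>
    rw [Rules.RightErased, Rules.RightErased, ih]
    simp only [rules, Set.mem_ofPred_eq, le_top, and_true]
    have : ringTime rateL rateR (y (i + 1)) < ringTime rateL rateR (y i) →
        ENNReal.ofReal (ringTime rateL rateR (y i)) ≤ t →
          ENNReal.ofReal (ringTime rateL rateR (y (i + 1))) ≤ t :=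
      fun h1 h2 => (ENNReal.ofReal_le_ofReal h1.le).trans h2
    tauto

theorem surv_rules (y : ℕ → Letter) (t : ℝ≥0∞) (i : ℕ) :
    (rules rateL rateR t).Surv y i ↔
      ¬ ((rules rateL rateR ⊤).LeftErased y i ∧
        ENNReal.ofReal (ringTime rateL rateR (y (i - 1))) ≤ t) ∧
      ¬ ((rules rateL rateR ⊤).RightErasedLim y i ∧
        ENNReal.ofReal (ringTime rateL rateR (y i)) ≤ t) := by
  rw [Rules.Surv, leftErased_rules]
  refine and_congr_right fun _ => not_congr ?_
  simp only [Rules.RightErasedLim, rightErased_rules (t := t)]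
  constructor
  · rintro ⟨N, hN⟩
    exact ⟨⟨N, fun n hn => (hN n hn).1⟩, (hN N le_rfl).2⟩
  · rintro ⟨⟨N, hN⟩, ht⟩
    exact ⟨N, fun n hn => ⟨hN n hn, ht⟩⟩

theorem surv_rules_coe {y : ℕ → Letter} (t : ℝ≥0) (i : ℕ) :
    (rules rateL rateR t).Surv y i ↔ (rules rateL rateR ⊤).AliveAt y t i := by
  rw [surv_rules, Rules.AliveAt]
  have : ∀ j, ENNReal.ofReal (ringTime rateL rateR (y j)) ≤ (t : ℝ≥0∞) ↔
      (rules rateL rateR ⊤).time (y j) ≤ t := fun j => by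
    rw [← ENNReal.ofReal_coe_nnreal, ENNReal.ofReal_le_ofReal_iff t.coe_nonneg]
    rfl
  rw [this, this]

theorem surv_rules_top {y : ℕ → Letter} (i : ℕ) :
    (rules rateL rateR ⊤).Surv y i ↔ ∀ t : ℝ≥0, (rules rateL rateR t).Surv y i := by
  constructor
  · intro h t
    rw [surv_rules]
    exact ⟨fun h' => h.1 h'.1, fun h' => h.2 h'.1⟩
  · intro h
    refine ⟨fun h' => ?_, fun h' => ?_⟩
    · have := (surv_rules _ _ _).1 (h (Real.toNNReal (ringTime rateL rateR (y (i - 1)))))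
      exact this.1 ⟨h', le_rfl⟩
    · have := (surv_rules _ _ _).1 (h (Real.toNNReal (ringTime rateL rateR (y i))))
      exact this.2 ⟨h', le_rfl⟩

end DomainRules

/-! ### Renewal configurations -/

section Renewal

/-- The gaps are at least `c`. -/
def GapsGE (c : ℝ) (p : ℝ × (ℕ → ℝ)) : Prop := ∀ i, c ≤ p.2 i

theorem renewalPoint_succ (p : ℝ × (ℕ → ℝ)) (k : ℕ) :
    renewalPoint p (k + 1) = renewalPoint p k + p.2 k := by
  simp only [renewalPoint, Finset.sum_range_succ, add_assoc]

@[fun_prop]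
theorem measurable_renewalPoint (k : ℕ) : Measurable fun p => renewalPoint p k := by
  unfold renewalPoint
  fun_prop

variable {c : ℝ} {p : ℝ × (ℕ → ℝ)}

theorem GapsGE.strictMono (hp : GapsGE c p) (hc : 0 < c) : StrictMono (renewalPoint p) :=
  strictMono_nat_of_lt_succ fun k => by
    rw [renewalPoint_succ]
    linarith [hp k]

theorem GapsGE.le_renewalPoint (hp : GapsGE c p) (k : ℕ) : p.1 + k * c ≤ renewalPoint p k := by
  induction k with
  | zero => simp [renewalPoint]
  | succ k ih =>
    rw [renewalPoint_succ]
    push_cast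
    linarith [hp k]

theorem GapsGE.exists_lt (hp : GapsGE c p) (hc : 0 < c) (b : ℝ) : ∃ k, b < renewalPoint p k := by
  obtain ⟨k, hk⟩ := exists_nat_gt ((b - p.1) / c)
  rw [div_lt_iff₀ hc] at hk
  exact ⟨k, by linarith [hp.le_renewalPoint k]⟩

theorem GapsGE.finite_index (hp : GapsGE c p) (hc : 0 < c) (b : ℝ) :
    {i | renewalPoint p i ≤ b}.Finite := by
  obtain ⟨k, hk⟩ := hp.exists_lt hc b
  refine (Set.finite_Iio k).subset fun i hi => ?_
  exact (hp.strictMono hc).lt_iff_lt.1 (lt_of_le_of_lt hi hk)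

theorem GapsGE.finite_range (hp : GapsGE c p) (hc : 0 < c) (a b : ℝ) :
    (Set.range (renewalPoint p) ∩ Set.Icc a b).Finite := by
  refine ((hp.finite_index hc b).image (renewalPoint p)).subset ?_
  rintro _ ⟨⟨i, rfl⟩, hi⟩
  exact ⟨i, hi.2, rfl⟩

theorem coe_renewalConfig (h : ∀ a b : ℝ, (Set.range (renewalPoint p) ∩ Set.Icc a b).Finite) :
    (renewalConfig p).1 = Set.range (renewalPoint p) := by
  have h1 : renewalConfig p = ⟨Set.range (renewalPoint p), h⟩ := dif_pos h
  rw [h1]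

theorem GapsGE.coe_renewalConfig (hp : GapsGE c p) (hc : 0 < c) :
    (renewalConfig p).1 = Set.range (renewalPoint p) :=
  Coalescence.coe_renewalConfig (hp.finite_range hc)

theorem GapsGE.isDomain_iff (hp : GapsGE c p) (hc : 0 < c) (a b : ℝ) :
    IsDomain (renewalConfig p) a b ↔ ∃ i, renewalPoint p i = a ∧ renewalPoint p (i + 1) = b := by
  have hm := hp.strictMono hc
  rw [IsDomain, hp.coe_renewalConfig hc]
  constructor
  · rintro ⟨⟨i, rfl⟩, ⟨j, rfl⟩, hij, hno⟩
    have hij' := hm.lt_iff_lt.1 hij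
    refine ⟨i, rfl, congr_arg _ ?_⟩
    by_contra hne
    exact hno _ ⟨i + 1, rfl⟩ ⟨hm (Nat.lt_succ_self i), hm (by omega)⟩
  · rintro ⟨i, rfl, rfl⟩
    refine ⟨⟨i, rfl⟩, ⟨i + 1, rfl⟩, hm (Nat.lt_succ_self i), ?_⟩
    rintro _ ⟨j, rfl⟩ ⟨h1, h2⟩
    have := hm.lt_iff_lt.1 h1
    have := hm.lt_iff_lt.1 h2
    omega

/-- The label of the first point. -/
def firstLabel (p : ℝ × (ℕ → ℝ)) : ℤ := 1 - (sInf {n | 0 < renewalPoint p n} : ℕ)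

theorem measurable_firstLabel : Measurable firstLabel := by
  have h : Measurable fun p => sInf {n | 0 < renewalPoint p n} :=
    measurable_sInf_nat fun n => measurableSet_lt measurable_const (measurable_renewalPoint n)
  exact (measurable_of_countable fun n : ℕ => (1 : ℤ) - n).comp h

/-- If `m` is the first index with a positive point, counting points from the origin gives `k - m +
1` in both cases, so labels and indices differ by a constant. -/
theorem GapsGE.label_renewalPoint (hp : GapsGE c p) (hc : 0 < c) (k : ℕ) :
    label (renewalConfig p) (renewalPoint p k) = firstLabel p + k := by
  have hm := hp.strictMono hc
  rw [label, hp.coe_renewalConfig hc, firstLabel]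
  set m := sInf {n | 0 < renewalPoint p n} with hmdef
  have hpos : ∀ i, 0 < renewalPoint p i ↔ m ≤ i := by
    intro i
    refine ⟨fun h => Nat.sInf_le h, fun h => ?_⟩
    have h1 : 0 < renewalPoint p m := Nat.sInf_mem (hp.exists_lt hc 0)
    exact h1.trans_le (hm.monotone h)
  split_ifs with hk
  · have hset : Set.range (renewalPoint p) ∩ Set.Ioc 0 (renewalPoint p k) =
        renewalPoint p '' (Finset.Icc m k : Finset ℕ) := by
      ext z
      constructor
      · rintro ⟨⟨i, rfl⟩, h1, h2⟩
        exact ⟨i, by simpa using ⟨(hpos i).1 h1, hm.le_iff_le.1 h2⟩, rfl⟩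
      · rintro ⟨i, hi, rfl⟩
        rw [Finset.coe_Icc] at hi
        exact ⟨⟨i, rfl⟩, (hpos i).2 hi.1, hm.monotone hi.2⟩
    rw [hset, Set.ncard_image_of_injective _ hm.injective, Set.ncard_coe_finset, Nat.card_Icc]
    have := (hpos k).1 hk
    omega
  · have hset : Set.range (renewalPoint p) ∩ Set.Ioc (renewalPoint p k) 0 =
        renewalPoint p '' (Finset.Ioo k m : Finset ℕ) := by
      ext z
      constructor
      · rintro ⟨⟨i, rfl⟩, h1, h2⟩
        refine ⟨i, ?_, rfl⟩
        rw [Finset.coe_Ioo]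
        refine ⟨hm.lt_iff_lt.1 h1, ?_⟩
        rw [← not_lt, hpos] at h2
        omega
      · rintro ⟨i, hi, rfl⟩
        rw [Finset.coe_Ioo] at hi
        refine ⟨⟨i, rfl⟩, hm hi.1, ?_⟩
        rw [← not_lt, hpos]
        have := hi.2
        omega
    rw [hset, Set.ncard_image_of_injective _ hm.injective, Set.ncard_coe_finset, Nat.card_Ioo]
    rw [hpos] at hk
    omega

end Renewal

/-! ### The path started from a renewal configuration -/

section Path

variable (rateL rateR : ℝ → ℝ) {c : ℝ} {p : ℝ × (ℕ → ℝ)} {ω : Marks}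

/-- The first point, and the sequence of the domains. -/
def encode (q : (ℝ × (ℕ → ℝ)) × Marks) : ℝ × (ℕ → Letter) :=
  (q.1.1, fun k => (q.1.2 k, q.2 (firstLabel q.1 + k)))

/-- The ring times are distinct and not eventually monotone, and the clocks are positive. -/
def Typical (y : ℕ → Letter) : Prop :=
  (rules rateL rateR ⊤).Good y ∧ ∀ i, 0 < (y i).2.1

variable {rateL rateR}

theorem Typical.ringTime_pos {y : ℕ → Letter} (h : Typical rateL rateR y) (i : ℕ) :
    0 < ringTime rateL rateR (y i) := by
  rw [ringTime]
  split_ifs with h'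
  · exact div_pos (h.2 i) h'
  · exact h.2 i

theorem GapsGE.erasedAt_iff (hp : GapsGE c p) (hc : 0 < c) (ξ : ℝ≥0 → Config) (i : ℕ) (s : ℝ≥0) :
    ErasedAt rateL rateR (renewalConfig p) ω ξ (renewalPoint p i) s ↔
      ((encode (p, ω)).2 i ∈ (rules rateL rateR ⊤).left ∧
        (s : ℝ) = (rules rateL rateR ⊤).time ((encode (p, ω)).2 i) ∧
        ∀ r < s, renewalPoint p i ∈ (ξ r).1 ∧ renewalPoint p (i + 1) ∈ (ξ r).1) ∨
      ∃ j, i = j + 1 ∧ (encode (p, ω)).2 j ∈ (rules rateL rateR ⊤).right ∧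
        (s : ℝ) = (rules rateL rateR ⊤).time ((encode (p, ω)).2 j) ∧
        ∀ r < s, renewalPoint p j ∈ (ξ r).1 ∧ renewalPoint p i ∈ (ξ r).1 := by
  have hm := hp.strictMono hc
  have hgap : ∀ k, renewalPoint p (k + 1) - renewalPoint p k = p.2 k := fun k => by
    rw [renewalPoint_succ, add_sub_cancel_left]
  simp only [ErasedAt, hp.isDomain_iff hc]
  refine or_congr ?_ ?_
  · constructor
    · rintro ⟨_, ⟨k, hk, rfl⟩, hr, hcoin, hX⟩
      obtain rfl := hm.injective hk
      rw [RingsAt, hp.label_renewalPoint hc, hgap] at hr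
      rw [CoinLeft, hp.label_renewalPoint hc, hgap] at hcoin
      refine ⟨⟨⟨hr.1, hcoin⟩, le_top⟩, hr.2.trans ?_, hX⟩
      exact (if_pos hr.1).symm
    · rintro ⟨⟨⟨h1, hcoin⟩, -⟩, hT, hX⟩
      refine ⟨_, ⟨i, rfl, rfl⟩, ?_, ?_, hX⟩
      · rw [RingsAt, hp.label_renewalPoint hc, hgap]
        exact ⟨h1, hT.trans (if_pos h1)⟩
      · rw [CoinLeft, hp.label_renewalPoint hc, hgap]
        exact hcoin
  · constructor
    · rintro ⟨_, ⟨k, rfl, hk⟩, hr, hcoin, hX⟩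
      obtain rfl := hm.injective hk
      rw [RingsAt, hp.label_renewalPoint hc, hgap] at hr
      rw [CoinLeft, hp.label_renewalPoint hc, hgap] at hcoin
      refine ⟨k, rfl, ⟨⟨hr.1, hcoin⟩, le_top⟩, hr.2.trans ?_, hX⟩
      exact (if_pos hr.1).symm
    · rintro ⟨j, rfl, ⟨⟨h1, hcoin⟩, -⟩, hT, hX⟩
      refine ⟨_, ⟨j, rfl, rfl⟩, ?_, ?_, hX⟩
      · rw [RingsAt, hp.label_renewalPoint hc, hgap]
        exact ⟨h1, hT.trans (if_pos h1)⟩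
      · rw [CoinLeft, hp.label_renewalPoint hc, hgap]
        exact hcoin

theorem GapsGE.followsDynamics_iff (hp : GapsGE c p) (hc : 0 < c) (ξ : ℝ≥0 → Config) :
    FollowsDynamics rateL rateR (renewalConfig p) ω ξ ↔
      (∀ t, (ξ t).1 ⊆ Set.range (renewalPoint p)) ∧
        (rules rateL rateR ⊤).Dynamics (encode (p, ω)).2 fun t i => renewalPoint p i ∈ (ξ t).1 := by
  simp only [FollowsDynamics, Rules.Dynamics, hp.coe_renewalConfig hc]
  constructor
  · intro h
    refine ⟨fun t z hz => ((h t z).1 hz).1, fun t i => ?_⟩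
    rw [h t, and_iff_right (Set.mem_range_self i)]
    simp only [hp.erasedAt_iff hc]
  · rintro ⟨h1, h2⟩ t z
    constructor
    · intro hz
      obtain ⟨i, rfl⟩ := h1 t hz
      have := (h2 t i).1 hz
      refine ⟨Set.mem_range_self i, ?_⟩
      simpa only [hp.erasedAt_iff hc] using this
    · rintro ⟨⟨i, rfl⟩, h⟩
      rw [h2 t i]
      simpa only [hp.erasedAt_iff hc] using h

/-- The points whose index satisfies `P`. -/
def GapsGE.restrict (hp : GapsGE c p) (hc : 0 < c) (P : ℕ → Prop) : Config :=
  ⟨renewalPoint p '' {i | P i}, fun a b =>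
    (hp.finite_range hc a b).subset (Set.inter_subset_inter_left _ (Set.image_subset_range _ _))⟩

theorem GapsGE.mem_restrict (hp : GapsGE c p) (hc : 0 < c) (P : ℕ → Prop) (i : ℕ) :
    renewalPoint p i ∈ (hp.restrict hc P).1 ↔ P i := by
  constructor
  · rintro ⟨j, hj, hij⟩
    rwa [← (hp.strictMono hc).injective hij]
  · exact fun h => ⟨i, h, rfl⟩

theorem GapsGE.path_eq (hp : GapsGE c p) (hc : 0 < c)
    (hy : Typical rateL rateR (encode (p, ω)).2) :
    path rateL rateR (renewalConfig p) ω = fun t =>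
      hp.restrict hc ((rules rateL rateR ⊤).AliveAt (encode (p, ω)).2 t) := by
  have h1 := hy.1.dynamics_aliveAt fun i => (hy.ringTime_pos i).le
  have hfol : FollowsDynamics rateL rateR (renewalConfig p) ω fun t =>
      hp.restrict hc ((rules rateL rateR ⊤).AliveAt (encode (p, ω)).2 t) := by
    rw [hp.followsDynamics_iff hc]
    refine ⟨fun t => Set.image_subset_range _ _, ?_⟩
    simpa only [hp.mem_restrict hc] using h1
  have hex : ∃! ξ : ℝ≥0 → Config, FollowsDynamics rateL rateR (renewalConfig p) ω ξ := by
    refine ⟨_, hfol, fun ξ hξ => ?_⟩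
    obtain ⟨hsub, hdyn⟩ := (hp.followsDynamics_iff hc ξ).1 hξ
    have hu := hy.1.dynamics_unique hdyn h1
    funext t
    refine Subtype.ext (Set.ext fun z => ⟨fun hz => ?_, ?_⟩)
    · obtain ⟨i, rfl⟩ := hsub t hz
      exact ⟨i, (hu t i).1 hz, rfl⟩
    · rintro ⟨i, hi, rfl⟩
      exact (hu t i).2 hi
  rw [path, dif_pos hex]
  exact hex.unique hex.choose_spec.1 hfol

theorem GapsGE.coe_state (hp : GapsGE c p) (hc : 0 < c)
    (hy : Typical rateL rateR (encode (p, ω)).2) (t : ℝ≥0∞) :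
    (state rateL rateR (renewalConfig p) ω t).1 =
      renewalPoint p '' {i | (rules rateL rateR t).Surv (encode (p, ω)).2 i} := by
  by_cases ht : t = ⊤
  · subst ht
    have h1 : (state rateL rateR (renewalConfig p) ω ⊤).1 =
        ⋂ r : ℝ≥0, (path rateL rateR (renewalConfig p) ω r).1 :=
      congr_arg Subtype.val (if_pos rfl)
    rw [h1, hp.path_eq hc hy]
    ext z
    simp only [Set.mem_iInter]
    constructor
    · intro h
      obtain ⟨i, -, rfl⟩ := h 0
      refine ⟨i, (surv_rules_top i).2 fun t => ?_, rfl⟩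
      exact (surv_rules_coe t i).2 ((hp.mem_restrict hc _ i).1 (h t))
    · rintro ⟨i, hi, rfl⟩ t
      exact (hp.mem_restrict hc _ i).2 ((surv_rules_coe t i).1 ((surv_rules_top i).1 hi t))
  · have h1 : state rateL rateR (renewalConfig p) ω t =
        path rateL rateR (renewalConfig p) ω t.toNNReal := if_neg ht
    rw [h1, hp.path_eq hc hy]
    lift t to ℝ≥0 using ht
    simp only [ENNReal.toNNReal_coe, GapsGE.restrict, surv_rules_coe]

theorem GapsGE.state_eq (hp : GapsGE c p) (hc : 0 < c)
    (hy : Typical rateL rateR (encode (p, ω)).2) (t : ℝ≥0∞) :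
    state rateL rateR (renewalConfig p) ω t =
      renewalConfig ((rules rateL rateR t).survivors Prod.fst (encode (p, ω))) := by
  have hgood : (rules rateL rateR t).Good (encode (p, ω)).2 := (good_rules_iff _ _).1 hy.1
  have hrange : Set.range (renewalPoint
        ((rules rateL rateR t).survivors Prod.fst (encode (p, ω)))) =
      renewalPoint p '' {i | (rules rateL rateR t).Surv (encode (p, ω)).2 i} := by
    have hpt : ∀ n, renewalPoint ((rules rateL rateR t).survivors Prod.fst (encode (p, ω))) n =
        renewalPoint p ((rules rateL rateR t).survIdx (encode (p, ω)).2 n) := fun n =>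
      Rules.renewalPoint_survivors (𝓡 := rules rateL rateR t) (g := Prod.fst) _ _ n
    ext z
    constructor
    · rintro ⟨n, rfl⟩
      exact ⟨_, hgood.surv_survIdx n, (hpt n).symm⟩
    · rintro ⟨i, hi, rfl⟩
      obtain ⟨n, rfl⟩ := hgood.exists_survIdx hi
      exact ⟨n, hpt n⟩
  refine Subtype.ext ?_
  rw [hp.coe_state hc hy, Coalescence.coe_renewalConfig, hrange]
  intro a b
  rw [hrange]
  exact (hp.restrict hc _).2 a b

end Path

/-! ### Measurability of configurations -/

section Decode

theorem measurable_ncard_inter {A : Set ℝ} (hA : MeasurableSet A) (hb : Bornology.IsBounded A) :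
    Measurable fun ξ : Config => (ξ.1 ∩ A).ncard :=
  measurable_to_countable' fun n => MeasurableSpace.measurableSet_generateFrom ⟨A, n, hA, hb, rfl⟩

theorem measurable_ncard_index {β : Type*} [MeasurableSpace β] {B : ℕ → Set β}
    (hB : ∀ i, MeasurableSet (B i)) : Measurable fun b => {i | b ∈ B i}.ncard := by
  have hs : ∀ s : Finset ℕ, MeasurableSet {b | ∀ i, i ∈ s ↔ b ∈ B i} := by
    intro s
    simp only [Set.ofPred_forall]
    refine .iInter fun i => ?_
    by_cases hi : i ∈ s
    · simp only [hi, true_iff]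
      exact hB i
    · simp only [hi, false_iff]
      exact (hB i).compl
  refine measurable_to_countable' fun n => ?_
  -- The second piece collects the infinite sets, whose `ncard` is 0 by convention.
  have : (fun b => {i | b ∈ B i}.ncard) ⁻¹' {n} =
      (⋃ s : Finset ℕ, ⋃ _ : s.card = n, {b | ∀ i, i ∈ s ↔ b ∈ B i}) ∪
        ({_b | n = 0} ∩ ⋂ s : Finset ℕ, {b | ∀ i, i ∈ s ↔ b ∈ B i}ᶜ) := by
    ext b
    simp only [Set.mem_preimage, Set.mem_singleton_iff, Set.mem_union, Set.mem_iUnion,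
      Set.mem_inter_iff, Set.mem_iInter, Set.mem_compl_iff, Set.mem_ofPred_eq, exists_prop]
    constructor
    · rintro rfl
      by_cases hfin : {i | b ∈ B i}.Finite
      · exact .inl ⟨hfin.toFinset, (Set.ncard_eq_toFinset_card _ hfin).symm, fun i => by simp⟩
      · refine .inr ⟨Set.Infinite.ncard hfin, fun s hs => hfin ?_⟩
        exact s.finite_toSet.subset fun i hi => (hs i).2 hi
    · rintro (⟨s, rfl, hs⟩ | ⟨rfl, hs⟩)
      · have : {i | b ∈ B i} = s := by ext i; exact (hs i).symm
        rw [this, Set.ncard_coe_finset]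
      · refine Set.Infinite.ncard fun hfin => hs hfin.toFinset fun i => by simp
  rw [this]
  exact (MeasurableSet.iUnion fun s => .iUnion fun _ => hs s).union
    ((MeasurableSet.const _).inter (.iInter fun s => (hs s).compl))

theorem measurableSet_gapsGE (c : ℝ) : MeasurableSet {p | GapsGE c p} := by
  simp only [GapsGE, Set.ofPred_forall]
  exact .iInter fun i => measurableSet_le measurable_const (by fun_prop)

/-- The empty configuration. -/
def emptyConfig : Config := ⟨∅, fun a b => by simp⟩

open Classical in
/-- The renewal configuration, or the empty one if the gaps are not all at least `c`. -/
def renewalConfigGE (c : ℝ) (p : ℝ × (ℕ → ℝ)) : Config :=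
  if GapsGE c p then renewalConfig p else emptyConfig

variable {c : ℝ}

theorem GapsGE.renewalConfigGE_eq {p : ℝ × (ℕ → ℝ)} (hp : GapsGE c p) :
    renewalConfigGE c p = renewalConfig p := if_pos hp

theorem measurable_renewalConfigGE (hc : 0 < c) : Measurable (renewalConfigGE c) := by
  refine measurable_generateFrom ?_
  rintro _ ⟨A, n, hA, hb, rfl⟩
  have hcount : Measurable fun p : ℝ × (ℕ → ℝ) => {i | p ∈ {p | renewalPoint p i ∈ A}}.ncard :=
    measurable_ncard_index fun i => measurable_renewalPoint i hA
  have : renewalConfigGE c ⁻¹' {ξ | (ξ.1 ∩ A).ncard = n} =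
      ({p | GapsGE c p} ∩ {p | {i | p ∈ {p | renewalPoint p i ∈ A}}.ncard = n}) ∪
        ({p | GapsGE c p}ᶜ ∩ {_p | 0 = n}) := by
    ext p
    by_cases hp : GapsGE c p
    · have h1 : Set.range (renewalPoint p) ∩ A = renewalPoint p '' {i | renewalPoint p i ∈ A} := by
        ext z
        constructor
        · rintro ⟨⟨i, rfl⟩, hi⟩
          exact ⟨i, hi, rfl⟩
        · rintro ⟨i, hi, rfl⟩
          exact ⟨⟨i, rfl⟩, hi⟩
      simp only [Set.mem_preimage, Set.mem_ofPred_eq, hp.renewalConfigGE_eq,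
        hp.coe_renewalConfig hc, h1, Set.ncard_image_of_injective _ (hp.strictMono hc).injective]
      simp [hp]
    · have h1 : renewalConfigGE c p = emptyConfig := if_neg hp
      have h2 : (emptyConfig.1 ∩ A).ncard = 0 := by
        rw [show emptyConfig.1 = ∅ from rfl, Set.empty_inter, Set.ncard_empty]
      simp only [Set.mem_preimage, Set.mem_ofPred_eq, h1, h2]
      simp [hp]
  rw [this]
  exact ((measurableSet_gapsGE c).inter (hcount (measurableSet_singleton n))).union
    ((measurableSet_gapsGE c).compl.inter (MeasurableSet.const _))

open Classical in
/-- Point number `k` of a configuration that has a first point. -/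
def pointAt (k : ℕ) (ξ : Config) : EReal :=
  ⨅ a : ℚ, if ∃ n : ℕ, k < (ξ.1 ∩ Set.Icc (-(n : ℝ)) a).ncard then ((a : ℝ) : EReal) else ⊤

/-- The first point and the gaps of a configuration. -/
def decode (ξ : Config) : ℝ × (ℕ → ℝ) :=
  ((pointAt 0 ξ).toReal, fun k => (pointAt (k + 1) ξ).toReal - (pointAt k ξ).toReal)

theorem measurable_pointAt (k : ℕ) : Measurable (pointAt k) := by
  refine Measurable.iInf fun a => Measurable.ite ?_ measurable_const measurable_const
  simp only [Set.ofPred_exists]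
  exact .iUnion fun n => measurableSet_lt measurable_const
    (measurable_ncard_inter measurableSet_Icc (Metric.isBounded_Icc _ _))

theorem measurable_decode : Measurable decode := by
  have h : ∀ k, Measurable fun ξ => (pointAt k ξ).toReal := fun k =>
    (measurable_pointAt k).ereal_toReal
  exact (h 0).prodMk (measurable_pi_lambda _ fun k => (h (k + 1)).sub (h k))

/-- Once `-n` lies below the first point, `[-n, a]` holds more than `k` points exactly when point
`k` is at most `a`; density of the rationals does the rest. -/
theorem GapsGE.pointAt_eq {p : ℝ × (ℕ → ℝ)} (hp : GapsGE c p) (hc : 0 < c) (k : ℕ) :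
    pointAt k (renewalConfig p) = (renewalPoint p k : ℝ) := by
  have hm := hp.strictMono hc
  have hiff : ∀ a : ℝ, (∃ n : ℕ, k < ((renewalConfig p).1 ∩ Set.Icc (-(n : ℝ)) a).ncard) ↔
      renewalPoint p k ≤ a := by
    intro a
    constructor
    · rintro ⟨n, hn⟩
      by_contra! hlt
      have hsub : (renewalConfig p).1 ∩ Set.Icc (-(n : ℝ)) a ⊆
          renewalPoint p '' (Finset.range k : Finset ℕ) := by
        rw [hp.coe_renewalConfig hc]
        rintro _ ⟨⟨i, rfl⟩, hi⟩
        exact ⟨i, by simpa using hm.lt_iff_lt.1 (hi.2.trans_lt hlt), rfl⟩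
      have := Set.ncard_le_ncard hsub ((Finset.finite_toSet _).image _)
      rw [Set.ncard_image_of_injective _ hm.injective, Set.ncard_coe_finset,
        Finset.card_range] at this
      omega
    · intro ha
      obtain ⟨n, hn⟩ := exists_nat_ge (-p.1)
      refine ⟨n, ?_⟩
      have hsub : renewalPoint p '' (Finset.range (k + 1) : Finset ℕ) ⊆
          (renewalConfig p).1 ∩ Set.Icc (-(n : ℝ)) a := by
        rw [hp.coe_renewalConfig hc]
        rintro _ ⟨i, hi, rfl⟩
        have hi' : i ≤ k := by simpa [Nat.lt_succ_iff] using hi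
        have h0 := hm.monotone (Nat.zero_le i)
        simp only [renewalPoint, Finset.range_zero, Finset.sum_empty, add_zero] at h0
        exact ⟨⟨i, rfl⟩, by simp only [renewalPoint]; linarith, (hm.monotone hi').trans ha⟩
      have := Set.ncard_le_ncard hsub ((renewalConfig p).2 _ _)
      rw [Set.ncard_image_of_injective _ hm.injective, Set.ncard_coe_finset,
        Finset.card_range] at this
      omega
  rw [pointAt]
  simp only [hiff]
  refine le_antisymm ?_ (le_iInf fun a => ?_)
  · refine le_of_forall_gt_imp_ge_of_dense fun z hz => ?_
    obtain ⟨a, ha, ha'⟩ := EReal.lt_iff_exists_rat_btwn.1 hz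
    refine (iInf_le _ a).trans ?_
    rw [if_pos (by exact_mod_cast ha.le)]
    exact ha'.le
  · split_ifs with h
    · exact_mod_cast h
    · exact le_top

theorem GapsGE.decode_eq {p : ℝ × (ℕ → ℝ)} (hp : GapsGE c p) (hc : 0 < c) :
    decode (renewalConfig p) = p := by
  refine Prod.ext ?_ (funext fun k => ?_)
  · simp [decode, hp.pointAt_eq hc, renewalPoint]
  · simp only [decode, hp.pointAt_eq hc, EReal.toReal_coe]
    rw [renewalPoint_succ, add_sub_cancel_left]

/-- Local finiteness isolates a point of one configuration that is missing in the other inside a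
rational interval. Equality of configurations thus becomes a countable condition, hence measurable.
-/
theorem Config.ext_of_ncard {ξ η : Config}
    (h : ∀ a b : ℚ, (ξ.1 ∩ Set.Icc (a : ℝ) b).ncard = (η.1 ∩ Set.Icc (a : ℝ) b).ncard) :
    ξ = η := by
  have key : ∀ {ξ η : Config},
      (∀ a b : ℚ, (ξ.1 ∩ Set.Icc (a : ℝ) b).ncard = (η.1 ∩ Set.Icc (a : ℝ) b).ncard) →
        ξ.1 ⊆ η.1 := by
    intro ξ η h z hz
    by_contra hz'
    have hfin : (η.1 ∩ Set.Icc (z - 1) (z + 1)).Finite := η.2 _ _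
    have hopen : (η.1 ∩ Set.Icc (z - 1) (z + 1))ᶜ ∈ nhds z :=
      hfin.isClosed.isOpen_compl.mem_nhds fun h' => hz' h'.1
    obtain ⟨ε, hε, hball⟩ := Metric.mem_nhds_iff.1 hopen
    obtain ⟨a, ha, ha'⟩ := exists_rat_btwn (show z - min ε 1 < z by
      have := lt_min hε one_pos; linarith)
    obtain ⟨b, hb, hb'⟩ := exists_rat_btwn (show z < z + min ε 1 by
      have := lt_min hε one_pos; linarith)
    have hε1 := min_le_left ε 1
    have hε2 := min_le_right ε 1
    have hempty : η.1 ∩ Set.Icc (a : ℝ) b = ∅ := by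
      refine Set.eq_empty_of_forall_notMem fun w hw => ?_
      have hw1 := hw.2.1
      have hw2 := hw.2.2
      refine (@hball w ?_) ⟨hw.1, by linarith, by linarith⟩
      rw [Metric.mem_ball, Real.dist_eq, abs_lt]
      constructor <;> linarith
    have h0 := h a b
    rw [hempty, Set.ncard_empty, Set.ncard_eq_zero (ξ.2 _ _)] at h0
    have : z ∈ ξ.1 ∩ Set.Icc (a : ℝ) b := ⟨hz, ha'.le, hb.le⟩
    rw [h0] at this
    exact this
  exact Subtype.ext (Set.Subset.antisymm (key h) (key fun a b => (h a b).symm))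

theorem measurableSet_eq_config {f : Config → Config} (hf : Measurable f) :
    MeasurableSet {ξ | f ξ = ξ} := by
  have : {ξ | f ξ = ξ} = ⋂ a : ℚ, ⋂ b : ℚ,
      {ξ | ((f ξ).1 ∩ Set.Icc (a : ℝ) b).ncard = (ξ.1 ∩ Set.Icc (a : ℝ) b).ncard} := by
    ext ξ
    simp only [Set.mem_iInter, Set.mem_ofPred_eq]
    exact ⟨fun h a b => by rw [h], Config.ext_of_ncard⟩
  rw [this]
  refine .iInter fun a => .iInter fun b => ?_
  have h1 := measurable_ncard_inter (A := Set.Icc (a : ℝ) b) measurableSet_Icc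
    (Metric.isBounded_Icc _ _)
  exact measurableSet_eq_fun (h1.comp hf) h1

end Decode

/-! ### Renewal processes -/

section RenewalLaw

variable {c : ℝ} (ν μ : Measure ℝ) [IsProbabilityMeasure ν] [IsProbabilityMeasure μ]

theorem ae_gapsGE {μ : Measure ℝ} [IsProbabilityMeasure μ] (hμ : μ (Set.Iio c) = 0) :
    ∀ᵐ p ∂ν.prod (iid μ), GapsGE c p := by
  refine ae_all_iff.2 fun i => ?_
  have h1 : ∀ᵐ x ∂μ, c ≤ x := by
    rw [ae_iff]
    simp only [not_le]
    exact hμ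
  exact ((measurePreserving_eval_infinitePi (fun _ : ℕ => μ) i).comp
    measurePreserving_snd).quasiMeasurePreserving.ae h1

variable (hc : 0 < c) (hμ : μ (Set.Iio c) = 0)

include hc hμ

theorem aemeasurable_renewalConfig : AEMeasurable renewalConfig (ν.prod (iid μ)) :=
  ⟨renewalConfigGE c, measurable_renewalConfigGE hc, by
    filter_upwards [ae_gapsGE ν hμ] with p hp
    exact hp.renewalConfigGE_eq.symm⟩

omit hc in
theorem map_renewalConfigGE :
    (ν.prod (iid μ)).map (renewalConfigGE c) = (ν.prod (iid μ)).map renewalConfig := by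
  refine Measure.map_congr ?_
  filter_upwards [ae_gapsGE ν hμ] with p hp
  exact hp.renewalConfigGE_eq

theorem measurePreserving_decode :
    MeasurePreserving decode ((ν.prod (iid μ)).map renewalConfig) (ν.prod (iid μ)) := by
  refine ⟨measurable_decode, ?_⟩
  rw [← map_renewalConfigGE ν μ hμ, Measure.map_map measurable_decode
    (measurable_renewalConfigGE hc)]
  conv_rhs => rw [← Measure.map_id (μ := ν.prod (iid μ))]
  refine Measure.map_congr ?_
  filter_upwards [ae_gapsGE ν hμ] with p hp
  rw [Function.comp_apply, hp.renewalConfigGE_eq, hp.decode_eq hc, id]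

/-- Together with `measurePreserving_decode`, this replaces a random configuration by its first
point and gaps, at the cost of a null set. -/
theorem ae_renewalConfig_decode :
    ∀ᵐ ξ ∂(ν.prod (iid μ)).map renewalConfig,
      GapsGE c (decode ξ) ∧ renewalConfig (decode ξ) = ξ := by
  have h1 : ∀ᵐ ξ ∂(ν.prod (iid μ)).map renewalConfig, renewalConfigGE c (decode ξ) = ξ := by
    have hms : MeasurableSet {ξ | renewalConfigGE c (decode ξ) = ξ} :=
      measurableSet_eq_config ((measurable_renewalConfigGE hc).comp measurable_decode)
    rw [← map_renewalConfigGE ν μ hμ,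
      ae_map_iff (measurable_renewalConfigGE hc).aemeasurable hms]
    filter_upwards [ae_gapsGE ν hμ] with p hp
    rw [hp.renewalConfigGE_eq, hp.decode_eq hc, hp.renewalConfigGE_eq]
  filter_upwards [h1, (measurePreserving_decode ν μ hc hμ).quasiMeasurePreserving.ae
    (ae_gapsGE ν hμ)] with ξ h2 h3
  exact ⟨h3, by rwa [h3.renewalConfigGE_eq] at h2⟩

end RenewalLaw

/-! ### The law of the sequence of domains -/

section Encode

instance : IsProbabilityMeasure (expMeasure 1) := isProbabilityMeasure_expMeasure one_pos

/-- The law of the mark of a domain. -/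
abbrev markLaw : Measure (ℝ × unitInterval) := (expMeasure 1).prod (volume : Measure unitInterval)

theorem marksLaw_eq : marksLaw = Measure.infinitePi fun _ : ℤ => markLaw := rfl

instance : IsProbabilityMeasure marksLaw := by
  rw [marksLaw_eq]
  infer_instance

variable (ν μ : Measure ℝ) [IsProbabilityMeasure ν] [IsProbabilityMeasure μ]

theorem measurePreserving_encode :
    MeasurePreserving encode ((ν.prod (iid μ)).prod marksLaw)
      (ν.prod (iid (μ.prod markLaw))) := by
  have hm : Measurable (Function.uncurry fun (p : ℝ × (ℕ → ℝ)) (ω : Marks) (k : ℕ) =>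
      ω (firstLabel p + k)) := by
    refine measurable_pi_lambda _ fun k => ?_
    have h1 : Measurable fun q : ℤ × Marks => q.2 (q.1 + k) :=
      measurable_from_prod_countable_right fun n => measurable_pi_apply (n + k : ℤ)
    exact h1.comp ((measurable_firstLabel.comp measurable_fst).prodMk measurable_snd)
  -- The labels depend on the configuration, but for each fixed one the marks are read along an
  -- injection of indices. So they are i.i.d. and independent of the configuration.
  have h1 := (MeasurePreserving.id (ν.prod (iid μ))).skew_product (μc := marksLaw)
    (μd := iid markLaw) hm (ae_of_all _ fun p => by
      refine (measurePreserving_reindex markLaw (e := fun k : ℕ => firstLabel p + k) ?_).map_eq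
      intro k l hkl
      simpa using hkl)
  have h2 := measurePreserving_prodAssoc ν (iid μ) (iid markLaw)
  have h3 := (MeasurePreserving.id ν).prod (measurePreserving_zip μ markLaw)
  exact h3.comp (h2.comp h1)

end Encode

/-! ### The rules under the law of a domain -/

section RulesLaw

theorem expMeasure_singleton (x : ℝ) : expMeasure 1 {x} = 0 :=
  withDensity_absolutelyContinuous _ _ Real.volume_singleton

theorem ae_expMeasure_pos : ∀ᵐ x ∂expMeasure 1, 0 < x := by
  have h1 : expMeasure 1 (Set.Iic 0) = 0 := by
    rw [← measureReal_eq_zero_iff, ← cdf_eq_real, cdf_expMeasure_eq one_pos]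
    simp
  rw [ae_iff]
  simp only [not_lt]
  exact h1

theorem volume_unitInterval_le {c : ℝ} (h0 : 0 ≤ c) (h1 : c ≤ 1) :
    (volume : Measure unitInterval) {u | (u : ℝ) ≤ c} = ENNReal.ofReal c :=
  unitInterval.volume_Iic ⟨c, h0, h1⟩

variable {rateL rateR : ℝ → ℝ} (hL : Measurable rateL) (hR : Measurable rateR)

include hL hR in
theorem measurable_ringTime : Measurable (ringTime rateL rateR) := by
  unfold ringTime
  exact Measurable.ite (measurableSet_lt measurable_const (by fun_prop)) (by fun_prop)
    (by fun_prop)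

variable (μ : Measure ℝ) [IsProbabilityMeasure μ]

include hL hR in
theorem measurableSet_rings_coin :
    MeasurableSet {a : Letter | 0 < rateL a.1 + rateR a.1} ∧
      MeasurableSet {a : Letter | (a.2.2 : ℝ) ≤ rateR a.1 / (rateL a.1 + rateR a.1)} :=
  ⟨measurableSet_lt measurable_const (by fun_prop), measurableSet_le (by fun_prop) (by fun_prop)⟩

omit [IsProbabilityMeasure μ] in
include hL hR in
theorem regular_rules (t : ℝ≥0∞) : (rules rateL rateR t).Regular (μ.prod markLaw) where
  measurable_time := measurable_ringTime hL hR
  measurableSet_left :=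
    ((measurableSet_rings_coin hL hR).1.inter (measurableSet_rings_coin hL hR).2).inter
      (measurableSet_le (measurable_ringTime hL hR).ennreal_ofReal measurable_const)
  measurableSet_right :=
    ((measurableSet_rings_coin hL hR).1.inter (measurableSet_rings_coin hL hR).2.compl).inter
      (measurableSet_le (measurable_ringTime hL hR).ennreal_ofReal measurable_const)
  null_time x := by
    have hms : MeasurableSet {a | ringTime rateL rateR a = x} :=
      measurableSet_eq_fun (measurable_ringTime hL hR) measurable_const
    refine (Measure.measure_prod_null hms).2 (ae_of_all _ fun d => ?_)
    -- For a given length, a prescribed ring time fixes the clock to a single value, and the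
    -- exponential law has no atoms.
    refine measure_mono_null (t := {if 0 < rateL d + rateR d then x * (rateL d + rateR d) else x} ×ˢ
      Set.univ) (fun b hb => ⟨?_, trivial⟩) (by rw [Measure.prod_prod, expMeasure_singleton, zero_mul])
    have hb' : ringTime rateL rateR (d, b) = x := hb
    rw [ringTime] at hb'
    rw [Set.mem_singleton_iff]
    split_ifs with hd
    · rw [if_pos hd] at hb'
      rw [← hb', div_mul_cancel₀ _ hd.ne']
    · rwa [if_neg hd] at hb'

include hL hR in
theorem ae_typical : ∀ᵐ y ∂iid (μ.prod markLaw), Typical rateL rateR y := by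
  have h1 := regular_rules hL hR μ ⊤
  have h2 : ∀ᵐ a ∂μ.prod markLaw, 0 < a.2.1 :=
    (measurePreserving_fst.comp (measurePreserving_snd (μ := μ)
      (ν := markLaw))).quasiMeasurePreserving.ae ae_expMeasure_pos
  have h3 : ∀ᵐ y ∂iid (μ.prod markLaw), ∀ i, 0 < (y i).2.1 := ae_all_iff.2 fun i =>
    (measurePreserving_eval_infinitePi (fun _ : ℕ => μ.prod markLaw) i).quasiMeasurePreserving.ae h2
  filter_upwards [ae_good _ h1.measurable_time h1.null_time, h3] with y hy hy'
  exact ⟨hy, hy'⟩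

variable {μ} {dmin dmax : ℝ} (hμ : μ (Set.Iio dmin) = 0)

omit [IsProbabilityMeasure μ] in
include hμ in
theorem ae_le_gap : ∀ᵐ a ∂μ.prod markLaw, dmin ≤ a.1 := by
  have h1 : ∀ᵐ x ∂μ, dmin ≤ x := by
    rw [ae_iff]
    simp only [not_le]
    exact hμ
  exact measurePreserving_fst.quasiMeasurePreserving.ae h1

omit [IsProbabilityMeasure μ] in
include hμ in
theorem ae_nonneg_gap (hdmin : 0 < dmin) : ∀ᵐ a ∂μ.prod markLaw, 0 ≤ a.1 := by
  filter_upwards [ae_le_gap hμ] with a ha using hdmin.le.trans ha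

variable (hA1 : ∀ d, dmin ≤ d → (0 < rateL d + rateR d ↔ d < dmax))

include hL hR hμ hA1 in
-- Without a time limit every domain of length in `[dmin, dmax)` erases exactly one of its extremes,
-- and no other domain acts.
theorem integral_left_add_right (hdmin : 0 < dmin) (s : ℂ) (hs : 0 ≤ s.re) :
    ∫ a in (rules rateL rateR ⊤).right, Complex.exp (-s * (a.1 : ℂ)) ∂μ.prod markLaw +
      ∫ a in (rules rateL rateR ⊤).left, Complex.exp (-s * (a.1 : ℂ)) ∂μ.prod markLaw =
    ∫ x in Set.Ico dmin dmax, Complex.exp (-s * (x : ℂ)) ∂μ := by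
  have hreg := regular_rules hL hR μ ⊤
  have hint : Integrable (fun a : Letter => Complex.exp (-s * (a.1 : ℂ))) (μ.prod markLaw) := by
    refine Integrable.of_bound (C := 1) (by fun_prop) ?_
    filter_upwards [ae_nonneg_gap hμ hdmin] with a ha
    have := Rules.norm_boundedExp_le (g := fun x : ℝ => x) s hs a.1
    rwa [if_pos ha] at this
  rw [← setIntegral_union _ hreg.measurableSet_left hint.integrableOn hint.integrableOn]
  · have hset : ((rules rateL rateR ⊤).right ∪ (rules rateL rateR ⊤).left : Set Letter)
        =ᵐ[μ.prod markLaw] Set.Ico dmin dmax ×ˢ Set.univ := by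
      filter_upwards [ae_le_gap hμ] with a ha
      refine propext ?_
      change ((0 < _ ∧ ¬ _) ∧ _ ≤ ⊤ ∨ (0 < _ ∧ _) ∧ _ ≤ ⊤) ↔ ((dmin ≤ a.1 ∧ a.1 < dmax) ∧ True)
      rw [← hA1 a.1 ha]
      simp only [le_top, and_true]
      tauto
    rw [setIntegral_congr_set hset]
    have := setIntegral_prod_mul (μ := μ) (ν := markLaw)
      (fun x : ℝ => Complex.exp (-s * (x : ℂ))) (fun _ => (1 : ℂ)) (Set.Ico dmin dmax) Set.univ
    simpa using this
  · exact Set.disjoint_left.2 fun a ha ha' => (rules rateL rateR ⊤).disj a ha' ha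

variable {γ : ℝ} (hγ : 0 ≤ γ) (hrate : ∀ d, dmin ≤ d → rateL d = γ * rateR d)

omit [IsProbabilityMeasure μ] in
include hμ hA1 hγ hrate in
-- With proportional rates the coin threshold is the constant `1 / (1 + γ)`, so the set is a product
-- and its integrals factor.
theorem left_ae_eq :
    (rules rateL rateR ⊤).left =ᵐ[μ.prod markLaw]
      Set.Ico dmin dmax ×ˢ (Set.univ ×ˢ {u : unitInterval | (u : ℝ) ≤ 1 / (1 + γ)}) := by
  filter_upwards [ae_le_gap hμ] with a ha
  refine propext ?_
  change ((0 < rateL a.1 + rateR a.1 ∧ (a.2.2 : ℝ) ≤ rateR a.1 / (rateL a.1 + rateR a.1)) ∧ _ ≤ ⊤) ↔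
    ((dmin ≤ a.1 ∧ a.1 < dmax) ∧ True ∧ (a.2.2 : ℝ) ≤ 1 / (1 + γ))
  rw [← hA1 a.1 ha]
  by_cases h : 0 < rateL a.1 + rateR a.1
  · have h1 : rateL a.1 + rateR a.1 = rateR a.1 * (1 + γ) := by rw [hrate a.1 ha]; ring
    have h2 : rateR a.1 ≠ 0 := by
      intro h0
      rw [h1, h0, zero_mul] at h
      exact lt_irrefl _ h
    have h3 : rateR a.1 / (rateL a.1 + rateR a.1) = 1 / (1 + γ) := by
      rw [h1]
      field_simp
    rw [h3]
    simp [h, ha]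
  · simp [h]

theorem measureReal_coin (hγ : 0 ≤ γ) :
    (volume : Measure unitInterval).real {u | (u : ℝ) ≤ 1 / (1 + γ)} = 1 / (1 + γ) := by
  have h0 : 0 ≤ 1 / (1 + γ) := by positivity
  rw [Measure.real, volume_unitInterval_le h0, ENNReal.toReal_ofReal h0]
  rw [div_le_one (by positivity)]
  linarith

include hμ hA1 hγ hrate in
theorem integral_left (s : ℂ) :
    ∫ a in (rules rateL rateR ⊤).left, Complex.exp (-s * (a.1 : ℂ)) ∂μ.prod markLaw =
      (∫ x in Set.Ico dmin dmax, Complex.exp (-s * (x : ℂ)) ∂μ) / (1 + (γ : ℂ)) := by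
  rw [setIntegral_congr_set (left_ae_eq hμ hA1 hγ hrate)]
  have := setIntegral_prod_mul (μ := μ) (ν := markLaw)
    (fun x : ℝ => Complex.exp (-s * (x : ℂ))) (fun _ => (1 : ℂ)) (Set.Ico dmin dmax)
    (Set.univ ×ˢ {u : unitInterval | (u : ℝ) ≤ 1 / (1 + γ)})
  simp only [mul_one] at this
  rw [this, setIntegral_const, Measure.real, Measure.prod_prod, measure_univ, one_mul,
    ← Measure.real, measureReal_coin hγ, Complex.real_smul, mul_one]
  push_cast
  ring

omit [IsProbabilityMeasure μ] in
include hμ hA1 hγ hrate in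
theorem measureReal_left :
    (μ.prod markLaw).real (rules rateL rateR ⊤).left = μ.real (Set.Ico dmin dmax) / (1 + γ) := by
  rw [measureReal_congr (left_ae_eq hμ hA1 hγ hrate), Measure.real, Measure.prod_prod,
    Measure.prod_prod, measure_univ, one_mul, ENNReal.toReal_mul, ← Measure.real, ← Measure.real,
    measureReal_coin hγ, mul_one_div]

include hμ in
theorem measure_left_eq_zero (hrateR : ∀ d, dmin ≤ d → rateR d = 0) (t : ℝ≥0∞) :
    (μ.prod markLaw) (rules rateL rateR t).left = 0 := by
  have h1 : ∀ᵐ a ∂μ.prod markLaw, ¬ (a.2.2 : ℝ) ≤ 0 := by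
    have h2 : ∀ᵐ u : unitInterval, ¬ (u : ℝ) ≤ 0 := by
      rw [ae_iff]
      simp only [not_not]
      exact (volume_unitInterval_le le_rfl zero_le_one).trans ENNReal.ofReal_zero
    exact (measurePreserving_snd.comp (measurePreserving_snd (μ := μ)
      (ν := markLaw))).quasiMeasurePreserving.ae h2
  have h3 : ∀ᵐ a ∂μ.prod markLaw, a ∉ (rules rateL rateR t).left := by
    filter_upwards [h1, ae_le_gap hμ] with a ha ha' hmem
    have := hmem.1.2
    rw [hrateR a.1 ha', zero_div] at this
    exact ha this
  rw [ae_iff] at h3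
  simp only [not_not] at h3
  exact h3

end RulesLaw

/-! ### The law of the process -/

section ProcessLaw

variable {rateL rateR : ℝ → ℝ} (hL : Measurable rateL) (hR : Measurable rateR) {dmin : ℝ}
  (hdmin : 0 < dmin) (ν μ : Measure ℝ) [IsProbabilityMeasure ν] [IsProbabilityMeasure μ]
  (hμ : μ (Set.Iio dmin) = 0)

/-- The law of the first point at time `t`. -/
def firstLaw (rateL rateR : ℝ → ℝ) (ν μ : Measure ℝ) [IsProbabilityMeasure μ] (t : ℝ≥0∞) :
    Measure ℝ :=
  (ν.prod ((rules rateL rateR t).firstDispLaw Prod.fst (μ.prod markLaw))).map fun q => q.1 + q.2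

/-- The law of the gaps at time `t`. -/
def gapLaw (rateL rateR : ℝ → ℝ) (μ : Measure ℝ) [IsProbabilityMeasure μ] (t : ℝ≥0∞) :
    Measure ℝ :=
  (rules rateL rateR t).nextGapLaw Prod.fst (μ.prod markLaw)

include hL hR

theorem isProbabilityMeasure_firstLaw (t : ℝ≥0∞) :
    IsProbabilityMeasure (firstLaw rateL rateR ν μ t) := by
  have := (regular_rules hL hR μ t).isProbabilityMeasure_firstDispLaw (g := Prod.fst)
    measurable_fst
  exact Measure.isProbabilityMeasure_map (by fun_prop)

theorem isProbabilityMeasure_gapLaw (t : ℝ≥0∞) :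
    IsProbabilityMeasure (gapLaw rateL rateR μ t) :=
  (regular_rules hL hR μ t).isProbabilityMeasure_nextGapLaw measurable_fst

include hdmin hμ

theorem gapLaw_Iio (t : ℝ≥0∞) : gapLaw rateL rateR μ t (Set.Iio dmin) = 0 := by
  refine (regular_rules hL hR μ t).ae_nextGapLaw measurable_fst measurableSet_Iio fun k hk => ?_
  have h1 : ∀ᵐ y ∂iid (μ.prod markLaw), ∀ i : ℕ, dmin ≤ (y i).1 := ae_all_iff.2 fun i =>
    (measurePreserving_eval_infinitePi (fun _ : ℕ => μ.prod markLaw) i).quasiMeasurePreserving.ae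
      (ae_le_gap hμ)
  filter_upwards [h1] with y hy
  rw [Set.mem_Iio, not_lt]
  refine (hy 0).trans (Finset.single_le_sum (f := fun i => (y i).1) (fun i _ => ?_)
    (Finset.mem_range.2 hk))
  exact hdmin.le.trans (hy i)

omit hL hR in
theorem measurePreserving_encode_decode :
    MeasurePreserving (fun q : Config × Marks => encode (decode q.1, q.2))
      (((ν.prod (iid μ)).map renewalConfig).prod marksLaw) (ν.prod (iid (μ.prod markLaw))) := by
  have h1 : IsProbabilityMeasure ((ν.prod (iid μ)).map renewalConfig) :=
    Measure.isProbabilityMeasure_map (aemeasurable_renewalConfig ν μ hdmin hμ)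
  exact (measurePreserving_encode ν μ).comp
    ((measurePreserving_decode ν μ hdmin hμ).prod (MeasurePreserving.id marksLaw))

theorem ae_decode_typical :
    ∀ᵐ q ∂((ν.prod (iid μ)).map renewalConfig).prod marksLaw,
      GapsGE dmin (decode q.1) ∧ renewalConfig (decode q.1) = q.1 ∧
        Typical rateL rateR (encode (decode q.1, q.2)).2 := by
  have h1 : IsProbabilityMeasure ((ν.prod (iid μ)).map renewalConfig) :=
    Measure.isProbabilityMeasure_map (aemeasurable_renewalConfig ν μ hdmin hμ)
  filter_upwards [measurePreserving_fst.quasiMeasurePreserving.ae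
      (ae_renewalConfig_decode ν μ hdmin hμ),
    (measurePreserving_encode_decode hdmin ν μ hμ).quasiMeasurePreserving.ae
      (measurePreserving_snd.quasiMeasurePreserving.ae (ae_typical hL hR μ))] with q h2 h3
  exact ⟨h2.1, h2.2, h3⟩

theorem map_state [∀ t, IsProbabilityMeasure (gapLaw rateL rateR μ t)] (t : ℝ≥0∞) :
    (((ν.prod (iid μ)).map renewalConfig).prod marksLaw).map
        (fun q => state rateL rateR q.1 q.2 t) =
      ((firstLaw rateL rateR ν μ t).prod (iid (gapLaw rateL rateR μ t))).map renewalConfig := by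
  have hreg := regular_rules hL hR μ t
  have hfirst := isProbabilityMeasure_firstLaw hL hR ν μ t
  have hprob : IsProbabilityMeasure
      ((rules rateL rateR t).nextGapLaw Prod.fst (μ.prod markLaw)) :=
    isProbabilityMeasure_gapLaw hL hR μ t
  have hmp : MeasurePreserving (fun q : Config × Marks =>
      (rules rateL rateR t).survivors Prod.fst (encode (decode q.1, q.2)))
      (((ν.prod (iid μ)).map renewalConfig).prod marksLaw)
      ((firstLaw rateL rateR ν μ t).prod (iid (gapLaw rateL rateR μ t))) :=
    (hreg.measurePreserving_survivors (g := Prod.fst) measurable_fst ν).comp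
      (measurePreserving_encode_decode hdmin ν μ hμ)
  have hrc := aemeasurable_renewalConfig (firstLaw rateL rateR ν μ t) (gapLaw rateL rateR μ t)
    hdmin (gapLaw_Iio hL hR hdmin μ hμ t)
  -- `renewalConfig` is only almost everywhere measurable, so its measurability is transported to
  -- the pushforward before the maps are composed.
  rw [← hmp.map_eq] at hrc
  rw [← hmp.map_eq, AEMeasurable.map_map_of_aemeasurable hrc hmp.measurable.aemeasurable]
  refine Measure.map_congr ?_
  filter_upwards [ae_decode_typical hL hR hdmin ν μ hμ] with q hq
  have := hq.1.state_eq hdmin hq.2.2 t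
  rw [hq.2.1] at this
  exact this

theorem map_state_zero :
    (((ν.prod (iid μ)).map renewalConfig).prod marksLaw).map
        (fun q => state rateL rateR q.1 q.2 0) = (ν.prod (iid μ)).map renewalConfig := by
  have h1 : IsProbabilityMeasure ((ν.prod (iid μ)).map renewalConfig) :=
    Measure.isProbabilityMeasure_map (aemeasurable_renewalConfig ν μ hdmin hμ)
  conv_rhs => rw [← (measurePreserving_fst (μ := (ν.prod (iid μ)).map renewalConfig)
    (ν := marksLaw)).map_eq]
  refine Measure.map_congr ?_
  filter_upwards [ae_decode_typical hL hR hdmin ν μ hμ] with q ⟨h2, h3, h4⟩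
  have h5 := h2.coe_state hdmin h4 0
  rw [h3] at h5
  refine Subtype.ext (h5.trans ?_)
  have h6 : ∀ i, (rules rateL rateR 0).Surv (encode (decode q.1, q.2)).2 i := by
    intro i
    have h7 : ∀ j, ¬ ENNReal.ofReal (ringTime rateL rateR
        ((encode (decode q.1, q.2)).2 j)) ≤ 0 := fun j => by
      simpa using h4.ringTime_pos j
    rw [surv_rules]
    exact ⟨fun h => h7 _ h.2, fun h => h7 _ h.2⟩
  have h8 : {i | (rules rateL rateR 0).Surv (encode (decode q.1, q.2)).2 i} = Set.univ :=
    Set.eq_univ_of_forall h6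
  rw [h8, Set.image_univ, ← h2.coe_renewalConfig hdmin, h3]

/-- Point 0 has no domain on its left, so its survival is exactly the event `survSet`. -/
theorem measure_first_survives :
    (((ν.prod (iid μ)).map renewalConfig).prod marksLaw)
        {q | ∃ x, IsLeast q.1.1 x ∧ x ∈ (state rateL rateR q.1 q.2 ⊤).1} =
      ENNReal.ofReal (Real.exp (-(μ.prod markLaw).real (rules rateL rateR ⊤).left)) := by
  have hreg := regular_rules hL hR μ ⊤
  have hmp := measurePreserving_encode_decode hdmin ν μ hμ
  have hset : {q : Config × Marks | ∃ x, IsLeast q.1.1 x ∧ x ∈ (state rateL rateR q.1 q.2 ⊤).1}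
      =ᵐ[((ν.prod (iid μ)).map renewalConfig).prod marksLaw]
        (fun q : Config × Marks => encode (decode q.1, q.2)) ⁻¹'
          (Set.univ ×ˢ (rules rateL rateR ⊤).survSet) := by
    filter_upwards [ae_decode_typical hL hR hdmin ν μ hμ] with q ⟨h2, h3, h4⟩
    have hm := h2.strictMono hdmin
    have h5 := h2.coe_state hdmin h4 ⊤
    have h6 := h2.coe_renewalConfig hdmin
    rw [h3] at h5 h6
    have hleast : IsLeast q.1.1 (renewalPoint (decode q.1) 0) := by
      rw [h6]
      exact ⟨⟨0, rfl⟩, by rintro _ ⟨i, rfl⟩; exact hm.monotone (Nat.zero_le i)⟩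
    refine propext ?_
    change (∃ x, IsLeast q.1.1 x ∧ x ∈ (state rateL rateR q.1 q.2 ⊤).1) ↔
      True ∧ ¬ (rules rateL rateR ⊤).RightErasedLim (encode (decode q.1, q.2)).2 0
    rw [h5, true_and]
    constructor
    · rintro ⟨x, hx, i, hi, rfl⟩
      obtain rfl := hm.injective (hx.unique hleast)
      exact hi.2
    · exact fun h => ⟨_, hleast, 0, ⟨id, h⟩, rfl⟩
  rw [measure_congr hset, hmp.measure_preimage
    (MeasurableSet.univ.prod hreg.measurableSet_survSet).nullMeasurableSet, Measure.prod_prod,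
    measure_univ, one_mul, ← hreg.measureReal_survSet, ofReal_measureReal]

theorem ae_firstDispLaw_nonneg (t : ℝ≥0∞) :
    ∀ᵐ x ∂(rules rateL rateR t).firstDispLaw Prod.fst (μ.prod markLaw), 0 ≤ x := by
  have hreg := regular_rules hL hR μ t
  rw [Rules.firstDispLaw, ae_map_iff (hreg.measurable_stepFirst measurable_fst).fst.aemeasurable
    measurableSet_Ici]
  have h1 : ∀ᵐ y ∂iid (μ.prod markLaw), ∀ i : ℕ, dmin ≤ (y i).1 := ae_all_iff.2 fun i =>
    (measurePreserving_eval_infinitePi (fun _ : ℕ => μ.prod markLaw) i).quasiMeasurePreserving.ae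
      (ae_le_gap hμ)
  filter_upwards [h1] with y hy
  change 0 ≤ ∑ i ∈ Finset.range _, (y i).1
  exact Finset.sum_nonneg fun i _ => hdmin.le.trans (hy i)

omit hL hR hdmin in
-- The coin threshold is 0, so almost surely no domain erases its left extreme. The first survivor
-- is point 0 and the displacement is a Dirac mass at 0.
theorem firstLaw_eq_of_rateR (hrateR : ∀ d, dmin ≤ d → rateR d = 0) (t : ℝ≥0∞) :
    firstLaw rateL rateR ν μ t = ν := by
  have h1 : ∀ᵐ a ∂μ.prod markLaw, a ∉ (rules rateL rateR t).left := by
    rw [ae_iff]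
    simp only [not_not]
    exact measure_left_eq_zero hμ hrateR t
  have h2 : (rules rateL rateR t).firstDispLaw Prod.fst (μ.prod markLaw) = Measure.dirac 0 := by
    have h3 : (fun y => ((rules rateL rateR t).stepFirst Prod.fst y).1)
        =ᵐ[iid (μ.prod markLaw)] fun _ => (0 : ℝ) := by
      filter_upwards [(measurePreserving_eval_infinitePi (fun _ : ℕ => μ.prod markLaw)
        0).quasiMeasurePreserving.ae h1] with y hy
      have h4 : (rules rateL rateR t).firstIdx y = 0 := by
        refine Nat.sInf_eq_zero.2 (.inl ⟨id, ?_⟩)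
        rintro ⟨N, hN⟩
        exact hy (hN (N + 1) (Nat.le_succ N)).1
      simp [Rules.stepFirst, h4, Rules.disp]
    rw [Rules.firstDispLaw, Measure.map_congr h3, Measure.map_const, measure_univ, one_smul]
  rw [firstLaw, h2, Measure.prod_dirac, Measure.map_map (by fun_prop) (by fun_prop)]
  simp only [Function.comp_def, add_zero]
  exact Measure.map_id

end ProcessLaw

/-! ### Laplace transforms of the laws of the process -/

/-- The value at time 0 is prescribed by hand, which makes the initial conditions equalities by
construction; the law of the process at time 0 is then supplied by `map_state_zero`. -/
theorem exists_probabilityMeasure_eq (m : ProbabilityMeasure ℝ) (f : ℝ≥0∞ → Measure ℝ)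
    (hf : ∀ t, IsProbabilityMeasure (f t)) :
    ∃ g : ℝ≥0∞ → ProbabilityMeasure ℝ, g 0 = m ∧ ∀ t, t ≠ 0 → (g t : Measure ℝ) = f t := by
  let g : ℝ≥0∞ → ProbabilityMeasure ℝ := fun t => ⟨f t, hf t⟩
  exact ⟨Function.update g 0 m, Function.update_self .., fun t ht =>
    congrArg (fun p : ProbabilityMeasure ℝ => (p : Measure ℝ)) (Function.update_of_ne ht m g)⟩

theorem setIntegral_Ici_of_measure_Iio {m : Measure ℝ} {c : ℝ} (h : m (Set.Iio c) = 0)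
    (f : ℝ → ℂ) : ∫ x in Set.Ici c, f x ∂m = ∫ x, f x ∂m := by
  rw [Measure.restrict_eq_self_of_ae_mem]
  rw [ae_iff]
  simp only [Set.mem_Ici, not_le]
  exact h

theorem ofReal_laplaceReal (m : ProbabilityMeasure ℝ) (A : Set ℝ) (s : ℝ) :
    (laplaceReal m A s : ℂ) = laplace m A s := by
  rw [laplaceReal, laplace, ← integral_complex_ofReal]
  push_cast
  rfl

theorem laplaceReal_zero (m : ProbabilityMeasure ℝ) (A : Set ℝ) :
    laplaceReal m A 0 = (m : Measure ℝ).real A := by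
  simp [laplaceReal]

theorem laplace_zero (m : ProbabilityMeasure ℝ) (A : Set ℝ) :
    laplace m A 0 = ((m : Measure ℝ).real A : ℂ) := by
  rw [← laplaceReal_zero, ofReal_laplaceReal, Complex.ofReal_zero]

section Laws

variable {rateL rateR : ℝ → ℝ} (hL : Measurable rateL) (hR : Measurable rateR) {dmin dmax : ℝ}
  (hdmin : 0 < dmin) (hA1 : ∀ d, dmin ≤ d → (0 < rateL d + rateR d ↔ d < dmax))
  (μ : ProbabilityMeasure ℝ) (hμ : (μ : Measure ℝ) (Set.Iio dmin) = 0)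

include hL hR hdmin hA1 hμ

theorem integral_gapLaw (s : ℂ) (hs : 0 ≤ s.re) :
    1 - ∫ x in Set.Ici dmin, Complex.exp (-s * (x : ℂ)) ∂gapLaw rateL rateR (μ : Measure ℝ) ⊤ =
      (1 - laplace μ (Set.Ici dmin) s) * Complex.exp (laplace μ (Set.Ico dmin dmax) s) := by
  rw [setIntegral_Ici_of_measure_Iio (gapLaw_Iio hL hR hdmin _ hμ ⊤), laplace,
    setIntegral_Ici_of_measure_Iio hμ, gapLaw,
    (regular_rules hL hR (μ : Measure ℝ) ⊤).laplace_nextGapLaw measurable_fst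
      (ae_nonneg_gap hμ hdmin) s hs,
    integral_left_add_right hL hR hμ hA1 hdmin s hs, sub_sub_cancel,
    integral_fun_fst (fun x : ℝ => Complex.exp (-s * (x : ℂ))), probReal_univ, one_smul, laplace]

variable {γ : ℝ} (hγ : 0 ≤ γ) (hrate : ∀ d, dmin ≤ d → rateL d = γ * rateR d)

include hγ hrate

theorem integral_firstDispLaw (s : ℂ) (hs : 0 ≤ s.re) :
    ∫ x, Complex.exp (-s * (x : ℂ))
        ∂(rules rateL rateR ⊤).firstDispLaw Prod.fst ((μ : Measure ℝ).prod markLaw) =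
      Complex.exp ((laplace μ (Set.Ico dmin dmax) s - laplace μ (Set.Ico dmin dmax) 0) /
        (1 + (γ : ℂ))) := by
  rw [(regular_rules hL hR (μ : Measure ℝ) ⊤).laplace_firstDispLaw measurable_fst
      (ae_nonneg_gap hμ hdmin) s hs, integral_left hμ hA1 hγ hrate,
    measureReal_left hμ hA1 hγ hrate, laplace_zero, laplace, sub_div]
  push_cast
  rfl

theorem lintegral_firstDispLaw (s : ℝ) (hs : 0 ≤ s) :
    ∫⁻ x, ENNReal.ofReal (Real.exp (-s * x))
        ∂(rules rateL rateR ⊤).firstDispLaw Prod.fst ((μ : Measure ℝ).prod markLaw) =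
      ENNReal.ofReal (Real.exp ((laplaceReal μ (Set.Ico dmin dmax) s -
        laplaceReal μ (Set.Ico dmin dmax) 0) / (1 + γ))) := by
  have := (regular_rules hL hR (μ : Measure ℝ) ⊤).isProbabilityMeasure_firstDispLaw
    (g := Prod.fst) measurable_fst
  rw [← ofReal_integral_eq_lintegral_ofReal _ (ae_of_all _ fun x => (Real.exp_pos _).le)]
  · congr 1
    apply Complex.ofReal_injective
    rw [← integral_complex_ofReal]
    push_cast
    rw [ofReal_laplaceReal, ofReal_laplaceReal, Complex.ofReal_zero]
    exact integral_firstDispLaw hL hR hdmin hA1 μ hμ hγ hrate s (by simpa using hs)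
  · refine Integrable.of_bound (C := 1) (by fun_prop) ?_
    filter_upwards [ae_firstDispLaw_nonneg hL hR hdmin (μ : Measure ℝ) hμ ⊤] with x hx
    rw [Real.norm_eq_abs, Real.abs_exp, Real.exp_le_one_iff]
    nlinarith

theorem integral_firstLaw (ν : ProbabilityMeasure ℝ) (s : ℂ) (hs : 0 ≤ s.re) :
    ∫ x, Complex.exp (-s * (x : ℂ)) ∂firstLaw rateL rateR (ν : Measure ℝ) (μ : Measure ℝ) ⊤ =
      laplace ν Set.univ s * Complex.exp ((laplace μ (Set.Ico dmin dmax) s -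
        laplace μ (Set.Ico dmin dmax) 0) / (1 + (γ : ℂ))) := by
  have := (regular_rules hL hR (μ : Measure ℝ) ⊤).isProbabilityMeasure_firstDispLaw
    (g := Prod.fst) measurable_fst
  rw [firstLaw, integral_map (by fun_prop) (by fun_prop)]
  simp only [Complex.ofReal_add, mul_add, Complex.exp_add]
  rw [laplace, setIntegral_univ, integral_prod_mul (fun x : ℝ => Complex.exp (-s * (x : ℂ)))
      (fun x : ℝ => Complex.exp (-s * (x : ℂ))),
    integral_firstDispLaw hL hR hdmin hA1 μ hμ hγ hrate s hs]

theorem lintegral_firstLaw (ν : ProbabilityMeasure ℝ) (s : ℝ) (hs : 0 ≤ s) :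
    ∫⁻ x, ENNReal.ofReal (Real.exp (-s * x))
        ∂firstLaw rateL rateR (ν : Measure ℝ) (μ : Measure ℝ) ⊤ =
      laplaceExt ν s * ENNReal.ofReal (Real.exp ((laplaceReal μ (Set.Ico dmin dmax) s -
        laplaceReal μ (Set.Ico dmin dmax) 0) / (1 + γ))) := by
  have := (regular_rules hL hR (μ : Measure ℝ) ⊤).isProbabilityMeasure_firstDispLaw
    (g := Prod.fst) measurable_fst
  rw [firstLaw, lintegral_map (by fun_prop) (by fun_prop)]
  simp only [mul_add, Real.exp_add, ENNReal.ofReal_mul (Real.exp_pos _).le]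
  rw [lintegral_prod_mul (f := fun x : ℝ => ENNReal.ofReal (Real.exp (-s * x)))
      (g := fun x : ℝ => ENNReal.ofReal (Real.exp (-s * x))) (by fun_prop) (by fun_prop),
    lintegral_firstDispLaw hL hR hdmin hA1 μ hμ hγ hrate s hs, laplaceExt]

end Laws

end Coalescence

end

/-! ### The recursive identities -/

theorem theorem2p2 (dmin dmax : ℝ) (hdmin : 0 < dmin) (hdmax : dmin < dmax)
    (rateL rateR : ℝ → ℝ) (hLmeas : Measurable rateL) (hRmeas : Measurable rateR)
    (hL : ∀ d, dmin ≤ d → 0 ≤ rateL d) (hR : ∀ d, dmin ≤ d → 0 ≤ rateR d)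
    (hbdd : ∃ C : ℝ, ∀ d, dmin ≤ d → rateL d ≤ C ∧ rateR d ≤ C)
    (hA1 : ∀ d, dmin ≤ d → (0 < rateL d + rateR d ↔ d < dmax))
    (hA2 : ∀ d d' : ℝ, dmin ≤ d → dmin ≤ d' → dmax ≤ d + d')
    (ν μ : ProbabilityMeasure ℝ) (hμ : (μ : Measure ℝ) (Set.Iio dmin) = 0) :
    ∃ νt μt : ℝ≥0∞ → ProbabilityMeasure ℝ,
      -- `νt t` and `μt t` are the first point law and the interval law at time `t ∈ [0, ∞]`
      νt 0 = ν ∧ μt 0 = μ ∧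
      (∀ t, (μt t : Measure ℝ) (Set.Iio dmin) = 0) ∧
      (∀ t, Coalescence.lawAt rateL rateR (Coalescence.Ren ν μ) t =
        Coalescence.Ren (νt t) (μt t)) ∧
      -- the recursive identity for the interval law, for `s ∈ ℝ₊ ∪ iℝ`
      (∀ s : ℂ, (0 ≤ s.re ∧ s.im = 0) ∨ s.re = 0 →
        1 - Coalescence.laplace (μt ⊤) (Set.Ici dmin) s =
          (1 - Coalescence.laplace (μt 0) (Set.Ici dmin) s) *
            Complex.exp (Coalescence.laplace (μt 0) (Set.Ico dmin dmax) s)) ∧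
      -- the first point law when `rateR` vanishes
      ((∀ d, dmin ≤ d → rateR d = 0) →
        ∀ t, νt t = νt 0 ∧
          (∀ s : ℂ, s.re = 0 → Coalescence.laplace (νt t) Set.univ s =
            Coalescence.laplace (νt 0) Set.univ s) ∧
          (∀ s : ℝ, 0 ≤ s → Coalescence.laplaceExt (νt t) s =
            Coalescence.laplaceExt (νt 0) s)) ∧
      -- the first point law and the survival of the first point when `rateL = γ rateR`
      (∀ γ : ℝ, 0 ≤ γ → (∀ d, dmin ≤ d → rateL d = γ * rateR d) →
        (∀ s : ℂ, s.re = 0 → Coalescence.laplace (νt ⊤) Set.univ s =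
          Coalescence.laplace (νt 0) Set.univ s *
            Complex.exp ((Coalescence.laplace (μt 0) (Set.Ico dmin dmax) s -
              Coalescence.laplace (μt 0) (Set.Ico dmin dmax) 0) / (1 + (γ : ℂ)))) ∧
        (∀ s : ℝ, 0 ≤ s → Coalescence.laplaceExt (νt ⊤) s =
          Coalescence.laplaceExt (νt 0) s *
            ENNReal.ofReal (Real.exp
              ((Coalescence.laplaceReal (μt 0) (Set.Ico dmin dmax) s -
                Coalescence.laplaceReal (μt 0) (Set.Ico dmin dmax) 0) / (1 + γ)))) ∧
        Coalescence.firstPointSurvival rateL rateR (Coalescence.Ren ν μ) =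
          ENNReal.ofReal (Real.exp
            (-(Coalescence.laplaceReal (μt 0) (Set.Ico dmin dmax) 0) / (1 + γ)))) := by
  have hfirst := Coalescence.isProbabilityMeasure_firstLaw hLmeas hRmeas (ν : Measure ℝ)
    (μ : Measure ℝ)
  have hgap := Coalescence.isProbabilityMeasure_gapLaw hLmeas hRmeas (μ : Measure ℝ)
  obtain ⟨νt, hν0, hνt⟩ := Coalescence.exists_probabilityMeasure_eq ν _ hfirst
  obtain ⟨μt, hμ0, hμt⟩ := Coalescence.exists_probabilityMeasure_eq μ _ hgap
  have htop : (⊤ : ℝ≥0∞) ≠ 0 := ENNReal.top_ne_zero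
  refine ⟨νt, μt, hν0, hμ0, fun t => ?_, fun t => ?_, fun s hs => ?_, fun hrateR t => ?_,
    fun γ hγ hrate => ⟨fun s hs => ?_, fun s hs => ?_, ?_⟩⟩
  · rcases eq_or_ne t 0 with rfl | ht
    · rwa [hμ0]
    · rw [hμt t ht]
      exact Coalescence.gapLaw_Iio hLmeas hRmeas hdmin _ hμ t
  · rcases eq_or_ne t 0 with rfl | ht
    · rw [hν0, hμ0]
      exact Coalescence.map_state_zero hLmeas hRmeas hdmin _ _ hμ
    · rw [Coalescence.Ren, Coalescence.Ren, hνt t ht, hμt t ht]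
      exact Coalescence.map_state hLmeas hRmeas hdmin _ _ hμ t
  · rw [hμ0, Coalescence.laplace, hμt ⊤ htop]
    exact Coalescence.integral_gapLaw hLmeas hRmeas hdmin hA1 μ hμ s
      -- Both half-lines of `s` lie in the closed right half-plane, which is all that the transform
      -- identity requires.
      (hs.elim And.left fun h => h.ge)
  · have ht : νt t = νt 0 := by
      rcases eq_or_ne t 0 with rfl | ht
      · rfl
      · exact Subtype.ext ((hνt t ht).trans
          ((Coalescence.firstLaw_eq_of_rateR _ _ hμ hrateR t).trans (congrArg Subtype.val hν0.symm)))
    exact ⟨ht, fun s _ => by rw [ht], fun s _ => by rw [ht]⟩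
  · rw [hν0, hμ0, Coalescence.laplace, hνt ⊤ htop, setIntegral_univ]
    exact Coalescence.integral_firstLaw hLmeas hRmeas hdmin hA1 μ hμ hγ hrate ν s hs.ge
  · rw [hν0, hμ0, Coalescence.laplaceExt, hνt ⊤ htop]
    exact Coalescence.lintegral_firstLaw hLmeas hRmeas hdmin hA1 μ hμ hγ hrate ν s hs
  · rw [hμ0, Coalescence.laplaceReal_zero, neg_div,
      ← Coalescence.measureReal_left hμ hA1 hγ hrate]
    exact Coalescence.measure_first_survives hLmeas hRmeas hdmin _ _ hμ
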